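/- Let $\hat U(N)$ be the set of signatures $\lambda=(\lambda_1\ge\dots\ge\lambda_N)\in\mathbb Z^N$, with rational Schur functions $\chi^\lambda(u_1,\dots,u_N)=\det(u_i^{\lambda_j+N-j})_{i,j}/\prod_{i<j}(u_i-u_j)$ (extended by continuity to points with coinciding nonzero coordinates). For $q\in[-1,1]$ let $$m_{N,PP(q)}[\lambda]=\frac1N\sum_{i=1}^N\Big(\prod_{j\ne i}\frac{(\lambda_i-i)-(\lambda_j-j)-q}{(\lambda_i-i)-(\lambda_j-j)}\Big)\,\delta\Big(\frac{\lambda_i+N-i}{N}\Big),$$ which is a probability measure on $\mathbb R$. For a probability measure $\varrho(N)$ on $\hat U(N)$ let $S_{\varrho(N)}(u)=\sum_{\lambda}\varrho(N)[\lambda]\,\chi^\lambda(u)/\chi^\lambda(1^N)$, and let $m_{N,PP(q)}[\varrho(N)]$ be the random measure $m_{N,PP(q)}[\lambda]$ with $\lambda$ distributed according to $\varrho(N)$. Put $e_q(u)=(1-qu)^{-1/q}$ for $q\neq 0$ and $e_0(u)=e^u$. Theorem. Let $\varrho(N)$, $N\in\mathbb N$, be probability measures on $\hat U(N)$ such that,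 for every $N$, the series $S_{\varrho(N)}$ converges uniformly in a (complex) neighborhood of $1^N=(1,\dots,1)$. Assume that there is a function $\Psi$, analytic in a neighborhood of $1$, such that for every fixed $r\in\mathbb N$ $$\lim_{N\to\infty}\frac1N\log S_{\varrho(N)}(u_1,\dots,u_r,1^{N-r})=\sum_{i=1}^r\Psi(u_i)$$ uniformly in a (complex) neighborhood of $1^r$ that does not depend on $N$, where $\log S_{\varrho(N)}$ is the analytic branch on this neighborhood, defined for all large $N$, that vanishes at $1^r$. Let $q\in[-1,1]$. Then there is a compactly supported probability measure $\mu^{(q)}$ on $\mathbb R$ such that for every integer $k\ge1$ the $k$-th moment of $m_{N,PP(q)}[\varrho(N)]$ converges in probability, as $N\to\infty$, to the $k$-th moment of $\mu^{(q)}$, which equals $$\sum_{m=0}^{k-1}\frac{k!}{m!\,(m+1)!\,(k-m)!}\,\frac{d^m}{du^m}\Big(e_q(u)\Psi'(e_q(u))+\frac{e_q(u)}{e_q(u)-1}-\frac1u\Big)^{k-m}\Big|_{u=0}$$ (the removable singularity at $u=0$ being removed). Moreover, for all $z\in\mathbb C$ with $|z|$ small, the $R$-transform of $\mu^{(q)}$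 is $$R_{\mu^{(q)}}(z)=e_q(z)\Psi'(e_q(z))+R_{\beta(1-q,1+q)}(z),\qquad R_{\beta(1-q,1+q)}(z)=\frac{e_q(z)}{e_q(z)-1}-\frac1z\quad(z\neq0).$$ Here the $R$-transform $R_\mu$ of a compactly supported probability measure $\mu$ is the function, analytic near $0$, such that $z\mapsto R_\mu(z)+1/z$ is the compositional inverse near $0$ of the Stieltjes transform $G_\mu(z)=\int(z-t)^{-1}\mu(dt)$, and $\beta(1-q,1+q)$ is the beta distribution, understood as $\delta_0$ for $q=1$ and $\delta_1$ for $q=-1$. -/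

import Mathlib

open Filter Topology MeasureTheory ProbabilityTheory
open scoped Nat

noncomputable section

namespace PerelomovPopov

/-- Signatures of length `N`: non-increasing `N`-tuples of integers
`λ_1 ≥ ⋯ ≥ λ_N`.  They label the irreducible representations of `U(N)`. -/
abbrev Signature (N : ℕ) : Type := {l : Fin N → ℤ // Antitone l}

/-- The strictly decreasing integers `λ_i + N - i`.  Since `Fin N` is indexed from `0`, the
`i`-th entry in the usual numbering is the entry with index `i - 1`, hence the `- 1`. -/
def Signature.shifted {N : ℕ} (l : Signature N) (i : Fin N) : ℤ :=
  l.1 i + (N : ℤ) - 1 - (i : ℤ)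

/-- The weight `∏_{j ≠ i} ((λ_i - i) - (λ_j - j) - q) / ((λ_i - i) - (λ_j - j))`. -/
def ppWeight (q : ℝ) {N : ℕ} (l : Signature N) (i : Fin N) : ℝ :=
  ∏ j ∈ Finset.univ.erase i,
    (((l.shifted i - l.shifted j : ℤ) : ℝ) - q) / ((l.shifted i - l.shifted j : ℤ) : ℝ)

/-- The `q`-deformed Perelomov-Popov measure
`(1 / N) ∑_i weight_i δ ((λ_i + N - i) / N)`, for `q ∈ [-1, 1]`.  For such `q` every weight is
nonnegative, because the `λ_i - i` are distinct integers, so that `ENNReal.ofReal` does not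
change it. -/
def ppMeasure (q : ℝ) {N : ℕ} (l : Signature N) : Measure ℝ :=
  ∑ i : Fin N, ENNReal.ofReal ((N : ℝ)⁻¹ * ppWeight q l i) •
    Measure.dirac ((l.shifted i : ℝ) / (N : ℝ))

/-- The quotient `det (u_i ^ (λ_j + N - j)) / ∏_{i < j} (u_i - u_j)`, meaningful when the
`u_i` are distinct and nonzero. -/
def schurRatio {N : ℕ} (l : Signature N) (u : Fin N → ℂ) : ℂ :=
  (Matrix.of fun i j : Fin N => u i ^ l.shifted j).det /
    ∏ i : Fin N, ∏ j ∈ Finset.Ioi i, (u i - u j)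

/-- The rational Schur function, that is, the character of the irreducible representation of
`U(N)` with signature `l`.  The quotient of determinants is a Laurent polynomial; at points with
coinciding coordinates its value is the limit of the quotient along points with distinct
coordinates. -/
def schurChar {N : ℕ} (l : Signature N) : (Fin N → ℂ) → ℂ :=
  extendFrom {u | Function.Injective u} (schurRatio l)

/-- The summand `ϱ[λ] χ^λ(u) / χ^λ(1^N)` of the Schur generating function. -/
def schurTerm {N : ℕ} (rho : PMF (Signature N)) (l : Signature N) (u : Fin N → ℂ) : ℂ :=
  ((rho l).toReal : ℂ) * (schurChar l u / schurChar l 1)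

/-- The Schur generating function `S_ϱ(u) = ∑_λ ϱ[λ] χ^λ(u) / χ^λ(1^N)`. -/
def schurGen {N : ℕ} (rho : PMF (Signature N)) (u : Fin N → ℂ) : ℂ :=
  ∑' l : Signature N, schurTerm rho l u

/-- The point `(u_1, …, u_r, 1^{N-r})`, for `r ≤ N`. -/
def padOne {r : ℕ} (N : ℕ) (u : Fin r → ℂ) : Fin N → ℂ :=
  fun i => if h : (i : ℕ) < r then u ⟨i, h⟩ else 1

/-- For every `r`, `(1/N) log S_{ϱ(N)}(u_1, …, u_r, 1^{N-r}) → ∑ Ψ(u_i)` as `N → ∞`, uniformly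
in a neighbourhood `U` of `1^r` which may depend on `r` but not on `N`.  Here `log S` is the
analytic branch of the logarithm that vanishes at `1^r` (where `S = 1`); the principal
branch would have imaginary part bounded in `N`. -/
def LogSchurGenTendsto (rho : (N : ℕ) → PMF (Signature N)) (Psi : ℂ → ℂ) : Prop :=
  ∀ r : ℕ, ∃ U : Set (Fin r → ℂ), IsOpen U ∧ (1 : Fin r → ℂ) ∈ U ∧
    ∃ L : ℕ → (Fin r → ℂ) → ℂ,
      (∀ᶠ N in atTop, AnalyticOnNhd ℂ (L N) U ∧ L N 1 = 0 ∧
        ∀ u ∈ U, Complex.exp (L N u) = schurGen (rho N) (padOne N u)) ∧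
      TendstoUniformlyOn (fun (N : ℕ) (u : Fin r → ℂ) => (N : ℂ)⁻¹ * L N u)
        (fun u => ∑ i, Psi (u i)) atTop U

/-- `e_q(u) = (1 - q u)^{-1/q}`, with `e_0(u) = exp u`. -/
def qExp (q : ℝ) (u : ℂ) : ℂ :=
  if q = 0 then Complex.exp u else (1 - (q : ℂ) * u) ^ (-(1 / (q : ℂ)))

/-- The function `e_q(u) Ψ'(e_q(u)) + e_q(u) / (e_q(u) - 1) - 1 / u`, with its removable
singularity at `u = 0` removed. -/
def qFun (q : ℝ) (Psi : ℂ → ℂ) : ℂ → ℂ :=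
  let F : ℂ → ℂ := fun u =>
    qExp q u * deriv Psi (qExp q u) + qExp q u / (qExp q u - 1) - 1 / u
  Function.update F 0 (limUnder (𝓝[≠] (0 : ℂ)) F)

/-- The sum
`∑_{m=0}^{k-1} k! / (m! (m+1)! (k-m)!) (d/du)^m (F(u)^{k-m})` at `u = 0`, where
`F(u) = e_q(u) Ψ'(e_q(u)) + e_q(u) / (e_q(u) - 1) - 1 / u`. -/
def limitMoment (q : ℝ) (Psi : ℂ → ℂ) (k : ℕ) : ℂ :=
  ∑ m ∈ Finset.range k,
    ((k ! : ℕ) : ℂ) / (((m ! : ℕ) : ℂ) * (((m + 1)! : ℕ) : ℂ) * (((k - m)! : ℕ) : ℂ)) *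
      iteratedDeriv m (fun u => qFun q Psi u ^ (k - m)) 0

/-- The Stieltjes (Cauchy) transform `G_μ(z) = ∫ μ(dt) / (z - t)`. -/
def stieltjes (mu : Measure ℝ) (z : ℂ) : ℂ := ∫ t, (z - (t : ℂ))⁻¹ ∂mu

/-- `mu` is supported in a bounded interval. -/
def CompactlySupported (mu : Measure ℝ) : Prop :=
  ∃ C : ℝ, mu (Set.Icc (-C) C)ᶜ = 0

/-- `R` is, near `0`, the `R`-transform of the compactly supported probability measure `mu`:
it is analytic at `0` and `z ↦ R z + 1 / z` is the compositional inverse of the Stieltjes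
transform of `mu`.  As `1 / z → ∞` for `z → 0` and the Stieltjes transform is injective near
infinity, this determines `R` near `0`. -/
def IsRTransform (mu : Measure ℝ) (R : ℂ → ℂ) : Prop :=
  IsProbabilityMeasure mu ∧ CompactlySupported mu ∧ AnalyticAt ℂ R 0 ∧
    ∀ᶠ z in 𝓝[≠] (0 : ℂ), stieltjes mu (R z + 1 / z) = z

/-- The beta distribution `β(1 - q, 1 + q)` for `q ∈ [-1, 1]`; for the boundary values it
degenerates to `β(0, 2) = δ_0` and `β(2, 0) = δ_1`. -/
def betaLaw (q : ℝ) : Measure ℝ :=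
  if q = 1 then Measure.dirac 0
  else if q = -1 then Measure.dirac 1
  else betaMeasure (1 - q) (1 + q)

end PerelomovPopov

end

noncomputable section

namespace PerelomovPopov

/-! Write x_j = λ_j + N - j and u = e^s. The normalized character times ∏_{i<j} (e^{s_i} -
e^{s_j})/(s_i - s_j) is a symmetric analytic function of s with value 1 at 0, and its product with
the Vandermonde product of s is a multiple of det(e^{s_i x_j}). Adding t to one coordinate of s and
summing over the coordinate multiplies this determinant by ∑_j e^{t x_j} (`sum_expDet_shift`). Two
such shifts produce the sums ∑_{i,j} (t x_i + t' x_j)^n, hence all joint second moments of the power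
sums of λ.

The difficulty is that s = 0 is a zero of the Vandermonde product. The remedy is that the n-th
derivative of a symmetric function along a ray sees only the power sums of degree at most n of the
direction (`rayDeriv_eq_of_psum_eq`). Small multiples of the N-th roots of unity are distinct and
have vanishing power sums of degree 1, ..., N - 1, so they serve as a nondegenerate substitute for
0. At such a point the ratios of Vandermonde products are residues of an explicit rational function.
By the same principle the direction in N variables may be replaced by one supported on 2m variables
with m > n, where the hypothesis on the logarithm applies. The outcome is a double contour integral
with fixed contours (`hasSum_moments`).

With t = τ/N and t' = τ'/N the kernels converge to e^{τ/z} and e^{τ'/z'}, the interaction factor to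
1, and the derivative factor to one built from the additive limit of (1/N) log. The limit integral
is evaluated by residues and splits into products (`contourInt_contourInt_eval`). Thus the
expectation of a product of two counting moments tends to the product of their limits c_k; the
variance vanishes and convergence in probability for q = 0 follows from Chebyshev's inequality.

For other q, partial fractions identify 1 - q ∑ I_k X^{k+1}, with I_k the Perelomov-Popov moments,
with ∏ (1 - (y_j + q/N) X)/(1 - y_j X), where y_j = x_j/N. Its logarithmic derivative is linear in
the counting moments, so in the limit the series becomes exp(-q S), S(v) = ∑ c_k v^{k+1}
(`tendstoInProb_ppCoeff`). Lagrange inversion (`exists_inverse_reciprocalShift`) says that S inverts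
z/(1 + z F(z)), where F is the function for q = 0. Consequently (1 - exp(-q S))/q inverts the
analogous function with log e_q(z) in place of z, which is the function of the theorem (`qFun_spec`,
`reciprocalShift_qFun`); Lagrange inversion read backwards gives the moment formula.

The limit moments grow at most geometrically and are limits of moments of probability measures, so
they belong to a compactly supported probability measure (`exists_measure_of_tendsto_moments`).
Since S(1/w) is then the expansion of the Stieltjes transform at infinity, the inversion property is
the statement on the R-transform (`isRTransform_of_leftInverse`). The beta law is the case Ψ = 0,
checked on its moments (1-q)(2-q)...(k-q)/(k+1)!. -/

/-- The `n`-th derivative at `0` of `f` along the ray through `v`. -/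
def rayDeriv {E : Type*} [NormedAddCommGroup E] [NormedSpace ℂ E] (n : ℕ) (f : E → ℂ) (v : E) : ℂ :=
  iteratedDeriv n (fun θ : ℂ => f (θ • v)) 0

/-! ### Derivatives along rays, and symmetric functions through power sums -/

section RayDeriv

variable {E : Type*} [NormedAddCommGroup E] [NormedSpace ℂ E]

lemma rayDeriv_eq_of_hasFPowerSeriesAt {f : E → ℂ} {p : FormalMultilinearSeries ℂ E ℂ}
    (hp : HasFPowerSeriesAt f p 0) (n : ℕ) (v : E) :
    rayDeriv n f v = (n ! : ℂ) * p n (fun _ => v) := by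
  let L : ℂ →L[ℂ] E := ContinuousLinearMap.toSpanSingleton ℂ v
  have h1 : HasFPowerSeriesAt f p (L 0) := by simpa using hp
  obtain ⟨r, hr⟩ := h1.compContinuousLinearMap (u := L)
  have h2 := hr.factorial_smul 1 n
  rw [rayDeriv, iteratedDeriv_eq_iteratedFDeriv]
  have h3 : (f ∘ L) = fun θ : ℂ => f (θ • v) := by
    ext θ; simp [L]
  rw [h3] at h2
  rw [← h2]
  simp [FormalMultilinearSeries.compContinuousLinearMap, L]

lemma analyticAt_ray {f : E → ℂ} (hf : AnalyticAt ℂ f 0) (v : E) :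
    AnalyticAt ℂ (fun θ : ℂ => f (θ • v)) 0 := by
  have h : AnalyticAt ℂ (fun θ : ℂ => θ • v) 0 := by fun_prop
  exact AnalyticAt.fun_comp (by simpa using hf) h

lemma rayDeriv_smul {f : E → ℂ} (hf : AnalyticAt ℂ f 0) (n : ℕ) (c : ℂ) (v : E) :
    rayDeriv n f (c • v) = c ^ n * rayDeriv n f v := by
  obtain ⟨p, hp⟩ := hf
  rw [rayDeriv_eq_of_hasFPowerSeriesAt hp, rayDeriv_eq_of_hasFPowerSeriesAt hp]
  have := (p n).map_smul_univ (fun _ => c) (fun _ => v)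
  simp only [Finset.prod_const, Finset.card_univ, Fintype.card_fin, smul_eq_mul] at this
  rw [this]; ring

end RayDeriv

open MvPolynomial in
-- Expanding the n-th multilinear Taylor coefficient in the standard basis gives a polynomial. This
-- brings the theory of symmetric polynomials to bear on analytic functions.
lemma exists_mvPolynomial_rayDeriv {ι : Type*} [Fintype ι] [DecidableEq ι] {f : (ι → ℂ) → ℂ}
    (hf : AnalyticAt ℂ f 0) (n : ℕ) :
    ∃ P : MvPolynomial ι ℂ, ∀ v, rayDeriv n f v = eval v P := by
  obtain ⟨p, hp⟩ := hf
  refine ⟨C (n ! : ℂ) * ∑ r : Fin n → ι, C (p n (fun i => Pi.single (r i) 1)) * ∏ i, X (r i), ?_⟩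
  intro v
  rw [rayDeriv_eq_of_hasFPowerSeriesAt hp]
  have hv : v = ∑ i, v i • (Pi.single i 1 : ι → ℂ) := by
    ext j; simp [Finset.sum_apply, Pi.single_apply]
  have h1 : p n (fun _ => v) = p n (fun _ : Fin n => ∑ i, v i • (Pi.single i 1 : ι → ℂ)) := by
    rw [← hv]
  rw [h1]
  have h2 := (p n).toMultilinearMap.map_sum (fun (_ : Fin n) (i : ι) => v i • (Pi.single i 1 : ι → ℂ))
  simp only [ContinuousMultilinearMap.coe_coe] at h2
  rw [h2]
  simp only [map_mul, eval_C, map_sum, map_prod, eval_X]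
  congr 1
  refine Finset.sum_congr rfl fun r _ => ?_
  rw [(p n).map_smul_univ (fun i => v (r i)) (fun i => Pi.single (r i) 1), smul_eq_mul, mul_comm]

open MvPolynomial in
lemma differentiable_rayDeriv {ι : Type*} [Fintype ι] [DecidableEq ι] {f : (ι → ℂ) → ℂ}
    (hf : AnalyticAt ℂ f 0) (n : ℕ) : Differentiable ℂ (rayDeriv n f) := by
  obtain ⟨p, hp⟩ := hf
  rw [funext (rayDeriv_eq_of_hasFPowerSeriesAt hp n)]
  refine Differentiable.const_mul ?_ _
  have : ContDiff ℂ 1 (fun v : ι → ℂ => p n (fun _ => v)) := by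
    refine (p n).contDiff.comp ?_
    fun_prop
  exact this.differentiable (by norm_num)

open MvPolynomial in
-- Newton's identities express j e_j through lower e_i and power sums of degree at most j, and j is
-- invertible in ℂ.
lemma eval_esymm_eq_of_psum_eq {ι : Type*} [Fintype ι] {a b : ι → ℂ} {k : ℕ}
    (h : ∀ j, 1 ≤ j → j ≤ k → ∑ i, a i ^ j = ∑ i, b i ^ j) :
    ∀ j ≤ k, eval a (esymm ι ℂ j) = eval b (esymm ι ℂ j) := by
  intro j
  induction j using Nat.strong_induction_on with
  | _ j ih =>
    intro hj
    rcases Nat.eq_zero_or_pos j with rfl | hpos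
    · simp
    · have hj0 : (j : ℂ) ≠ 0 := by exact_mod_cast hpos.ne'
      apply mul_left_cancel₀ hj0
      have hN := mul_esymm_eq_sum ι ℂ j
      have ha := congrArg (eval a) hN
      have hb := congrArg (eval b) hN
      simp only [map_mul, map_natCast, map_sum, map_pow, map_neg, map_one] at ha hb
      rw [ha, hb]
      congr 1
      refine Finset.sum_congr rfl fun x hx => ?_
      rw [Finset.mem_filter] at hx
      have hx1 := Finset.HasAntidiagonal.mem_antidiagonal.mp hx.1
      have hx2 := hx.2
      rw [ih x.1 hx.2 (by omega)]
      congr 1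
      simp only [psum, map_sum, map_pow, eval_X]
      exact h x.2 (by omega) (by omega)

open MvPolynomial in
/-- The derivatives of order `n` along rays of a symmetric analytic function depend only on the
power sums of degree at most `n`. -/
theorem rayDeriv_eq_of_psum_eq {ι : Type*} [Fintype ι] [DecidableEq ι] {f : (ι → ℂ) → ℂ}
    (hf : AnalyticAt ℂ f 0) (hsymm : ∀ σ : Equiv.Perm ι, ∀ᶠ s in 𝓝 (0 : ι → ℂ), f (s ∘ σ) = f s)
    {n : ℕ} {a b : ι → ℂ} (h : ∀ j, 1 ≤ j → j ≤ n → ∑ i, a i ^ j = ∑ i, b i ^ j) :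
    rayDeriv n f a = rayDeriv n f b := by
  obtain ⟨P, hP⟩ := exists_mvPolynomial_rayDeriv hf n
  have hPs : P.IsSymmetric := by
    intro σ
    apply MvPolynomial.funext
    intro v
    rw [eval_rename, ← hP, ← hP]
    unfold rayDeriv
    apply Filter.EventuallyEq.iteratedDeriv_eq
    have h1 : Tendsto (fun θ : ℂ => θ • v) (𝓝 0) (𝓝 0) := by
      have : Continuous (fun θ : ℂ => θ • v) := by fun_prop
      simpa using this.tendsto 0
    filter_upwards [h1.eventually (hsymm σ)] with θ hθ
    rw [← hθ]; rfl
  -- Fundamental theorem of symmetric polynomials: P is a polynomial Q in the elementary symmetric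
  -- ones.
  obtain ⟨Q, hQ⟩ := esymmAlgHom_surjective (σ := ι) ℂ (n := Fintype.card ι) le_rfl ⟨P, hPs⟩
  have hQ' : P = aeval (fun i : Fin (Fintype.card ι) => esymm ι ℂ (i + 1)) Q := by
    have := congrArg Subtype.val hQ
    rw [esymmAlgHom_apply] at this
    exact this.symm
  -- `A c` is θ ↦ P(θ c) as a polynomial in θ, written through Q: scaling the point multiplies
  -- e_{i+1} by θ^{i+1}. Homogeneity of P makes it a monomial of degree n.
  let A : (ι → ℂ) → Polynomial ℂ := fun c =>
    aeval (fun i : Fin (Fintype.card ι) =>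
      Polynomial.C (eval c (esymm ι ℂ (i + 1))) * Polynomial.X ^ (i.1 + 1)) Q
  have hes : ∀ (c : ι → ℂ) (θ : ℂ) (j : ℕ),
      eval (θ • c) (esymm ι ℂ j) = θ ^ j * eval c (esymm ι ℂ j) := by
    intro c θ j
    simp only [esymm, map_sum, map_prod, eval_X, Pi.smul_apply, smul_eq_mul, Finset.mul_sum]
    refine Finset.sum_congr rfl fun t ht => ?_
    rw [Finset.prod_mul_distrib, Finset.prod_const, (Finset.mem_powersetCard.mp ht).2]
  have hA : ∀ c : ι → ℂ, A c = Polynomial.C (eval c P) * Polynomial.X ^ n := by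
    intro c
    apply Polynomial.funext
    intro θ
    have h1 : eval (θ • c) P = θ ^ n * eval c P := by
      rw [← hP, ← hP, rayDeriv_smul hf]
    simp only [Polynomial.eval_mul, Polynomial.eval_C, Polynomial.eval_pow, Polynomial.eval_X]
    rw [mul_comm, ← h1, hQ']
    have e1 : Polynomial.eval θ (A c) = aeval (fun i : Fin (Fintype.card ι) =>
        eval c (esymm ι ℂ (i + 1)) * θ ^ (i.1 + 1)) Q := by
      have := comp_aeval_apply (fun i : Fin (Fintype.card ι) =>
        Polynomial.C (eval c (esymm ι ℂ (i + 1))) * Polynomial.X ^ (i.1 + 1))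
        (Polynomial.aeval (R := ℂ) θ) Q
      simp only [A]
      rw [← Polynomial.coe_aeval_eq_eval]
      erw [this]
      simp
    have e2 : eval (θ • c) (aeval (fun i : Fin (Fintype.card ι) => esymm ι ℂ (i + 1)) Q) =
        aeval (fun i : Fin (Fintype.card ι) => eval (θ • c) (esymm ι ℂ (i + 1))) Q := by
      have := comp_aeval_apply (fun i : Fin (Fintype.card ι) => esymm ι ℂ (i.1 + 1))
        (aeval (R := ℂ) (θ • c)) Q
      rw [← coe_aeval_eq_eval]
      erw [this]
      rfl
    rw [e1, e2]
    simp_rw [hes, mul_comm]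
  -- Modulo X^{n+1} the elementary symmetric functions of degree above n disappear, and those of
  -- degree at most n agree at a and b. Comparing coefficients of X^n then finishes the proof.
  have hcongr : Polynomial.X ^ (n + 1) ∣ A a - A b := by
    rw [← Ideal.mem_span_singleton, ← Ideal.Quotient.eq]
    have key : ∀ c, Ideal.Quotient.mk (Ideal.span {(Polynomial.X : Polynomial ℂ) ^ (n + 1)}) (A c) =
        aeval (fun i : Fin (Fintype.card ι) => Ideal.Quotient.mk
          (Ideal.span {(Polynomial.X : Polynomial ℂ) ^ (n + 1)})
          (Polynomial.C (eval c (esymm ι ℂ (i + 1))) * Polynomial.X ^ (i.1 + 1))) Q := by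
      intro c
      exact comp_aeval_apply _ (Ideal.Quotient.mkₐ ℂ
        (Ideal.span {(Polynomial.X : Polynomial ℂ) ^ (n + 1)})) Q
    rw [key, key]
    congr 2
    funext i
    by_cases hi : i.1 + 1 ≤ n
    · rw [eval_esymm_eq_of_psum_eq h _ hi]
    · rw [Ideal.Quotient.eq, ← sub_mul, Ideal.mem_span_singleton]
      exact Dvd.dvd.mul_left (pow_dvd_pow _ (by omega)) _
  rw [Polynomial.X_pow_dvd_iff] at hcongr
  have := hcongr n (Nat.lt_succ_self n)
  rw [hA, hA] at this
  simp only [Polynomial.coeff_sub, Polynomial.coeff_C_mul, Polynomial.coeff_X_pow, if_true,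
    mul_one] at this
  rw [hP, hP]
  exact sub_eq_zero.mp this

lemma analyticAt_coord {ι : Type*} [Fintype ι] (i : ι) (u : ι → ℂ) :
    AnalyticAt ℂ (fun u : ι → ℂ => u i) u :=
  (ContinuousLinearMap.proj (R := ℂ) i : (ι → ℂ) →L[ℂ] ℂ).analyticAt u

/-! ### The Schur function as an explicit symmetric Laurent polynomial -/

section Remainder

variable {N : ℕ}

/-- The monic polynomial with roots `u i`. -/
def rootPoly (u : Fin N → ℂ) : Polynomial ℂ := ∏ i, (Polynomial.X - Polynomial.C (u i))

/-- The coefficients of the remainder of `X ^ n` modulo `∏ (X - u i)`. -/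
def powRem (u : Fin N → ℂ) : ℕ → ℕ → ℂ
  | 0, l => if l = 0 then 1 else 0
  | n + 1, l => (if l = 0 then 0 else powRem u n (l - 1)) -
      powRem u n (N - 1) * (rootPoly u).coeff l

lemma rootPoly_comp_perm (u : Fin N → ℂ) (σ : Equiv.Perm (Fin N)) :
    rootPoly (u ∘ σ) = rootPoly u :=
  Equiv.prod_comp σ (fun i => Polynomial.X - Polynomial.C (u i))

lemma powRem_comp_perm (u : Fin N → ℂ) (σ : Equiv.Perm (Fin N)) (n l : ℕ) :
    powRem (u ∘ σ) n l = powRem u n l := by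
  induction n generalizing l with
  | zero => rfl
  | succ n ih => simp only [powRem, ih, rootPoly_comp_perm]

/-- Passing from n to n + 1 multiplies the remainder by X and subtracts the leading coefficient
times the monic polynomial `rootPoly u`, which vanishes at each u_i. -/
lemma sum_powRem (u : Fin N → ℂ) (n : ℕ) (i : Fin N) :
    ∑ l : Fin N, powRem u n l * u i ^ (l : ℕ) = u i ^ n := by
  obtain ⟨K, rfl⟩ : ∃ K, N = K + 1 := ⟨N - 1, by have := i.2; omega⟩
  rw [Fin.sum_univ_eq_sum_range (fun l => powRem u n l * u i ^ l)]
  induction n with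
  | zero => simp [powRem]
  | succ n ih =>
    have hdeg : (rootPoly u).natDegree = K + 1 := by
      simp [rootPoly, Polynomial.natDegree_finsetProd_X_sub_C_eq_card]
    have hmonic : (rootPoly u).coeff (K + 1) = 1 := by
      have : (rootPoly u).Monic := Polynomial.monic_prod_X_sub_C _ _
      have h2 := this.coeff_natDegree
      rwa [hdeg] at h2
    have heval : (rootPoly u).eval (u i) = 0 := by
      rw [rootPoly, Polynomial.eval_prod]
      exact Finset.prod_eq_zero (Finset.mem_univ i) (by simp)
    rw [Polynomial.eval_eq_sum_range, hdeg, Finset.sum_range_succ, hmonic] at heval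
    simp only [powRem, sub_mul, Finset.sum_sub_distrib, mul_assoc]
    rw [← Finset.mul_sum]
    have h1 : ∑ l ∈ Finset.range (K + 1), (rootPoly u).coeff l * u i ^ l = - u i ^ (K + 1) := by
      linear_combination heval
    rw [h1, Finset.sum_range_succ' (fun l => (if l = 0 then 0 else powRem u n (l - 1)) * u i ^ l)]
    rw [Finset.sum_range_succ] at ih
    simp only [Nat.add_sub_cancel, Nat.add_eq_zero_iff, one_ne_zero, and_false, if_false, if_true,
      pow_succ, ← mul_assoc, ← Finset.sum_mul]
    linear_combination (u i) * ih

lemma analyticAt_coeff_prod (s : Finset (Fin N)) (l : ℕ) (u : Fin N → ℂ) :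
    AnalyticAt ℂ (fun u : Fin N → ℂ =>
      (∏ i ∈ s, (Polynomial.X - Polynomial.C (u i))).coeff l) u := by
  induction s using Finset.induction_on generalizing l with
  | empty => simp only [Finset.prod_empty]; exact analyticAt_const
  | insert i s hi ih =>
    simp only [Finset.prod_insert hi, sub_mul]
    have hproj : AnalyticAt ℂ (fun u : Fin N → ℂ => u i) u :=
      analyticAt_coord i u
    cases l with
    | zero =>
      simp only [Polynomial.coeff_sub, Polynomial.coeff_C_mul, Polynomial.coeff_X_mul_zero]
      exact analyticAt_const.sub (hproj.mul (ih 0))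
    | succ l =>
      simp only [Polynomial.coeff_sub, Polynomial.coeff_C_mul, Polynomial.coeff_X_mul]
      exact (ih l).sub (hproj.mul (ih (l + 1)))

lemma analyticAt_powRem (n l : ℕ) (u : Fin N → ℂ) :
    AnalyticAt ℂ (fun u : Fin N → ℂ => powRem u n l) u := by
  induction n generalizing l with
  | zero => simp only [powRem]; exact analyticAt_const
  | succ n ih =>
    simp only [powRem]
    refine AnalyticAt.sub ?_ ((ih _).mul (analyticAt_coeff_prod _ _ _))
    by_cases hl : l = 0
    · simp only [hl, if_true]; exact analyticAt_const
    · simp only [hl, if_false]; exact ih _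

/-- Reducing each power modulo ∏ (X - u_i) writes the alternant as a matrix product, so the
Vandermonde determinant splits off. The other factor has entries that are symmetric and polynomial
in u, and it makes sense at coinciding points. -/
lemma det_pow_eq (u : Fin N → ℂ) (n : Fin N → ℕ) :
    (Matrix.of fun i j : Fin N => u i ^ n j).det =
      (Matrix.vandermonde u).det *
        (Matrix.of fun l j : Fin N => powRem u (n j) l).det := by
  rw [← Matrix.det_mul]
  congr 1
  ext i j
  simp only [Matrix.of_apply, Matrix.mul_apply, Matrix.vandermonde_apply]
  rw [← sum_powRem u (n j) i]
  exact Finset.sum_congr rfl fun l _ => mul_comm _ _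

end Remainder

/-- The product `∏_{i < j} (s_i - s_j)`. -/
def diffProd {N : ℕ} (s : Fin N → ℂ) : ℂ := ∏ i : Fin N, ∏ j ∈ Finset.Ioi i, (s i - s j)

lemma diffProd_ne_zero {N : ℕ} {s : Fin N → ℂ} (hs : Function.Injective s) : diffProd s ≠ 0 := by
  refine Finset.prod_ne_zero_iff.mpr fun i _ => Finset.prod_ne_zero_iff.mpr fun j hj => ?_
  exact sub_ne_zero.mpr fun h => (Finset.mem_Ioi.mp hj).ne (hs h)

/-- The sign relating the two orders of the factors of the Vandermonde determinant. -/
def pairSign (N : ℕ) : ℂ := ∏ i : Fin N, ∏ _j ∈ Finset.Ioi i, (-1 : ℂ)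

lemma det_vandermonde_eq_diffProd {N : ℕ} (u : Fin N → ℂ) :
    (Matrix.vandermonde u).det = pairSign N * diffProd u := by
  rw [Matrix.det_vandermonde, pairSign, diffProd, ← Finset.prod_mul_distrib]
  refine Finset.prod_congr rfl fun i _ => ?_
  rw [← Finset.prod_mul_distrib]
  exact Finset.prod_congr rfl fun j _ => by ring

section Schur

variable {N : ℕ} (l : Signature N)

/-- A natural number `M` such that all exponents `λ_j + N - j + M` are nonnegative. -/
def Signature.bound : ℕ := ∑ j, (l.shifted j).natAbs

lemma Signature.shifted_add_bound_nonneg (j : Fin N) : 0 ≤ l.shifted j + l.bound := by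
  have h : (l.shifted j).natAbs ≤ l.bound :=
    Finset.single_le_sum (f := fun j => (l.shifted j).natAbs) (fun _ _ => Nat.zero_le _)
      (Finset.mem_univ j)
  omega

/-- The Schur function as an explicit Laurent polynomial. -/
def schurLaurent (u : Fin N → ℂ) : ℂ :=
  (∏ i, u i ^ l.bound)⁻¹ * (pairSign N *
    (Matrix.of fun k j : Fin N => powRem u (l.shifted j + l.bound).toNat k).det)

lemma schurLaurent_mul_diffProd {u : Fin N → ℂ} (hu : ∀ i, u i ≠ 0) :
    schurLaurent l u * diffProd u = (Matrix.of fun i j : Fin N => u i ^ l.shifted j).det := by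
  have h1 : (Matrix.of fun i j : Fin N => u i ^ (l.shifted j + l.bound).toNat) =
      Matrix.of fun i j => u i ^ l.bound * (Matrix.of fun i j => u i ^ l.shifted j) i j := by
    ext i j
    simp only [Matrix.of_apply]
    rw [← zpow_natCast, Int.toNat_of_nonneg (l.shifted_add_bound_nonneg j), zpow_add₀ (hu i),
      zpow_natCast, mul_comm]
  have h2 := det_pow_eq u (fun j => (l.shifted j + l.bound).toNat)
  rw [h1, Matrix.det_mul_column, det_vandermonde_eq_diffProd] at h2
  have h3 : ∏ i, u i ^ l.bound ≠ 0 :=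
    Finset.prod_ne_zero_iff.mpr fun i _ => pow_ne_zero _ (hu i)
  rw [schurLaurent]
  field_simp
  rw [h2]; ring

lemma analyticAt_schurLaurent {u : Fin N → ℂ} (hu : ∀ i, u i ≠ 0) :
    AnalyticAt ℂ (schurLaurent l) u := by
  unfold schurLaurent
  refine AnalyticAt.mul (AnalyticAt.inv ?_ ?_) (AnalyticAt.mul analyticAt_const ?_)
  · refine Finset.analyticAt_fun_prod _ fun i _ => AnalyticAt.pow ?_ _
    exact analyticAt_coord i u
  · exact Finset.prod_ne_zero_iff.mpr fun i _ => pow_ne_zero _ (hu i)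
  · simp only [Matrix.det_apply, Matrix.of_apply]
    refine Finset.analyticAt_fun_sum _ fun σ _ => ?_
    simp only [Units.smul_def, zsmul_eq_mul]
    exact analyticAt_const.mul (Finset.analyticAt_fun_prod _ fun i _ => analyticAt_powRem _ _ _)

lemma schurLaurent_comp_perm (u : Fin N → ℂ) (σ : Equiv.Perm (Fin N)) :
    schurLaurent l (u ∘ σ) = schurLaurent l u := by
  simp only [schurLaurent, powRem_comp_perm]
  congr 2
  exact Equiv.prod_comp σ (fun i => u i ^ l.bound)

/-- The perturbation u_i + ε i separates all coordinates except for finitely many ε. Density makes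
the value of `extendFrom` at coinciding points a genuine limit. -/
lemma dense_injective : Dense {u : Fin N → ℂ | Function.Injective u} := by
  intro u
  have hev : ∀ᶠ ε : ℂ in 𝓝[≠] 0, Function.Injective (fun i : Fin N => u i + ε * (i : ℂ)) := by
    have : ∀ i j : Fin N, i ≠ j →
        ∀ᶠ ε : ℂ in 𝓝[≠] 0, u i + ε * (i : ℂ) ≠ u j + ε * (j : ℂ) := by
      intro i j hij
      have hij' : (j : ℂ) - (i : ℂ) ≠ 0 := by
        rw [sub_ne_zero]
        intro h
        exact hij (Fin.ext (Nat.cast_injective h).symm)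
      have hmem : {((u i - u j) / ((j : ℂ) - (i : ℂ)))}ᶜ ∈ 𝓝[≠] (0 : ℂ) := by
        by_cases h0 : (u i - u j) / ((j : ℂ) - (i : ℂ)) = 0
        · rw [h0]; exact self_mem_nhdsWithin
        · exact mem_nhdsWithin_of_mem_nhds (isOpen_compl_singleton.mem_nhds (Ne.symm h0))
      filter_upwards [hmem] with ε hε h
      apply hε
      rw [Set.mem_singleton_iff, eq_div_iff hij']
      linear_combination -h
    have h2 : ∀ᶠ ε : ℂ in 𝓝[≠] 0, ∀ i j : Fin N, i ≠ j →
        u i + ε * (i : ℂ) ≠ u j + ε * (j : ℂ) := by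
      simp only [eventually_all]
      exact this
    filter_upwards [h2] with ε hε i j hij
    by_contra hne
    exact hε i j hne hij
  have ht : Tendsto (fun ε : ℂ => fun i : Fin N => u i + ε * (i : ℂ)) (𝓝[≠] 0) (𝓝 u) := by
    have hc : Continuous (fun ε : ℂ => fun i : Fin N => u i + ε * (i : ℂ)) := by fun_prop
    have := hc.tendsto 0
    simp only [zero_mul, add_zero] at this
    exact this.mono_left nhdsWithin_le_nhds
  exact mem_closure_of_tendsto ht hev

lemma schurChar_eq_schurLaurent {u : Fin N → ℂ} (hu : ∀ i, u i ≠ 0) :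
    schurChar l u = schurLaurent l u := by
  refine extendFrom_eq (dense_injective u) ?_
  have hc : Tendsto (schurLaurent l) (𝓝[{u | Function.Injective u}] u) (𝓝 (schurLaurent l u)) :=
    (analyticAt_schurLaurent l hu).continuousAt.mono_left nhdsWithin_le_nhds
  refine hc.congr' ?_
  have hne : ∀ᶠ v in 𝓝 u, ∀ i, v i ≠ 0 := by
    rw [eventually_all]
    intro i
    exact (continuous_apply i).continuousAt.eventually_ne (hu i)
  filter_upwards [self_mem_nhdsWithin, mem_nhdsWithin_of_mem_nhds hne] with v hv hv0
  rw [schurRatio, ← schurLaurent_mul_diffProd l hv0]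
  exact (mul_div_cancel_right₀ _ (diffProd_ne_zero hv)).symm

lemma schurChar_mul_diffProd {u : Fin N → ℂ} (hu : ∀ i, u i ≠ 0) :
    schurChar l u * diffProd u = (Matrix.of fun i j : Fin N => u i ^ l.shifted j).det := by
  rw [schurChar_eq_schurLaurent l hu, schurLaurent_mul_diffProd l hu]

lemma analyticAt_schurChar {u : Fin N → ℂ} (hu : ∀ i, u i ≠ 0) :
    AnalyticAt ℂ (schurChar l) u := by
  refine (analyticAt_schurLaurent l hu).congr ?_
  have hne : ∀ᶠ v in 𝓝 u, ∀ i, v i ≠ 0 := by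
    rw [eventually_all]
    intro i
    exact (continuous_apply i).continuousAt.eventually_ne (hu i)
  filter_upwards [hne] with v hv
  exact (schurChar_eq_schurLaurent l hv).symm

lemma schurChar_comp_perm {u : Fin N → ℂ} (hu : ∀ i, u i ≠ 0) (σ : Equiv.Perm (Fin N)) :
    schurChar l (u ∘ σ) = schurChar l u := by
  rw [schurChar_eq_schurLaurent l hu, schurChar_eq_schurLaurent l (u := u ∘ σ) (fun i => hu (σ i)),
    schurLaurent_comp_perm]

end Schur

/-! ### Exponential coordinates -/

section ExpDiv

/-- The entire function `(e ^ a - e ^ b) / (a - b)`. -/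
def expDiv (a b : ℂ) : ℂ := Complex.exp b * dslope Complex.exp 0 (a - b)

lemma sub_mul_expDiv (a b : ℂ) : (a - b) * expDiv a b = Complex.exp a - Complex.exp b := by
  have h := sub_smul_dslope Complex.exp 0 (a - b)
  simp only [sub_zero, smul_eq_mul, Complex.exp_zero] at h
  rw [expDiv, mul_left_comm, h, Complex.exp_sub, mul_sub, mul_div_cancel₀ _ (Complex.exp_ne_zero b),
    mul_one]

lemma expDiv_self (a : ℂ) : expDiv a a = Complex.exp a := by
  simp [expDiv, dslope_same]

lemma expDiv_comm (a b : ℂ) : expDiv a b = expDiv b a := by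
  by_cases h : a = b
  · rw [h]
  · apply mul_left_cancel₀ (sub_ne_zero.mpr h)
    rw [sub_mul_expDiv, ← neg_sub b a, neg_mul, sub_mul_expDiv, neg_sub]

lemma differentiable_dslope_exp : Differentiable ℂ (dslope Complex.exp 0) := by
  rw [← differentiableOn_univ]
  exact (Complex.differentiableOn_dslope univ_mem).mpr Complex.differentiable_exp.differentiableOn

lemma analyticAt_expDiv {E : Type*} [NormedAddCommGroup E] [NormedSpace ℂ E] {f g : E → ℂ} {x : E}
    (hf : AnalyticAt ℂ f x) (hg : AnalyticAt ℂ g x) :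
    AnalyticAt ℂ (fun y => expDiv (f y) (g y)) x := by
  unfold expDiv
  refine AnalyticAt.mul hg.cexp' ?_
  exact AnalyticAt.fun_comp (g := dslope Complex.exp 0)
    (differentiable_dslope_exp.analyticAt _) (hf.sub hg)

/-- The known rule concerns antisymmetric functions of pairs. It is applied to the sign of the order
and to that sign times g; the two factors sign(σ) cancel. -/
lemma prod_pairs_comp_perm {N : ℕ} (σ : Equiv.Perm (Fin N)) {g : Fin N → Fin N → ℂ}
    (hg : ∀ i j, g i j = g j i) :
    ∏ i, ∏ j ∈ Finset.Ioi i, g (σ i) (σ j) = ∏ i, ∏ j ∈ Finset.Ioi i, g i j := by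
  let h1 : Fin N → Fin N → ℂ := fun i j => if i < j then 1 else if j < i then -1 else 0
  have hh1 : ∀ i j, h1 i j = -h1 j i := by
    intro i j
    simp only [h1]
    rcases lt_trichotomy i j with h | h | h
    · simp [h, h.not_gt]
    · simp [h]
    · simp [h, h.not_gt]
  have e1 := σ.prod_Ioi_comp_eq_sign_mul_prod hh1
  have e2 := σ.prod_Ioi_comp_eq_sign_mul_prod (f := fun i j => h1 i j * g i j)
    (fun i j => by rw [hh1 i j, hg i j]; ring)
  have e3 : ∏ i, ∏ j ∈ Finset.Ioi i, h1 i j = 1 :=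
    Finset.prod_eq_one fun i _ => Finset.prod_eq_one fun j hj => by
      simp [h1, Finset.mem_Ioi.mp hj]
  simp only [Finset.prod_mul_distrib, e1, e3, one_mul, mul_one] at e2
  refine mul_left_cancel₀ ?_ e2
  rcases Int.units_eq_one_or σ.sign with h | h <;> simp [h]

variable {N : ℕ}

/-- The product `∏_{i < j} (e ^ {s_i} - e ^ {s_j}) / (s_i - s_j)`. -/
def expDivProd (s : Fin N → ℂ) : ℂ := ∏ i : Fin N, ∏ j ∈ Finset.Ioi i, expDiv (s i) (s j)

lemma expDivProd_zero : expDivProd (0 : Fin N → ℂ) = 1 := by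
  simp [expDivProd, expDiv_self]

lemma expDivProd_comp_perm (s : Fin N → ℂ) (σ : Equiv.Perm (Fin N)) :
    expDivProd (s ∘ σ) = expDivProd s :=
  prod_pairs_comp_perm σ (g := fun i j => expDiv (s i) (s j)) fun _ _ => expDiv_comm _ _

lemma expDivProd_mul_diffProd (s : Fin N → ℂ) :
    expDivProd s * diffProd s = diffProd (fun i => Complex.exp (s i)) := by
  simp only [expDivProd, diffProd, ← Finset.prod_mul_distrib]
  refine Finset.prod_congr rfl fun i _ => Finset.prod_congr rfl fun j _ => ?_
  rw [mul_comm, sub_mul_expDiv]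

lemma analyticAt_expDivProd (s : Fin N → ℂ) : AnalyticAt ℂ (expDivProd (N := N)) s := by
  unfold expDivProd
  refine Finset.analyticAt_fun_prod _ fun i _ => Finset.analyticAt_fun_prod _ fun j _ => ?_
  exact analyticAt_expDiv
    (analyticAt_coord i s)
    (analyticAt_coord j s)

end ExpDiv

section IteratedDeriv

/-- Multiplying by a function whose derivatives of order `1, …, n` vanish. -/
lemma iteratedDeriv_mul_of_flat {g h : ℂ → ℂ} (hg : AnalyticAt ℂ g 0) (hh : AnalyticAt ℂ h 0)
    {n : ℕ} (hflat : ∀ j, 1 ≤ j → j ≤ n → iteratedDeriv j h 0 = 0) :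
    iteratedDeriv n (fun θ => g θ * h θ) 0 = iteratedDeriv n g 0 * h 0 := by
  rw [iteratedDeriv_fun_mul hg.contDiffAt hh.contDiffAt, Finset.sum_range_succ]
  rw [Finset.sum_eq_zero]
  · simp
  · intro i hi
    have := Finset.mem_range.mp hi
    rw [hflat (n - i) (by omega) (by omega), mul_zero]

/-- Weierstrass's theorem, iterated; holomorphy of the derivatives is carried along in the
induction. -/
lemma tendstoLocallyUniformlyOn_iteratedDeriv {ι : Type*} {F : ι → ℂ → ℂ} {f : ℂ → ℂ}
    {p : Filter ι} [p.NeBot] {U : Set ℂ} (hU : IsOpen U) (hf : TendstoLocallyUniformlyOn F f p U)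
    (hF : ∀ i, DifferentiableOn ℂ (F i) U) (n : ℕ) :
    TendstoLocallyUniformlyOn (fun i => iteratedDeriv n (F i)) (iteratedDeriv n f) p U ∧
      ∀ i, DifferentiableOn ℂ (iteratedDeriv n (F i)) U := by
  induction n with
  | zero => simpa using ⟨hf, hF⟩
  | succ n ih =>
    simp only [iteratedDeriv_succ]
    exact ⟨ih.1.deriv (Eventually.of_forall ih.2) hU, fun i => (ih.2 i).deriv hU⟩

end IteratedDeriv

/-! ### Shifting one variable of the determinant -/

section Shift

variable {N : ℕ}

/-- The determinant `det (e ^ {s_i x_j})`. -/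
def expDet (x : Fin N → ℂ) (s : Fin N → ℂ) : ℂ :=
  (Matrix.of fun i j : Fin N => Complex.exp (s i * x j)).det

/-- In the Leibniz expansion, shifting s_k multiplies the term of σ by e^{t x_j} with j = σ⁻¹(k).
Summing over k runs through all j, whatever σ is. -/
lemma sum_expDet_shift (x s : Fin N → ℂ) (t : ℂ) :
    ∑ i, expDet x (s + Pi.single i t) = (∑ j, Complex.exp (t * x j)) * expDet x s := by
  simp only [expDet, Matrix.det_apply', Matrix.of_apply]
  rw [Finset.sum_comm, Finset.mul_sum]
  refine Finset.sum_congr rfl fun σ _ => ?_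
  have h : ∀ k, ∏ i, Complex.exp ((s + Pi.single k t : Fin N → ℂ) (σ i) * x i) =
      (∏ i, Complex.exp (s (σ i) * x i)) * Complex.exp (t * x (σ.symm k)) := by
    intro k
    have : ∀ i, Complex.exp ((s + Pi.single k t : Fin N → ℂ) (σ i) * x i) =
        Complex.exp (s (σ i) * x i) * (if i = σ.symm k then Complex.exp (t * x i) else 1) := by
      intro i
      rw [Pi.add_apply, add_mul, Complex.exp_add, Pi.single_apply]
      congr 1
      by_cases hik : σ i = k
      · subst hik; simp
      · have : i ≠ σ.symm k := fun h => hik (by rw [h]; simp)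
        simp [hik, this]
    rw [Finset.prod_congr rfl fun i _ => this i, Finset.prod_mul_distrib, Finset.prod_ite_eq']
    simp
  simp only [h]
  rw [← Finset.mul_sum, ← Finset.mul_sum, Equiv.sum_comp σ.symm (fun j => Complex.exp (t * x j))]
  ring

lemma sum_sum_expDet_shift (x s : Fin N → ℂ) (t t' : ℂ) :
    ∑ j, ∑ i, expDet x (s + Pi.single j t' + Pi.single i t) =
      (∑ i, ∑ j, Complex.exp (t * x i + t' * x j)) * expDet x s := by
  simp only [sum_expDet_shift, ← Finset.mul_sum, Complex.exp_add, ← Finset.sum_mul]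
  ring

lemma diffProd_smul (θ : ℂ) (s : Fin N → ℂ) :
    diffProd (θ • s) = (∏ i : Fin N, ∏ _j ∈ Finset.Ioi i, θ) * diffProd s := by
  simp only [diffProd, ← Finset.prod_mul_distrib, Pi.smul_apply, smul_eq_mul, ← mul_sub]

/-- The double shift identity is applied at θ s with shifts θ t, θ t' and differentiated n times at
θ = 0. The power sums of s vanish up to degree n, so f(θ s) is flat to order n and only the
exponential sum is differentiated. The identity is linear in f, apart from the normalization f(0) =
1, and can therefore be averaged over signatures. -/
lemma sum_pow_mul_diffProd {f : (Fin N → ℂ) → ℂ} (hf : AnalyticAt ℂ f 0)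
    (hsymm : ∀ σ : Equiv.Perm (Fin N), ∀ᶠ s in 𝓝 (0 : Fin N → ℂ), f (s ∘ σ) = f s)
    (hf0 : f 0 = 1) {c : ℂ} {x : Fin N → ℂ} (hfx : ∀ s, f s * diffProd s = c * expDet x s)
    {n : ℕ} {s : Fin N → ℂ} (hs : ∀ j, 1 ≤ j → j ≤ n → ∑ i, s i ^ j = 0) (t t' : ℂ) :
    diffProd s * ∑ i, ∑ j, (t * x i + t' * x j) ^ n =
      ∑ j, ∑ i, diffProd (s + Pi.single j t' + Pi.single i t) *
        rayDeriv n f (s + Pi.single j t' + Pi.single i t) := by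
  let g : ℂ → ℂ := fun θ => ∑ i, ∑ j, Complex.exp ((t * x i + t' * x j) * θ)
  have hg : AnalyticAt ℂ g 0 := by
    refine Finset.analyticAt_fun_sum _ fun i _ => Finset.analyticAt_fun_sum _ fun j _ => ?_
    fun_prop
  have hA : AnalyticAt ℂ (fun θ : ℂ => ∑ j, ∑ i, diffProd (s + Pi.single j t' + Pi.single i t) *
      f (θ • (s + Pi.single j t' + Pi.single i t))) 0 := by
    refine Finset.analyticAt_fun_sum _ fun i _ => Finset.analyticAt_fun_sum _ fun j _ => ?_
    exact analyticAt_const.mul (analyticAt_ray hf _)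
  have hB : AnalyticAt ℂ (fun θ : ℂ => diffProd s * (g θ * f (θ • s))) 0 :=
    analyticAt_const.mul (hg.mul (analyticAt_ray hf _))
  -- All Vandermonde products involved are homogeneous of the same degree, so a common power of θ
  -- cancels. This needs θ ≠ 0; analyticity then extends the identity to a full neighbourhood.
  have heq : ∀ᶠ θ : ℂ in 𝓝[≠] 0, ∑ j, ∑ i, diffProd (s + Pi.single j t' + Pi.single i t) *
      f (θ • (s + Pi.single j t' + Pi.single i t)) = diffProd s * (g θ * f (θ • s)) := by
    filter_upwards [self_mem_nhdsWithin] with θ hθ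
    have hK : (∏ i : Fin N, ∏ _j ∈ Finset.Ioi i, θ) ≠ 0 :=
      Finset.prod_ne_zero_iff.mpr fun i _ => Finset.prod_ne_zero_iff.mpr fun j _ => hθ
    apply mul_left_cancel₀ hK
    have h1 := sum_sum_expDet_shift x (θ • s) (θ * t) (θ * t')
    have h2 : ∀ i j, θ • s + Pi.single j (θ * t') + Pi.single i (θ * t) =
        θ • (s + Pi.single j t' + Pi.single i t) := by
      intro i j
      rw [smul_add, smul_add, ← Pi.single_smul, ← Pi.single_smul, smul_eq_mul, smul_eq_mul]
    simp only [h2] at h1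
    have h3 := congrArg (fun z => c * z) h1
    simp only [Finset.mul_sum, ← hfx] at h3
    rw [mul_left_comm, ← hfx] at h3
    simp only [diffProd_smul] at h3
    simp only [Finset.mul_sum]
    have e : ∀ i j : Fin N, (∏ i : Fin N, ∏ _j ∈ Finset.Ioi i, θ) *
        (diffProd (s + Pi.single j t' + Pi.single i t) *
          f (θ • (s + Pi.single j t' + Pi.single i t))) =
        f (θ • (s + Pi.single j t' + Pi.single i t)) *
          ((∏ i : Fin N, ∏ _j ∈ Finset.Ioi i, θ) *
            diffProd (s + Pi.single j t' + Pi.single i t)) := fun i j => by ring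
    simp only [e, h3]
    have e2 : g θ = ∑ i, ∑ j, Complex.exp (θ * t * x i + θ * t' * x j) := by
      simp only [g]
      refine Finset.sum_congr rfl fun i _ => Finset.sum_congr rfl fun j _ => ?_
      congr 1; ring
    rw [e2]; ring
  have heq' := (hA.frequently_eq_iff_eventually_eq hB).mp heq.frequently
  have hD := Filter.EventuallyEq.iteratedDeriv_eq n heq'
  rw [iteratedDeriv_const_mul_field, iteratedDeriv_mul_of_flat hg (analyticAt_ray hf _)] at hD
  · rw [zero_smul, hf0, mul_one] at hD
    have hg' : iteratedDeriv n g 0 = ∑ i, ∑ j, (t * x i + t' * x j) ^ n := by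
      simp only [g]
      rw [iteratedDeriv_fun_sum]
      · refine Finset.sum_congr rfl fun i _ => ?_
        rw [iteratedDeriv_fun_sum]
        · refine Finset.sum_congr rfl fun j _ => ?_
          rw [iteratedDeriv_cexp_const_mul]; simp
        · intro j _; fun_prop
      · intro i _; fun_prop
    rw [hg'] at hD
    rw [← hD, iteratedDeriv_fun_sum]
    · refine Finset.sum_congr rfl fun j _ => ?_
      rw [iteratedDeriv_fun_sum]
      · refine Finset.sum_congr rfl fun i _ => ?_
        rw [iteratedDeriv_const_mul_field]; rfl
      · intro i _
        exact (analyticAt_const.mul (analyticAt_ray hf _)).contDiffAt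
    · intro j _
      refine AnalyticAt.contDiffAt (Finset.analyticAt_fun_sum _ fun i _ => ?_)
      exact analyticAt_const.mul (analyticAt_ray hf _)
  -- Flatness: s and 0 have the same power sums of positive degree at most j, and f is constant
  -- along the ray of 0.
  · intro j hj hjn
    have h0 : rayDeriv j f s = rayDeriv j f 0 := by
      refine rayDeriv_eq_of_psum_eq hf hsymm fun k hk hkj => ?_
      rw [hs k hk (hkj.trans hjn)]
      have hk0 : k ≠ 0 := by omega
      simp [hk0]
    have h1 : rayDeriv j f 0 = 0 := by
      simp only [rayDeriv, smul_zero, iteratedDeriv_const]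
      have hj0 : j ≠ 0 := by omega
      simp [hj0]
    exact h0.trans h1

end Shift

/-! ### Averaging over signatures -/

section Bessel

variable {N : ℕ}

/-- The normalized Schur function in exponential coordinates, times `∏ (e^{s_i} - e^{s_j})/(s_i - s_j)`. -/
def besselTerm (l : Signature N) (s : Fin N → ℂ) : ℂ :=
  schurChar l (fun i => Complex.exp (s i)) / schurChar l 1 * expDivProd s

lemma analyticAt_exp_comp (s : Fin N → ℂ) :
    AnalyticAt ℂ (fun s : Fin N → ℂ => fun i => Complex.exp (s i)) s := by
  rw [analyticAt_pi_iff]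
  exact fun i => (analyticAt_coord i s).cexp'

lemma analyticAt_schurChar_exp (l : Signature N) (s : Fin N → ℂ) :
    AnalyticAt ℂ (fun s : Fin N → ℂ => schurChar l (fun i => Complex.exp (s i))) s :=
  AnalyticAt.fun_comp (analyticAt_schurChar l (u := fun i => Complex.exp (s i))
    fun _ => Complex.exp_ne_zero _) (analyticAt_exp_comp s)

lemma analyticAt_besselTerm (l : Signature N) (s : Fin N → ℂ) :
    AnalyticAt ℂ (besselTerm l) s := by
  unfold besselTerm
  simp only [div_eq_mul_inv]
  exact ((analyticAt_schurChar_exp l s).mul analyticAt_const).mul (analyticAt_expDivProd s)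

lemma besselTerm_comp_perm (l : Signature N) (s : Fin N → ℂ) (σ : Equiv.Perm (Fin N)) :
    besselTerm l (s ∘ σ) = besselTerm l s := by
  rw [besselTerm, besselTerm, expDivProd_comp_perm,
    ← schurChar_comp_perm l (u := fun i => Complex.exp (s i)) (fun _ => Complex.exp_ne_zero _) σ]
  rfl

lemma besselTerm_zero {l : Signature N} (hl : schurChar l 1 ≠ 0) : besselTerm l 0 = 1 := by
  have : (fun i : Fin N => Complex.exp ((0 : Fin N → ℂ) i)) = 1 := by ext; simp
  rw [besselTerm, expDivProd_zero, this, div_self hl, mul_one]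

lemma besselTerm_mul_diffProd (l : Signature N) (s : Fin N → ℂ) :
    besselTerm l s * diffProd s =
      (schurChar l 1)⁻¹ * expDet (fun j => ((l.shifted j : ℤ) : ℂ)) s := by
  rw [besselTerm, mul_assoc, expDivProd_mul_diffProd, div_mul_eq_mul_div,
    schurChar_mul_diffProd l (u := fun i => Complex.exp (s i)) (fun _ => Complex.exp_ne_zero _),
    div_eq_inv_mul, expDet]
  congr 3
  ext i j
  rw [← Complex.exp_int_mul, mul_comm]

/-- The Schur generating function in exponential coordinates, times
`∏ (e^{s_i} - e^{s_j})/(s_i - s_j)`. -/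
def besselGen (rho : PMF (Signature N)) (s : Fin N → ℂ) : ℂ :=
  schurGen rho (fun i => Complex.exp (s i)) * expDivProd s

/-- The uniformly convergent series pulls back to a disc on the complex line through v, where
Weierstrass's theorem allows termwise differentiation. Only this one-variable statement is needed,
not analyticity of the sum in N variables. -/
lemma hasSum_rayDeriv_besselGen {rho : PMF (Signature N)}
    (hV : ∃ V ∈ 𝓝 (1 : Fin N → ℂ), SummableUniformlyOn (schurTerm rho) V) (n : ℕ)
    (v : Fin N → ℂ) :
    HasSum (fun l => ((rho l).toReal : ℂ) * rayDeriv n (besselTerm l) v)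
      (rayDeriv n (besselGen rho) v) := by
  obtain ⟨V, hV1, hV⟩ := hV
  have h1 := hV.hasSumUniformlyOn.tendstoUniformlyOn
  have hray : Continuous (fun θ : ℂ => fun i : Fin N => Complex.exp ((θ • v) i)) := by
    fun_prop
  have hpre : ∀ᶠ θ : ℂ in 𝓝 0, (fun i : Fin N => Complex.exp ((θ • v) i)) ∈ V := by
    refine hray.continuousAt.eventually_mem ?_
    convert hV1 using 2
    ext; simp
  obtain ⟨r, hr, hball⟩ := Metric.eventually_nhds_iff_ball.mp hpre
  have h2 := h1.comp (fun θ : ℂ => fun i : Fin N => Complex.exp ((θ • v) i))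
  have h3 := (h2.mono (s' := Metric.ball 0 r) fun θ hθ => hball θ hθ).tendstoLocallyUniformlyOn
  have hWan : ∀ θ : ℂ, AnalyticAt ℂ (fun θ : ℂ => expDivProd (θ • v)) θ := fun θ =>
    AnalyticAt.fun_comp (analyticAt_expDivProd (θ • v)) (by fun_prop)
  have htermd : ∀ l, ∀ θ : ℂ, AnalyticAt ℂ
      (fun θ : ℂ => schurChar l (fun i : Fin N => Complex.exp ((θ • v) i))) θ := fun l θ =>
    AnalyticAt.fun_comp (g := fun s : Fin N → ℂ => schurChar l (fun i => Complex.exp (s i)))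
      (f := fun θ : ℂ => θ • v) (analyticAt_schurChar_exp l (θ • v)) (by fun_prop)
  have hFd : ∀ A : Finset (Signature N), ∀ θ : ℂ, AnalyticAt ℂ
      (fun θ : ℂ => ∑ l ∈ A, schurTerm rho l (fun i : Fin N => Complex.exp ((θ • v) i))) θ := by
    intro A θ
    refine Finset.analyticAt_fun_sum _ fun l _ => ?_
    unfold schurTerm
    simp only [div_eq_mul_inv]
    exact analyticAt_const.mul ((htermd l θ).mul analyticAt_const)
  have h4 : TendstoLocallyUniformlyOn
      (fun (A : Finset (Signature N)) (θ : ℂ) =>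
        ∑ l ∈ A, schurTerm rho l (fun i : Fin N => Complex.exp ((θ • v) i)))
      (fun θ : ℂ => schurGen rho (fun i : Fin N => Complex.exp ((θ • v) i))) atTop
      (Metric.ball 0 r) := by
    refine (h3.congr fun A θ hθ => ?_).congr_right fun θ hθ => ?_
    · simp
    · have := hV.hasSumUniformlyOn.tsum_eqOn (hball θ hθ)
      simp only [Function.comp_apply]
      rw [← this]; rfl
  have hcont : ContinuousOn (fun θ : ℂ => schurGen rho (fun i : Fin N => Complex.exp ((θ • v) i)))
      (Metric.ball 0 r) :=
    h4.continuousOn (Frequently.of_forall fun A => fun θ _ =>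
      (hFd A θ).continuousAt.continuousWithinAt)
  have hconst : TendstoLocallyUniformlyOn
      (fun (_ : Finset (Signature N)) (θ : ℂ) => expDivProd (θ • v))
      (fun θ : ℂ => expDivProd (θ • v)) atTop (Metric.ball 0 r) := by
    refine TendstoUniformlyOn.tendstoLocallyUniformlyOn ?_
    intro U hU
    exact Eventually.of_forall fun A θ _ => refl_mem_uniformity hU
  have h5 := h4.mul₀ hconst hcont fun θ _ => (hWan θ).continuousAt.continuousWithinAt
  have h6 := (tendstoLocallyUniformlyOn_iteratedDeriv Metric.isOpen_ball h5
    (fun A θ _ => ((hFd A θ).mul (hWan θ)).differentiableAt.differentiableWithinAt) n).1.tendsto_at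
      (Metric.mem_ball_self hr)
  refine h6.congr fun A => ?_
  have e1 : ((fun (A : Finset (Signature N)) (θ : ℂ) =>
        ∑ l ∈ A, schurTerm rho l (fun i : Fin N => Complex.exp ((θ • v) i))) *
      (fun (_ : Finset (Signature N)) (θ : ℂ) => expDivProd (θ • v))) A =
      fun θ : ℂ => ∑ l ∈ A, ((rho l).toReal : ℂ) * besselTerm l (θ • v) := by
    ext θ
    simp only [Pi.mul_apply, Finset.sum_mul, schurTerm, besselTerm, mul_assoc]
  rw [e1, iteratedDeriv_fun_sum]
  · refine Finset.sum_congr rfl fun l _ => ?_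
    rw [iteratedDeriv_const_mul_field]; rfl
  · intro l _
    exact (analyticAt_const.mul (analyticAt_ray (analyticAt_besselTerm l 0) v)).contDiffAt

/-- Both sides are sums of series whose terms agree one by one. -/
lemma rayDeriv_besselGen_eq_of_psum_eq {rho : PMF (Signature N)}
    (hV : ∃ V ∈ 𝓝 (1 : Fin N → ℂ), SummableUniformlyOn (schurTerm rho) V) {n : ℕ}
    {a b : Fin N → ℂ} (h : ∀ j, 1 ≤ j → j ≤ n → ∑ i, a i ^ j = ∑ i, b i ^ j) :
    rayDeriv n (besselGen rho) a = rayDeriv n (besselGen rho) b := by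
  refine (hasSum_rayDeriv_besselGen hV n a).unique ?_
  convert hasSum_rayDeriv_besselGen hV n b using 3 with l
  exact rayDeriv_eq_of_psum_eq (analyticAt_besselTerm l 0)
    (fun σ => Eventually.of_forall fun s => besselTerm_comp_perm l s σ) h

lemma hasSum_sum_pow_mul_diffProd {rho : PMF (Signature N)}
    (hV : ∃ V ∈ 𝓝 (1 : Fin N → ℂ), SummableUniformlyOn (schurTerm rho) V)
    (hrho : ∀ l, rho l ≠ 0 → schurChar l 1 ≠ 0)
    {n : ℕ} {s : Fin N → ℂ} (hs : ∀ j, 1 ≤ j → j ≤ n → ∑ i, s i ^ j = 0) (t t' : ℂ) :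
    HasSum (fun l => ((rho l).toReal : ℂ) *
        (diffProd s * ∑ i, ∑ j, (t * (l.shifted i : ℤ) + t' * (l.shifted j : ℤ)) ^ n))
      (∑ j, ∑ i, diffProd (s + Pi.single j t' + Pi.single i t) *
        rayDeriv n (besselGen rho) (s + Pi.single j t' + Pi.single i t)) := by
  have h : HasSum (fun l => ∑ j, ∑ i, diffProd (s + Pi.single j t' + Pi.single i t) *
        (((rho l).toReal : ℂ) *
          rayDeriv n (besselTerm l) (s + Pi.single j t' + Pi.single i t)))
      (∑ j, ∑ i, diffProd (s + Pi.single j t' + Pi.single i t) *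
        rayDeriv n (besselGen rho) (s + Pi.single j t' + Pi.single i t)) :=
    hasSum_sum fun j _ => hasSum_sum fun i _ => (hasSum_rayDeriv_besselGen hV n _).mul_left _
  convert h using 2 with l
  by_cases hl : rho l = 0
  · simp [hl]
  · rw [sum_pow_mul_diffProd (analyticAt_besselTerm l 0)
      (fun σ => Eventually.of_forall fun s => besselTerm_comp_perm l s σ)
      (besselTerm_zero (hrho l hl)) (besselTerm_mul_diffProd l) hs]
    simp only [Finset.mul_sum]
    exact Finset.sum_congr rfl fun j _ => Finset.sum_congr rfl fun i _ => by ring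

end Bessel

/-! ### Residue formulas for ratios of Vandermonde products -/

section PartialFractions

/-- Partial fractions of `∏ (z + t - s_j) / (z - s_j)`. -/
lemma prod_shift_div {K ι : Type*} [Field K] [Fintype ι] [DecidableEq ι] {s : ι → K}
    (hs : Function.Injective s) (t : K) {z : K} (hz : ∀ i, z ≠ s i) :
    ∏ j, (z + t - s j) / (z - s j) =
      1 + t * ∑ i, (∏ j ∈ Finset.univ.erase i, (s i + t - s j) / (s i - s j)) / (z - s i) := by
  classical
  let A : Polynomial K := ∏ j, (Polynomial.X - Polynomial.C (s j - t))
  let B : Polynomial K := Lagrange.nodal Finset.univ s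
  have hB : B = ∏ j, (Polynomial.X - Polynomial.C (s j)) := rfl
  have hdA : A.degree = (Fintype.card ι : ℕ) := by
    simp only [A, Polynomial.degree_prod, Polynomial.degree_X_sub_C]; simp
  have hdB : B.degree = (Fintype.card ι : ℕ) := by
    simp [hB, Polynomial.degree_prod]
  have hmA : A.Monic := Polynomial.monic_prod_X_sub_C _ _
  have hmB : B.Monic := Polynomial.monic_prod_X_sub_C _ _
  -- Two monic polynomials of equal degree: the leading terms cancel, so Lagrange interpolation at
  -- the nodes recovers the difference.
  have hdeg : (A - B).degree < (Finset.univ : Finset ι).card := by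
    have := Polynomial.degree_sub_lt_left (hdA.trans hdB.symm) hmA.ne_zero (by rw [hmA, hmB])
    rwa [hdA] at this
  have hev : ∀ i ∈ Finset.univ, (A - B).eval (s i) =
      (t * ∏ j ∈ Finset.univ.erase i, (s i + t - s j)) := by
    intro i _
    have hB0 : B.eval (s i) = 0 := by
      rw [hB, Polynomial.eval_prod]
      exact Finset.prod_eq_zero (Finset.mem_univ i) (by simp)
    rw [Polynomial.eval_sub, hB0, sub_zero, Polynomial.eval_prod,
      ← Finset.mul_prod_erase _ _ (Finset.mem_univ i)]
    simp only [Polynomial.eval_sub, Polynomial.eval_X, Polynomial.eval_C]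
    congr 1
    · ring
    · exact Finset.prod_congr rfl fun j _ => by ring
  have hint := congrArg (Polynomial.eval z)
    (Lagrange.eq_interpolate_of_eval_eq _ hs.injOn hdeg hev)
  rw [Lagrange.eval_interpolate_not_at_node _ (fun i _ => hz i)] at hint
  have hBz : B.eval z = ∏ j, (z - s j) := by rw [hB, Polynomial.eval_prod]; simp
  have hAz : A.eval z = ∏ j, (z + t - s j) := by
    rw [Polynomial.eval_prod]
    exact Finset.prod_congr rfl fun j _ => by simp; ring
  have hne : ∏ j, (z - s j) ≠ 0 := Finset.prod_ne_zero_iff.mpr fun j _ => sub_ne_zero.mpr (hz j)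
  change (A - B).eval z = B.eval z * _ at hint
  rw [Polynomial.eval_sub, hAz, hBz] at hint
  rw [Finset.prod_div_distrib, div_eq_iff hne, add_mul, one_mul, ← sub_eq_iff_eq_add', hint,
    mul_comm, Finset.mul_sum]
  congr 1
  refine Finset.sum_congr rfl fun i _ => ?_
  rw [Lagrange.nodalWeight, Finset.prod_div_distrib, Finset.prod_inv_distrib]
  field_simp

/-- The normalized contour integral `(2πi)⁻¹ ∮_{|z| = R} g(z) dz`. -/
def contourInt (R : ℝ) (g : ℂ → ℂ) : ℂ := (2 * Real.pi * Complex.I)⁻¹ * ∮ z in C(0, R), g z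

lemma contourInt_congr {R : ℝ} (hR : 0 ≤ R) {f g : ℂ → ℂ} (h : ∀ z, ‖z‖ = R → f z = g z) :
    contourInt R f = contourInt R g := by
  rw [contourInt, contourInt, circleIntegral.integral_congr hR fun z hz => h z (by simpa using hz)]

lemma contourInt_const_mul (R : ℝ) (a : ℂ) (f : ℂ → ℂ) :
    contourInt R (fun z => a * f z) = a * contourInt R f := by
  rw [contourInt, contourInt, circleIntegral.integral_const_mul]; ring

lemma contourInt_sum {ι : Type*} {R : ℝ} (s : Finset ι) {f : ι → ℂ → ℂ}
    (h : ∀ i ∈ s, CircleIntegrable (f i) 0 R) :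
    contourInt R (fun z => ∑ i ∈ s, f i z) = ∑ i ∈ s, contourInt R (f i) := by
  simp only [contourInt]
  rw [circleIntegral.integral_fun_sum h, Finset.mul_sum]

lemma contourInt_of_differentiable {R : ℝ} (hR : 0 ≤ R) {g : ℂ → ℂ}
    (hg : DifferentiableOn ℂ g (Metric.closedBall 0 R)) : contourInt R g = 0 := by
  rw [contourInt, (Complex.circleIntegral_eq_zero_of_differentiable_on_off_countable hR
    Set.countable_empty hg.continuousOn fun z hz => ?_), mul_zero]
  exact (hg z (Metric.ball_subset_closedBall hz.1)).differentiableAt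
    (Metric.closedBall_mem_nhds_of_mem hz.1)

lemma contourInt_inv_sub_mul {R : ℝ} {g : ℂ → ℂ} {w : ℂ}
    (hg : DifferentiableOn ℂ g (Metric.closedBall 0 R)) (hw : ‖w‖ < R) :
    contourInt R (fun z => (z - w)⁻¹ * g z) = g w := by
  have h := hg.circleIntegral_sub_inv_smul (w := w) (by simpa using hw)
  simp only [smul_eq_mul] at h
  rw [contourInt, h, inv_mul_cancel_left₀ Complex.two_pi_I_ne_zero]

/-- The coefficients are the residues of the rational function at the nodes, and its constant part 1
contributes nothing since g is holomorphic inside the circle. -/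
lemma sum_shift_eq_contourInt {ι : Type*} [Fintype ι] [DecidableEq ι] {s : ι → ℂ}
    (hs : Function.Injective s) {t : ℂ} {R : ℝ} (hsR : ∀ i, ‖s i‖ < R) (hR : 0 < R) {g : ℂ → ℂ}
    (hg : DifferentiableOn ℂ g (Metric.closedBall 0 R)) :
    t * ∑ i, (∏ j ∈ Finset.univ.erase i, (s i + t - s j) / (s i - s j)) * g (s i) =
      contourInt R (fun z => (∏ j, (z + t - s j) / (z - s j)) * g z) := by
  have hcont : ContinuousOn g (Metric.sphere 0 R) :=
    hg.continuousOn.mono Metric.sphere_subset_closedBall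
  have hne : ∀ z : ℂ, ‖z‖ = R → ∀ i, z ≠ s i := fun z hz i h => by
    have := hsR i; rw [← h, hz] at this; exact lt_irrefl _ this
  have hint : ∀ i, CircleIntegrable (fun z => (z - s i)⁻¹ * g z) 0 R := by
    intro i
    refine ContinuousOn.circleIntegrable hR.le (ContinuousOn.mul ?_ hcont)
    refine ContinuousOn.inv₀ (by fun_prop) fun z hz => sub_ne_zero.mpr (hne z (by simpa using hz) i)
  have h1 : contourInt R (fun z => (∏ j, (z + t - s j) / (z - s j)) * g z) =
      contourInt R (fun z => ∑ o : Option ι, (match o with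
        | none => g z
        | some i => (t * ∏ j ∈ Finset.univ.erase i, (s i + t - s j) / (s i - s j)) *
            ((z - s i)⁻¹ * g z))) := by
    refine contourInt_congr hR.le fun z hz => ?_
    rw [Fintype.sum_option, prod_shift_div hs t (hne z hz), add_mul, one_mul, Finset.mul_sum,
      Finset.sum_mul]
    congr 1
    exact Finset.sum_congr rfl fun i _ => by rw [div_eq_mul_inv]; ring
  rw [h1, contourInt_sum, Fintype.sum_option]
  · simp only [contourInt_const_mul]
    rw [contourInt_of_differentiable hR.le hg, zero_add, Finset.mul_sum]
    refine Finset.sum_congr rfl fun i _ => ?_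
    rw [contourInt_inv_sub_mul hg (hsR i)]; ring
  · rintro (_ | i) _
    · exact hcont.circleIntegrable hR.le
    · exact (hint i).const_smul (a := _)

end PartialFractions

section DiffProd

variable {N : ℕ}

/-- Only pairs containing k change. For i < k both the factor and its replacement change sign when
the pair is reversed, so the ratio has the same form on either side of k. -/
lemma diffProd_add_single {s : Fin N → ℂ} (hs : Function.Injective s) (k : Fin N) (t : ℂ) :
    diffProd (s + Pi.single k t) =
      diffProd s * ∏ j ∈ Finset.univ.erase k, (s k + t - s j) / (s k - s j) := by
  set s' := s + Pi.single k t with hs'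
  have hk : s' k = s k + t := by simp [hs']
  have hj : ∀ j, j ≠ k → s' j = s j := fun j h => by simp [hs', h]
  have hne : ∀ i j, i ≠ j → s i - s j ≠ 0 := fun i j h => sub_ne_zero.mpr (hs.ne h)
  have h1 : diffProd s' = diffProd s *
      ∏ i : Fin N, ∏ j ∈ Finset.Ioi i, (s' i - s' j) / (s i - s j) := by
    simp only [diffProd, ← Finset.prod_mul_distrib]
    refine Finset.prod_congr rfl fun i _ => Finset.prod_congr rfl fun j hj => ?_
    rw [mul_div_cancel₀ _ (hne i j (Finset.mem_Ioi.mp hj).ne)]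
  rw [h1]
  congr 1
  have h2 : ∀ i : Fin N, i ≠ k → ∏ j ∈ Finset.Ioi i, (s' i - s' j) / (s i - s j) =
      if i < k then (s k + t - s i) / (s k - s i) else 1 := by
    intro i hi
    rw [Finset.prod_congr rfl (g := fun j => if j = k then (s k + t - s i) / (s k - s i) else 1),
      Finset.prod_ite_eq']
    · simp
    · intro j hj'
      split_ifs with hjk
      · subst hjk
        rw [hk, hj i hi, ← neg_sub (s j) (s i), ← neg_sub _ (s i), neg_div_neg_eq]
      · rw [hj i hi, hj j hjk, div_self (hne i j (Finset.mem_Ioi.mp hj').ne)]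
  rw [← Finset.mul_prod_erase _ _ (Finset.mem_univ k),
    Finset.prod_congr rfl fun i hi => h2 i (Finset.ne_of_mem_erase hi), ← Finset.prod_filter]
  have h3 : (Finset.univ.erase k : Finset (Fin N)).filter (· < k) = Finset.Iio k := by
    ext i; simp +contextual [ne_of_lt]
  have h4 : (Finset.univ.erase k : Finset (Fin N)) = Finset.Ioi k ∪ Finset.Iio k := by
    ext i; simp [lt_or_lt_iff_ne, eq_comm]
  have h5 : Disjoint (Finset.Ioi k) (Finset.Iio k) := by
    rw [Finset.disjoint_left]; intro i h h'
    exact lt_asymm (Finset.mem_Ioi.mp h) (Finset.mem_Iio.mp h')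
  rw [h3, h4, Finset.prod_union h5]
  congr 1
  refine Finset.prod_congr rfl fun j hj' => ?_
  rw [hk, hj j (Finset.mem_Ioi.mp hj').ne']

end DiffProd

section TwoStep

/-- The interaction factor of two contour variables. -/
def crossFactor (t t' z z' : ℂ) : ℂ :=
  ((z + t - z' - t') * (z - z')) / ((z + t - z') * (z - z' - t'))

variable {N : ℕ}

/-- The sum over the second shift becomes the integral over |z| = 2 and the sum over the first the
integral over |z'| = 1. The radii are separated enough, compared with t and t', for the interaction
factor to be holomorphic in z' on the unit disc, so that only the nodes s_j contribute to the inner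
integral. -/
lemma sum_sum_diffProd_eq_contourInt {s : Fin N → ℂ} {ε : ℝ} {t t' : ℂ} (hs : Function.Injective s)
    (hsε : ∀ i, ‖s i‖ = ε) (hε : 2 * ε < ‖t'‖) (ht : ‖t‖ < 1 / 2) (ht' : ‖t'‖ < 1 / 2)
    (ht0 : t ≠ 0) (ht0' : t' ≠ 0) (hε0 : 0 < ε)
    {Φ : ℂ → ℂ → ℂ} (hΦ : Differentiable ℂ (fun p : ℂ × ℂ => Φ p.1 p.2)) :
    ∑ j, ∑ i, diffProd (s + Pi.single j t' + Pi.single i t) *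
        Φ ((s + Pi.single j t' : Fin N → ℂ) i) (s j) =
      diffProd s * ((t * t')⁻¹ * contourInt 2 (fun z => contourInt 1 (fun z' =>
        (∏ l, (z + t - s l) / (z - s l)) * (∏ l, (z' + t' - s l) / (z' - s l)) *
          crossFactor t t' z z' * Φ z z'))) := by
  -- Distances between the s_i are at most 2ε < ‖t'‖, so the moved point cannot land on another one.
  have hinj : ∀ j, Function.Injective (s + Pi.single j t') := by
    intro j a b hab
    by_contra hne
    have hsab : s a ≠ s b := hs.ne hne
    have h2 : ‖s a - s b‖ ≤ 2 * ε := by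
      calc ‖s a - s b‖ ≤ ‖s a‖ + ‖s b‖ := norm_sub_le _ _
        _ = 2 * ε := by rw [hsε, hsε]; ring
    simp only [Pi.add_apply, Pi.single_apply] at hab
    by_cases ha : a = j
    · have hb : b ≠ j := fun h => hne (ha.trans h.symm)
      simp only [ha, hb, if_true, if_false, add_zero] at hab
      have : t' = -(s a - s b) := by rw [ha]; linear_combination hab
      rw [this, norm_neg] at hε; linarith
    · by_cases hb : b = j
      · simp only [ha, hb, if_true, if_false, add_zero] at hab
        have : t' = s a - s b := by rw [hb]; linear_combination -hab
        rw [this] at hε; linarith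
      · simp only [ha, hb, if_false, add_zero] at hab
        exact hsab hab
  have hnorm : ∀ j i, ‖(s + Pi.single j t' : Fin N → ℂ) i‖ < 2 := by
    intro j i
    have h1 : ‖(Pi.single j t' : Fin N → ℂ) i‖ ≤ ‖t'‖ := by
      rw [Pi.single_apply]; split_ifs <;> simp
    calc ‖(s + Pi.single j t' : Fin N → ℂ) i‖ ≤ ‖s i‖ + ‖(Pi.single j t' : Fin N → ℂ) i‖ := norm_add_le _ _
      _ < 2 := by rw [hsε]; linarith
  have hε1 : ε < 1 / 4 := by linarith
  have hz1 : ∀ z z' : ℂ, ‖z‖ = 2 → ‖z'‖ ≤ 1 → z + t - z' ≠ 0 ∧ z - z' - t' ≠ 0 ∧ z - z' ≠ 0 := by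
    intro z z' hz hz'
    refine ⟨fun h => ?_, fun h => ?_, fun h => ?_⟩
    · have : z = z' - t := by linear_combination h
      have h2 := norm_sub_le z' t
      rw [← this, hz] at h2; linarith
    · have : z = z' + t' := by linear_combination h
      have h2 := norm_add_le z' t'
      rw [← this, hz] at h2; linarith
    · have : z = z' := by linear_combination h
      rw [← this, hz] at hz'; linarith
  have hΦ1 : ∀ z', Differentiable ℂ (fun z => Φ z z') := fun z' =>
    hΦ.comp (f := fun z => (z, z')) (by fun_prop)
  have hΦ2 : ∀ z, Differentiable ℂ (fun z' => Φ z z') := fun z =>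
    hΦ.comp (f := fun z' => (z, z')) (by fun_prop)
  -- Moving s_j by t' alters just the j-th factor of the product; the quotient of new and old factor
  -- is the interaction factor at z' = s_j.
  have hcross : ∀ j z, ‖z‖ = 2 → ∏ l, (z + t - (s + Pi.single j t' : Fin N → ℂ) l) / (z - (s + Pi.single j t' : Fin N → ℂ) l) =
      (∏ l, (z + t - s l) / (z - s l)) * crossFactor t t' z (s j) := by
    intro j z hz
    obtain ⟨h1, h2, h3⟩ := hz1 z (s j) hz (by rw [hsε]; linarith)
    rw [← Finset.mul_prod_erase _ _ (Finset.mem_univ j),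
      ← Finset.mul_prod_erase _ (fun l => (z + t - s l) / (z - s l)) (Finset.mem_univ j)]
    have : ∏ l ∈ Finset.univ.erase j,
        (z + t - (s + Pi.single j t' : Fin N → ℂ) l) / (z - (s + Pi.single j t' : Fin N → ℂ) l) =
        ∏ l ∈ Finset.univ.erase j, (z + t - s l) / (z - s l) := by
      refine Finset.prod_congr rfl fun l hl => ?_
      simp [Finset.ne_of_mem_erase hl]
    rw [this, crossFactor]
    simp only [Pi.add_apply, Pi.single_eq_same]
    have h2' : z - (s j + t') ≠ 0 := by rwa [← sub_sub]
    field_simp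
    ring
  have step1 : ∀ j, ∑ i, diffProd (s + Pi.single j t' + Pi.single i t) *
        Φ ((s + Pi.single j t' : Fin N → ℂ) i) (s j) =
      diffProd (s + Pi.single j t') * (t⁻¹ * contourInt 2 (fun z =>
        (∏ l, (z + t - s l) / (z - s l)) * crossFactor t t' z (s j) * Φ z (s j))) := by
    intro j
    have h := sum_shift_eq_contourInt (hinj j) (t := t) (hnorm j) two_pos
      (hΦ1 (s j)).differentiableOn
    rw [contourInt_congr two_pos.le (g := fun z =>
        (∏ l, (z + t - s l) / (z - s l)) * crossFactor t t' z (s j) * Φ z (s j))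
        fun z hz => by rw [hcross j z hz]] at h
    rw [← h, inv_mul_cancel_left₀ ht0, Finset.mul_sum]
    refine Finset.sum_congr rfl fun i _ => ?_
    rw [diffProd_add_single (hinj j)]; ring
  have hne2 : ∀ z : ℂ, ‖z‖ = 2 → ∀ l, z - s l ≠ 0 := by
    intro z hz l h
    have : z = s l := by linear_combination h
    have h2 := hsε l
    rw [← this, hz] at h2; linarith
  simp only [step1, diffProd_add_single hs]
  have hci : ∀ j, CircleIntegrable (fun z => (t'* ∏ k ∈ Finset.univ.erase j, (s j + t' - s k) / (s j - s k)) *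
      ((∏ l, (z + t - s l) / (z - s l)) * crossFactor t t' z (s j) * Φ z (s j))) 0 2 := by
    intro j
    refine ContinuousOn.circleIntegrable two_pos.le ?_
    have hz2 : ∀ z ∈ Metric.sphere (0 : ℂ) 2, ‖z‖ = 2 := fun z hz => by simpa using hz
    refine ContinuousOn.mul continuousOn_const (ContinuousOn.mul (ContinuousOn.mul ?_ ?_)
      (hΦ1 _).continuous.continuousOn)
    · refine continuousOn_finsetProd _ fun l _ => ContinuousOn.div (by fun_prop) (by fun_prop)
        fun z hz => hne2 z (hz2 z hz) l
    · unfold crossFactor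
      refine ContinuousOn.div (by fun_prop) (by fun_prop) fun z hz => ?_
      have := hz1 z (s j) (hz2 z hz) (by rw [hsε]; linarith)
      exact mul_ne_zero this.1 this.2.1
  have step2 : contourInt 2 (fun z => contourInt 1 (fun z' =>
        (∏ l, (z + t - s l) / (z - s l)) * (∏ l, (z' + t' - s l) / (z' - s l)) *
          crossFactor t t' z z' * Φ z z')) =
      ∑ j, (t'* ∏ k ∈ Finset.univ.erase j, (s j + t' - s k) / (s j - s k)) * contourInt 2 (fun z =>
        (∏ l, (z + t - s l) / (z - s l)) * crossFactor t t' z (s j) * Φ z (s j)) := by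
    simp only [← contourInt_const_mul]
    rw [← contourInt_sum _ fun j _ => hci j]
    refine contourInt_congr two_pos.le fun z hz => ?_
    have hd : DifferentiableOn ℂ (fun z' => crossFactor t t' z z' * Φ z z')
        (Metric.closedBall 0 1) := by
      refine DifferentiableOn.mul ?_ (hΦ2 z).differentiableOn
      unfold crossFactor
      refine DifferentiableOn.div (by fun_prop) (by fun_prop) fun z' hz' => ?_
      have := hz1 z z' hz (by simpa using hz')
      exact mul_ne_zero this.1 this.2.1
    have h := sum_shift_eq_contourInt hs (t := t') (R := 1) (fun i => by rw [hsε]; linarith)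
      one_pos hd
    have h2 : contourInt 1 (fun z' =>
        (∏ l, (z + t - s l) / (z - s l)) * (∏ l, (z' + t' - s l) / (z' - s l)) *
          crossFactor t t' z z' * Φ z z') = (∏ l, (z + t - s l) / (z - s l)) *
        contourInt 1 (fun z' => (∏ l, (z' + t' - s l) / (z' - s l)) *
          (crossFactor t t' z z' * Φ z z')) := by
      rw [← contourInt_const_mul]
      exact contourInt_congr one_pos.le fun z' _ => by ring
    rw [h2, ← h, Finset.mul_sum, Finset.mul_sum]
    exact Finset.sum_congr rfl fun j _ => by ring
  rw [step2, Finset.mul_sum, Finset.mul_sum]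
  refine Finset.sum_congr rfl fun j _ => ?_
  field_simp

end TwoStep

/-! ### Roots of unity as a nondegenerate substitute for the origin -/

section Config

/-- The primitive root of unity `e^{2πi/m}`. -/
def unityRoot (m : ℕ) : ℂ := Complex.exp (2 * Real.pi * Complex.I / m)

lemma unityRoot_isPrimitiveRoot {m : ℕ} (hm : m ≠ 0) : IsPrimitiveRoot (unityRoot m) m :=
  Complex.isPrimitiveRoot_exp m hm

lemma norm_unityRoot {m : ℕ} (hm : m ≠ 0) : ‖unityRoot m‖ = 1 :=
  (unityRoot_isPrimitiveRoot hm).norm'_eq_one hm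

lemma sum_unityRoot_pow {m j : ℕ} (hj : 1 ≤ j) (hjm : j < m) (z : ℂ) :
    ∑ l : Fin m, (z * unityRoot m ^ (l : ℕ)) ^ j = 0 := by
  have hm : m ≠ 0 := by omega
  have hp := unityRoot_isPrimitiveRoot hm
  have h1 : unityRoot m ^ j ≠ 1 := hp.pow_ne_one_of_pos_of_lt (by omega) hjm
  have h2 : ∀ l : ℕ, (z * unityRoot m ^ l) ^ j = z ^ j * (unityRoot m ^ j) ^ l := fun l => by
    rw [mul_pow, ← pow_mul, ← pow_mul, mul_comm l j]
  rw [Fin.sum_univ_eq_sum_range (fun l => (z * unityRoot m ^ l) ^ j)]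
  simp only [h2, ← Finset.mul_sum]
  rw [geom_sum_eq h1, ← pow_mul, mul_comm j m, pow_mul, hp.pow_eq_one, one_pow, sub_self, zero_div,
    mul_zero]

lemma sum_add_single_pow {ι : Type*} [Fintype ι] [DecidableEq ι] (a : ι → ℂ) (k : ι) (t : ℂ)
    (j : ℕ) :
    ∑ i, (a + Pi.single k t : ι → ℂ) i ^ j = ∑ i, a i ^ j + ((a k + t) ^ j - a k ^ j) := by
  rw [← Finset.add_sum_erase _ _ (Finset.mem_univ k),
    ← Finset.add_sum_erase _ (fun i => a i ^ j) (Finset.mem_univ k)]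
  have : ∑ i ∈ Finset.univ.erase k, (a + Pi.single k t : ι → ℂ) i ^ j =
      ∑ i ∈ Finset.univ.erase k, a i ^ j := by
    refine Finset.sum_congr rfl fun i hi => ?_
    simp [Finset.ne_of_mem_erase hi]
  rw [this]
  simp only [Pi.add_apply, Pi.single_eq_same]
  ring

/-- The points `z ω^l`, `l < m`, with `ω` a primitive `m`-th root of unity and the first point
moved by `t`. -/
def ringBlock (m : ℕ) (z t : ℂ) : Fin m → ℂ :=
  fun l => z * unityRoot m ^ (l : ℕ) + if (l : ℕ) = 0 then t else 0

/-- The full orbit of z under the m-th roots of unity has vanishing power sums of degree 1, ..., m -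
1, so up to that degree the block records only the displacement of one point from z to z + t. -/
lemma sum_ringBlock_pow {m j : ℕ} (hj : 1 ≤ j) (hjm : j < m) (z t : ℂ) :
    ∑ l, ringBlock m z t l ^ j = (z + t) ^ j - z ^ j := by
  have h : ringBlock m z t = (fun l : Fin m => z * unityRoot m ^ (l : ℕ)) +
      Pi.single ⟨0, by omega⟩ t := by
    ext l
    simp only [ringBlock, Pi.add_apply, Pi.single_apply, Fin.ext_iff]
  rw [h, sum_add_single_pow, sum_unityRoot_pow hj hjm]
  simp

/-- Two blocks of points. -/
def ringConfig (m : ℕ) (z t z' t' : ℂ) : Fin (m + m) → ℂ :=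
  Fin.append (ringBlock m z t) (ringBlock m z' t')

lemma sum_ringConfig_pow {m j : ℕ} (hj : 1 ≤ j) (hjm : j < m) (z t z' t' : ℂ) :
    ∑ l, ringConfig m z t z' t' l ^ j = (z + t) ^ j - z ^ j + ((z' + t') ^ j - z' ^ j) := by
  rw [Fin.sum_univ_add]
  simp only [ringConfig, Fin.append_left, Fin.append_right, sum_ringBlock_pow hj hjm]

/-- Extension of a vector by zeros. -/
def padZero {r : ℕ} (N : ℕ) (c : Fin r → ℂ) : Fin N → ℂ :=
  fun i => if h : (i : ℕ) < r then c ⟨i, h⟩ else 0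

lemma padZero_smul {r N : ℕ} (θ : ℂ) (c : Fin r → ℂ) : padZero N (θ • c) = θ • padZero N c := by
  ext i
  simp only [padZero, Pi.smul_apply, smul_eq_mul]
  split_ifs <;> simp

lemma sum_padZero_pow {r N j : ℕ} (hrN : r ≤ N) (hj : 1 ≤ j) (c : Fin r → ℂ) :
    ∑ i, padZero N c i ^ j = ∑ i, c i ^ j := by
  obtain ⟨K, rfl⟩ := Nat.exists_eq_add_of_le hrN
  rw [Fin.sum_univ_add]
  have hj0 : j ≠ 0 := by omega
  simp [padZero, hj0]

lemma rayDeriv_padZero {r N : ℕ} (n : ℕ) (f : (Fin N → ℂ) → ℂ) (c : Fin r → ℂ) :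
    rayDeriv n f (padZero N c) = rayDeriv n (fun c : Fin r → ℂ => f (padZero N c)) c := by
  simp only [rayDeriv, padZero_smul]

lemma differentiable_ringConfig (m : ℕ) (t t' : ℂ) :
    Differentiable ℂ (fun p : ℂ × ℂ => ringConfig m p.1 t p.2 t') := by
  rw [differentiable_pi]
  intro i
  refine Fin.addCases (fun l => ?_) (fun l => ?_) i
  · simp only [ringConfig, Fin.append_left, ringBlock]; fun_prop
  · simp only [ringConfig, Fin.append_right, ringBlock]; fun_prop

/-- The one-variable kernel of the contour integral formula. -/
def shiftKernel (N : ℕ) (ε t z : ℂ) : ℂ := ((z + t) ^ N - ε ^ N) / (z ^ N - ε ^ N)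

lemma prod_unityRoot_shift {N : ℕ} (hN : N ≠ 0) (ε t z : ℂ) :
    ∏ l : Fin N, (z + t - ε * unityRoot N ^ (l : ℕ)) / (z - ε * unityRoot N ^ (l : ℕ)) =
      shiftKernel N ε t z := by
  have hp := unityRoot_isPrimitiveRoot hN
  have key : ∀ w : ℂ, ∏ l : Fin N, (w - ε * unityRoot N ^ (l : ℕ)) = w ^ N - ε ^ N := by
    intro w
    rw [hp.pow_sub_pow_eq_prod_sub_mul w ε (Nat.pos_of_ne_zero hN)]
    rw [Fin.prod_univ_eq_prod_range (fun l => w - ε * unityRoot N ^ l)]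
    have : NeZero N := ⟨hN⟩
    refine Finset.prod_bij (fun l _ => unityRoot N ^ l) ?_ ?_ ?_ ?_
    · intro l _
      rw [Polynomial.mem_nthRootsFinset (Nat.pos_of_ne_zero hN), ← pow_mul, mul_comm, pow_mul,
        hp.pow_eq_one, one_pow]
    · intro a ha b hb h
      exact hp.pow_inj (Finset.mem_range.mp ha) (Finset.mem_range.mp hb) h
    · intro ζ hζ
      rw [Polynomial.mem_nthRootsFinset (Nat.pos_of_ne_zero hN)] at hζ
      obtain ⟨i, hi, h⟩ := hp.eq_pow_of_pow_eq_one hζ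
      exact ⟨i, Finset.mem_range.mpr hi, h⟩
    · intro l _; rw [mul_comm]
  rw [Finset.prod_div_distrib, key, key, shiftKernel]

/-- The joint moments of the shifted signature as a double contour integral. -/
theorem hasSum_moments {N m n : ℕ} (hN : m + m ≤ N) (hn : n < m) {rho : PMF (Signature N)}
    (hV : ∃ V ∈ 𝓝 (1 : Fin N → ℂ), SummableUniformlyOn (schurTerm rho) V)
    (hrho : ∀ l, rho l ≠ 0 → schurChar l 1 ≠ 0)
    (hG : AnalyticAt ℂ (fun c : Fin (m + m) → ℂ => besselGen rho (padZero N c)) 0)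
    {t t' : ℂ} (ht : ‖t‖ < 1 / 2) (ht' : ‖t'‖ < 1 / 2) (ht0 : t ≠ 0) (ht0' : t' ≠ 0) :
    HasSum (fun l => ((rho l).toReal : ℂ) *
        ∑ i, ∑ j, (t * (l.shifted i : ℤ) + t' * (l.shifted j : ℤ)) ^ n)
      ((t * t')⁻¹ * contourInt 2 (fun z => contourInt 1 (fun z' =>
        shiftKernel N (‖t'‖ / 4 : ℝ) t z * shiftKernel N (‖t'‖ / 4 : ℝ) t' z' *
          crossFactor t t' z z' *
          rayDeriv n (fun c : Fin (m + m) → ℂ => besselGen rho (padZero N c))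
            (ringConfig m z t z' t')))) := by
  have hN0 : N ≠ 0 := by omega
  -- A positive ε keeps the base points distinct, and 2ε < ‖t'‖ keeps them distinct after the first
  -- shift.
  set ε : ℝ := ‖t'‖ / 4 with hε
  have hε0 : 0 < ε := by have := norm_pos_iff.mpr ht0'; positivity
  let s : Fin N → ℂ := fun l => ε * unityRoot N ^ (l : ℕ)
  have hsinj : Function.Injective s := by
    intro a b hab
    have h1 := mul_left_cancel₀ (Complex.ofReal_ne_zero.mpr hε0.ne') hab
    exact Fin.ext ((unityRoot_isPrimitiveRoot hN0).pow_inj a.2 b.2 h1)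
  have hsε : ∀ i, ‖s i‖ = ε := by
    intro i
    simp only [s, norm_mul, norm_pow, norm_unityRoot hN0, one_pow, mul_one, Complex.norm_real,
      Real.norm_eq_abs, abs_of_pos hε0]
  have hspow : ∀ j, 1 ≤ j → j ≤ n → ∑ i, s i ^ j = 0 := fun j hj hjn =>
    sum_unityRoot_pow hj (by omega) _
  have h1 := hasSum_sum_pow_mul_diffProd hV hrho hspow t t'
  let Φ : ℂ → ℂ → ℂ := fun z z' =>
    rayDeriv n (fun c : Fin (m + m) → ℂ => besselGen rho (padZero N c)) (ringConfig m z t z' t')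
  have hΦ : Differentiable ℂ (fun p : ℂ × ℂ => Φ p.1 p.2) :=
    (differentiable_rayDeriv hG n).comp (differentiable_ringConfig m t t')
  -- Reduction to 2m variables. The point shifted second starts at (s + t' e_j)_i, and s itself has
  -- no power sums up to degree n, so the N-vector and the padded two-block configuration have equal
  -- power sums up to degree n < m.
  have h2 : ∀ j i, rayDeriv n (besselGen rho) (s + Pi.single j t' + Pi.single i t) =
      Φ ((s + Pi.single j t' : Fin N → ℂ) i) (s j) := by
    intro j i
    simp only [Φ]
    rw [← rayDeriv_padZero]
    refine rayDeriv_besselGen_eq_of_psum_eq hV fun k hk hkn => ?_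
    rw [sum_padZero_pow hN hk, sum_ringConfig_pow hk (by omega), sum_add_single_pow,
      sum_add_single_pow, hspow k hk hkn]
    ring
  simp only [h2] at h1
  rw [sum_sum_diffProd_eq_contourInt hsinj hsε (by rw [hε]; linarith [norm_pos_iff.mpr ht0'])
    ht ht' ht0 ht0' hε0 hΦ] at h1
  have h3 := h1.mul_left (diffProd s)⁻¹
  rw [inv_mul_cancel_left₀ (diffProd_ne_zero hsinj)] at h3
  have hk : ∀ τ z : ℂ, ∏ l, (z + τ - s l) / (z - s l) = shiftKernel N ε τ z := fun τ z =>
    prod_unityRoot_shift hN0 _ _ _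
  simp only [hk] at h3
  refine (congrArg (fun f => HasSum f _) (funext fun l => ?_)).mp h3
  rw [mul_left_comm, inv_mul_cancel_left₀ (diffProd_ne_zero hsinj)]

end Config

/-! ### Limits of contour integrals and of difference quotients -/

section ContourLimit

lemma tendsto_contourInt {R B : ℝ} (hR : 0 ≤ R) {f : ℕ → ℂ → ℂ} {g : ℂ → ℂ}
    (hc : ∀ᶠ N in atTop, Continuous fun α : ℝ => f N (circleMap 0 R α))
    (hB : ∀ᶠ N in atTop, ∀ z, ‖z‖ = R → ‖f N z‖ ≤ B)
    (hl : ∀ z, ‖z‖ = R → Tendsto (fun N => f N z) atTop (𝓝 (g z))) :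
    Tendsto (fun N => contourInt R (f N)) atTop (𝓝 (contourInt R g)) := by
  have hn : ∀ α, ‖circleMap 0 R α‖ = R := fun α => by simp [abs_of_nonneg hR]
  unfold contourInt
  refine Tendsto.const_mul _ ?_
  unfold circleIntegral
  refine intervalIntegral.tendsto_integral_filter_of_dominated_convergence (fun _ => R * B)
    ?_ ?_ (by simp) ?_
  · filter_upwards [hc] with N h
    refine Continuous.aestronglyMeasurable ?_
    simp only [deriv_circleMap]
    exact ((continuous_circleMap 0 R).mul continuous_const).smul h
  · filter_upwards [hB] with N h
    refine Eventually.of_forall fun α _ => ?_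
    rw [norm_smul, deriv_circleMap, norm_mul, hn, Complex.norm_I, mul_one]
    exact mul_le_mul_of_nonneg_left (h _ (hn α)) hR
  · exact Eventually.of_forall fun α _ => (hl _ (hn α)).const_smul _

lemma norm_contourInt_le {R B : ℝ} (hR : 0 ≤ R) {f : ℂ → ℂ} (hB : ∀ z, ‖z‖ = R → ‖f z‖ ≤ B) :
    ‖contourInt R f‖ ≤ R * B := by
  have := circleIntegral.norm_two_pi_i_inv_smul_integral_le_of_norm_le_const (f := f) (c := 0) hR
    fun z hz => hB z (by simpa using hz)
  simpa [contourInt] using this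

lemma iteratedDeriv_eq_contourInt {R : ℝ} (hR : 0 < R) (n : ℕ) {f : ℂ → ℂ}
    (hf : DifferentiableOn ℂ f (Metric.closedBall 0 R)) :
    iteratedDeriv n f 0 = (n ! : ℂ) * contourInt R fun z => (1 / z ^ (n + 1)) * f z := by
  have h := hf.circleIntegral_one_div_sub_center_pow_smul hR n
  simp only [sub_zero, smul_eq_mul] at h
  have hn : (n ! : ℂ) ≠ 0 := by exact_mod_cast n.factorial_ne_zero
  rw [contourInt, h]
  field_simp [Complex.two_pi_I_ne_zero]

lemma continuous_contourInt {X : Type*} [TopologicalSpace X] {R : ℝ} {f : X → ℂ → ℂ}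
    (hf : Continuous fun p : X × ℝ => f p.1 (circleMap 0 R p.2)) :
    Continuous fun x => contourInt R (f x) := by
  unfold contourInt circleIntegral
  refine continuous_const.mul
    (intervalIntegral.continuous_parametric_intervalIntegral_of_continuous' ?_ _ _)
  simp only [deriv_circleMap, Function.uncurry_def]
  exact (((continuous_circleMap 0 R).comp continuous_snd).mul continuous_const).smul hf

end ContourLimit

section DifferenceQuotient

variable {E : Type*} [NormedAddCommGroup E] [NormedSpace ℂ E]

/-- Schwarz's lemma for v ↦ f(x + v y), which maps the unit disc into the ball of radius 2C about
f(x). -/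
lemma norm_sub_le_of_bounded {f : E → ℂ} {ρ C : ℝ} (hf : DifferentiableOn ℂ f (Metric.ball 0 ρ))
    (hC : ∀ x ∈ Metric.ball (0 : E) ρ, ‖f x‖ ≤ C) {x y : E} (hxy : ‖x‖ + ‖y‖ < ρ) {w : ℂ}
    (hw : ‖w‖ < 1) : ‖f (x + w • y) - f x‖ ≤ 2 * C * ‖w‖ := by
  have hmem : ∀ v ∈ Metric.ball (0 : ℂ) 1, x + v • y ∈ Metric.ball (0 : E) ρ := by
    intro v hv
    rw [mem_ball_zero_iff] at hv ⊢
    calc ‖x + v • y‖ ≤ ‖x‖ + ‖v‖ * ‖y‖ := (norm_add_le _ _).trans (by rw [norm_smul])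
      _ ≤ ‖x‖ + 1 * ‖y‖ := by gcongr
      _ < ρ := by linarith
  have hd : DifferentiableOn ℂ (fun v : ℂ => f (x + v • y)) (Metric.ball 0 1) := by
    refine hf.comp (by fun_prop) hmem
  have h := Complex.dist_le_div_mul_dist_of_mapsTo_ball (R₂ := 2 * C) hd (fun v hv => ?_)
    (mem_ball_zero_iff.mpr hw)
  · simpa [dist_eq_norm] using h
  · rw [Metric.mem_closedBall, dist_eq_norm]
    have h1 := hC _ (hmem v hv)
    have h2 := hC _ (hmem 0 (by simp))
    linarith [norm_sub_le (f (x + v • y)) (f (x + (0 : ℂ) • y))]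

/-- The derivative of the limit is reached with step 1/N although the functions vary with N: the
increment of `F N - f` is bounded by its small supremum times 1/N, which compensates the factor N.
-/
lemma tendsto_differenceQuotient {F : ℕ → E → ℂ} {f : E → ℂ} {ρ : ℝ}
    (hF : ∀ᶠ N in atTop, DifferentiableOn ℂ (F N) (Metric.ball 0 ρ))
    (hf : DifferentiableOn ℂ f (Metric.ball 0 ρ))
    (hlim : TendstoUniformlyOn F f atTop (Metric.ball 0 ρ)) {x y : E} (hxy : ‖x‖ + ‖y‖ < ρ)
    {d : ℂ} (hd : HasDerivAt (fun w : ℂ => f (x + w • y)) d 0) :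
    Tendsto (fun N : ℕ => (N : ℂ) * (F N (x + (N : ℂ)⁻¹ • y) - F N x)) atTop (𝓝 d) := by
  have hinv : Tendsto (fun N : ℕ => (N : ℂ)⁻¹) atTop (𝓝[≠] 0) := by
    rw [tendsto_nhdsWithin_iff]
    refine ⟨?_, ?_⟩
    · exact tendsto_inv_atTop_nhds_zero_nat
    · filter_upwards [eventually_gt_atTop 0] with N hN
      simp [hN.ne']
  have h1 : Tendsto (fun N : ℕ => (N : ℂ) * (f (x + (N : ℂ)⁻¹ • y) - f x)) atTop (𝓝 d) := by
    have := (hasDerivAt_iff_tendsto_slope_zero.mp hd).comp hinv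
    simpa [Function.comp_def] using this
  have h2 : Tendsto (fun N : ℕ => (N : ℂ) * (F N (x + (N : ℂ)⁻¹ • y) - F N x) -
      (N : ℂ) * (f (x + (N : ℂ)⁻¹ • y) - f x)) atTop (𝓝 0) := by
    rw [NormedAddGroup.tendsto_nhds_zero]
    intro ε hε
    filter_upwards [hF, Metric.tendstoUniformlyOn_iff.mp hlim (ε / 4) (by positivity),
      eventually_gt_atTop 1] with N hN hNε hN1
    have hNpos : (0 : ℝ) < N := by exact_mod_cast (by omega : 0 < N)
    have hnorm : ‖(N : ℂ)⁻¹‖ = (N : ℝ)⁻¹ := by simp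
    have h := norm_sub_le_of_bounded (f := fun v => F N v - f v) (C := ε / 4) (hN.sub hf)
      (fun v hv => by rw [← dist_eq_norm, dist_comm]; exact (hNε v hv).le) hxy (w := (N : ℂ)⁻¹)
      (by rw [hnorm]; exact inv_lt_one_of_one_lt₀ (by exact_mod_cast hN1))
    rw [← mul_sub, norm_mul, Complex.norm_natCast]
    calc _ = (N : ℝ) * ‖(F N (x + (N : ℂ)⁻¹ • y) - f (x + (N : ℂ)⁻¹ • y)) - (F N x - f x)‖ := by
          congr 2; ring
      _ ≤ N * (2 * (ε / 4) * ‖(N : ℂ)⁻¹‖) := by gcongr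
      _ = ε / 2 := by rw [hnorm]; field_simp; ring
      _ < ε := by linarith
  simpa using h2.add h1

lemma norm_differenceQuotient_le {f : E → ℂ} {ρ C : ℝ}
    (hf : DifferentiableOn ℂ f (Metric.ball 0 ρ))
    (hC : ∀ x ∈ Metric.ball (0 : E) ρ, ‖f x‖ ≤ C) {x y : E} (hxy : ‖x‖ + ‖y‖ < ρ) {N : ℕ}
    (hN : 1 < N) : ‖(N : ℂ) * (f (x + (N : ℂ)⁻¹ • y) - f x)‖ ≤ 2 * C := by
  have hNpos : (0 : ℝ) < N := by exact_mod_cast (by omega : 0 < N)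
  have hnorm : ‖(N : ℂ)⁻¹‖ = (N : ℝ)⁻¹ := by simp
  have h := norm_sub_le_of_bounded hf hC hxy (w := (N : ℂ)⁻¹)
      (by rw [hnorm]; exact inv_lt_one_of_one_lt₀ (by exact_mod_cast hN))
  rw [norm_mul, Complex.norm_natCast]
  calc _ ≤ (N : ℝ) * (2 * C * ‖(N : ℂ)⁻¹‖) := by gcongr
    _ = 2 * C := by rw [hnorm]; field_simp

end DifferenceQuotient

section Kernels

lemma shiftKernel_eq {N : ℕ} {ε t z : ℂ} (hz : z ≠ 0) :
    shiftKernel N ε t z = ((1 + t / z) ^ N - (ε / z) ^ N) / (1 - (ε / z) ^ N) := by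
  have hzN : z ^ N ≠ 0 := pow_ne_zero _ hz
  rw [shiftKernel, ← mul_div_mul_left ((1 + t / z) ^ N - (ε / z) ^ N) _ hzN, mul_sub, mul_sub,
    ← mul_pow, ← mul_pow, mul_add, mul_one, mul_div_cancel₀ _ hz, mul_div_cancel₀ _ hz, mul_one]

lemma norm_pow_div_le {N : ℕ} {ε : ℝ} (hε0 : 0 ≤ ε) (hε : ε ≤ 1 / 4) {z : ℂ}
    (hz : 1 ≤ ‖z‖) : ‖((ε : ℂ) / z) ^ N‖ ≤ (1 / 4) ^ N := by
  rw [norm_pow, norm_div, Complex.norm_real, Real.norm_eq_abs, abs_of_nonneg hε0]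
  refine pow_le_pow_left₀ (by positivity) ?_ N
  rw [div_le_iff₀ (by linarith)]
  nlinarith

/-- After division by z^N the numerator is at most (1 + 1/N)^N + 1/4 ≤ e + 1/4 in norm and the
denominator at least 3/4. The bound uniform in N serves dominated convergence. -/
lemma norm_shiftKernel_le {N : ℕ} (hN : 1 ≤ N) {ε : ℝ} (hε0 : 0 ≤ ε) (hε : ε ≤ 1 / 4) {z τ : ℂ}
    (hz : 1 ≤ ‖z‖) (hτ : ‖τ‖ ≤ 1) : ‖shiftKernel N ε (τ / N) z‖ ≤ 8 := by
  have hz0 : z ≠ 0 := by rintro rfl; norm_num at hz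
  have hp := norm_pow_div_le (N := N) hε0 hε hz
  have hp' : ((1 : ℝ) / 4) ^ N ≤ 1 / 4 := pow_le_of_le_one (by norm_num) (by norm_num) (by omega)
  have h1 : ‖(1 + τ / N / z) ^ N‖ ≤ 3 := by
    rw [norm_pow]
    have hN0 : (0 : ℝ) < N := by exact_mod_cast hN
    have : ‖1 + τ / N / z‖ ≤ Real.exp (1 / N) := by
      refine (norm_add_le _ _).trans ?_
      rw [norm_one, norm_div, norm_div, Complex.norm_natCast]
      have : ‖τ‖ / N / ‖z‖ ≤ 1 / N := by
        rw [div_le_iff₀ (by linarith)]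
        calc ‖τ‖ / N ≤ 1 / N := by gcongr
          _ ≤ 1 / N * ‖z‖ := le_mul_of_one_le_right (by positivity) hz
      linarith [Real.add_one_le_exp (1 / (N : ℝ))]
    calc ‖1 + τ / N / z‖ ^ N ≤ Real.exp (1 / N) ^ N := by gcongr
      _ = Real.exp 1 := by rw [← Real.exp_nat_mul]; congr 1; field_simp
      _ ≤ 3 := Real.exp_one_lt_three.le
  have h2 : 3 / 4 ≤ ‖1 - ((ε : ℂ) / z) ^ N‖ := by
    have := norm_sub_norm_le (1 : ℂ) (((ε : ℂ) / z) ^ N)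
    rw [norm_one] at this
    linarith
  rw [shiftKernel_eq hz0, norm_div, div_le_iff₀ (by linarith)]
  have := norm_sub_le ((1 + τ / N / z) ^ N) (((ε : ℂ) / z) ^ N)
  linarith

lemma shiftKernel_denom_ne_zero {N : ℕ} (hN : 1 ≤ N) {ε : ℝ} (hε0 : 0 ≤ ε) (hε : ε ≤ 1 / 4)
    {z : ℂ} (hz : 1 ≤ ‖z‖) : z ^ N - (ε : ℂ) ^ N ≠ 0 := by
  intro h
  have h1 : ‖z ^ N‖ = ‖(ε : ℂ) ^ N‖ := by rw [sub_eq_zero.mp h]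
  rw [norm_pow, norm_pow, Complex.norm_real, Real.norm_eq_abs, abs_of_nonneg hε0] at h1
  have h2 : ε ^ N < ‖z‖ ^ N := pow_lt_pow_left₀ (by linarith) hε0 (by omega)
  exact h2.ne h1.symm

lemma tendsto_shiftKernel {ε : ℕ → ℝ} (hε0 : ∀ N, 0 ≤ ε N)
    (hε : ∀ᶠ N in atTop, ε N ≤ 1 / 4) {z : ℂ} (τ : ℂ) (hz : 1 ≤ ‖z‖) :
    Tendsto (fun N : ℕ => shiftKernel N (ε N) (τ / N) z) atTop (𝓝 (Complex.exp (τ / z))) := by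
  have hz0 : z ≠ 0 := by rintro rfl; norm_num at hz
  have h0 : Tendsto (fun N : ℕ => (((ε N : ℝ) : ℂ) / z) ^ N) atTop (𝓝 0) := by
    refine squeeze_zero_norm' (a := fun N : ℕ => ((1 : ℝ) / 4) ^ N) ?_
      (tendsto_pow_atTop_nhds_zero_of_lt_one (by norm_num) (by norm_num))
    filter_upwards [hε] with N h1
    exact norm_pow_div_le (hε0 N) h1 hz
  have h1 := Complex.tendsto_one_add_div_pow_exp (τ / z)
  have h := (h1.sub h0).div (tendsto_const_nhds.sub h0) (a := Complex.exp (τ / z) - 0)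
    (b := (1 : ℂ) - 0) (by norm_num)
  simp only [sub_zero, div_one] at h
  refine h.congr fun N => ?_
  simp only [Pi.div_apply]
  rw [shiftKernel_eq hz0, div_right_comm τ z]

lemma crossFactor_denom_ge {t t' z z' : ℂ} (ht : ‖t‖ ≤ 1 / 4) (ht' : ‖t'‖ ≤ 1 / 4)
    (hz : ‖z‖ = 2) (hz' : ‖z'‖ = 1) : 9 / 16 ≤ ‖(z + t - z') * (z - z' - t')‖ := by
  have h1 : 3 / 4 ≤ ‖z + t - z'‖ := by
    have a := norm_sub_norm_le z (z' - t)
    have b := norm_sub_le z' t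
    rw [show z - (z' - t) = z + t - z' by ring] at a
    linarith
  have h2 : 3 / 4 ≤ ‖z - z' - t'‖ := by
    have a := norm_sub_norm_le z (z' + t')
    have b := norm_add_le z' t'
    rw [show z - (z' + t') = z - z' - t' by ring] at a
    linarith
  rw [norm_mul]
  nlinarith

/-- The numerator is at most (7/2)·3 and the denominator at least (3/4)², with quotient below 20. -/
lemma norm_crossFactor_le {t t' z z' : ℂ} (ht : ‖t‖ ≤ 1 / 4) (ht' : ‖t'‖ ≤ 1 / 4)
    (hz : ‖z‖ = 2) (hz' : ‖z'‖ = 1) : ‖crossFactor t t' z z'‖ ≤ 20 := by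
  have h := crossFactor_denom_ge ht ht' hz hz'
  rw [crossFactor, norm_div, div_le_iff₀ (by linarith), norm_mul]
  have h1 : ‖z + t - z' - t'‖ ≤ 7 / 2 := by
    have a := norm_sub_le (z + t) (z' + t')
    have b := norm_add_le z t
    have c := norm_add_le z' t'
    rw [show z + t - (z' + t') = z + t - z' - t' by ring] at a
    linarith
  have h2 : ‖z - z'‖ ≤ 3 := by linarith [norm_sub_le z z']
  nlinarith [norm_nonneg (z + t - z' - t'), norm_nonneg (z - z')]

lemma tendsto_crossFactor (τ τ' : ℂ) {z z' : ℂ} (hz : ‖z‖ = 2) (hz' : ‖z'‖ = 1) :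
    Tendsto (fun N : ℕ => crossFactor (τ / N) (τ' / N) z z') atTop (𝓝 1) := by
  have h0 : ∀ τ : ℂ, Tendsto (fun N : ℕ => τ / N) atTop (𝓝 0) := fun τ =>
    tendsto_const_div_atTop_nhds_zero_nat τ
  have hne : z - z' ≠ 0 := by
    intro h
    rw [sub_eq_zero.mp h] at hz
    linarith
  have hc : ContinuousAt (fun p : ℂ × ℂ => crossFactor p.1 p.2 z z') (0, 0) := by
    unfold crossFactor
    refine ContinuousAt.div (by fun_prop) (by fun_prop) ?_
    simpa using hne
  have h := hc.tendsto.comp ((h0 τ).prodMk_nhds (h0 τ'))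
  have e : crossFactor 0 0 z z' = 1 := by
    simp only [crossFactor, add_zero, sub_zero]
    exact div_self (mul_ne_zero hne hne)
  simpa [e, Function.comp_def] using h

end Kernels

section ConfigEstimates

lemma ringConfig_eq_add_smul (m : ℕ) (z τ z' τ' w : ℂ) :
    ringConfig m z (w * τ) z' (w * τ') = ringConfig m z 0 z' 0 + w • ringConfig m 0 τ 0 τ' := by
  ext i
  refine Fin.addCases (fun l => ?_) (fun l => ?_) i <;>
  simp only [ringConfig, ringBlock, Fin.append_left, Fin.append_right, Pi.add_apply,
    Pi.smul_apply, smul_eq_mul] <;>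
  split_ifs <;> ring

lemma norm_ringBlock_le {m : ℕ} (z t : ℂ) {B : ℝ} (h : ‖z‖ + ‖t‖ ≤ B) (l : Fin m) :
    ‖ringBlock m z t l‖ ≤ B := by
  have hm : m ≠ 0 := by have := l.2; omega
  have h1 : ‖z * unityRoot m ^ (l : ℕ)‖ = ‖z‖ := by
    rw [norm_mul, norm_pow, norm_unityRoot hm, one_pow, mul_one]
  have h2 : ‖(if (l : ℕ) = 0 then t else 0 : ℂ)‖ ≤ ‖t‖ := by split_ifs <;> simp
  unfold ringBlock
  exact (norm_add_le _ _).trans (by rw [h1]; linarith)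

lemma norm_ringConfig_le {m : ℕ} {z t z' t' : ℂ} {B : ℝ} (hB : 0 ≤ B) (h : ‖z‖ + ‖t‖ ≤ B)
    (h' : ‖z'‖ + ‖t'‖ ≤ B) : ‖ringConfig m z t z' t'‖ ≤ B := by
  rw [pi_norm_le_iff_of_nonneg hB]
  intro i
  refine Fin.addCases (fun l => ?_) (fun l => ?_) i
  · simpa only [ringConfig, Fin.append_left] using norm_ringBlock_le z t h l
  · simpa only [ringConfig, Fin.append_right] using norm_ringBlock_le z' t' h' l

lemma sum_ringBlock_mul {m : ℕ} (hm : 0 < m) (g : ℂ → ℂ) (z τ : ℂ) :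
    ∑ l : Fin m, g (ringBlock m z 0 l) * ringBlock m 0 τ l = g z * τ := by
  rw [Finset.sum_eq_single ⟨0, hm⟩]
  · simp [ringBlock]
  · intro l _ hl
    have : (l : ℕ) ≠ 0 := fun h => hl (Fin.ext h)
    simp [ringBlock, this]
  · simp

lemma hasDerivAt_sum_ringConfig {P : ℂ → ℂ} {ρ : ℝ} (hP : DifferentiableOn ℂ P (Metric.ball 0 ρ))
    {m : ℕ} (hm : 0 < m) {z z' θ : ℂ} (τ τ' : ℂ) (hθ : ‖θ • ringConfig m z 0 z' 0‖ < ρ) :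
    HasDerivAt (fun w : ℂ => ∑ i, P ((θ • ringConfig m z 0 z' 0 +
        w • (θ • ringConfig m 0 τ 0 τ') : Fin (m + m) → ℂ) i))
      (θ * (τ * deriv P (θ * z)) + θ * (τ' * deriv P (θ * z'))) 0 := by
  have h1 : HasDerivAt (fun w : ℂ => ∑ i, P ((θ • ringConfig m z 0 z' 0 +
        w • (θ • ringConfig m 0 τ 0 τ') : Fin (m + m) → ℂ) i))
      (∑ i, deriv P (θ * ringConfig m z 0 z' 0 i) * (θ * ringConfig m 0 τ 0 τ' i)) 0 := by
    refine HasDerivAt.fun_sum fun i _ => ?_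
    have hmem : θ * ringConfig m z 0 z' 0 i ∈ Metric.ball (0 : ℂ) ρ := by
      rw [mem_ball_zero_iff]
      exact (norm_le_pi_norm (θ • ringConfig m z 0 z' 0) i).trans_lt hθ
    have hd : HasDerivAt P (deriv P (θ * ringConfig m z 0 z' 0 i))
        (θ * ringConfig m z 0 z' 0 i + 0 * (θ * ringConfig m 0 τ 0 τ' i)) := by
      rw [zero_mul, add_zero]
      exact (hP.differentiableAt (Metric.isOpen_ball.mem_nhds hmem)).hasDerivAt
    have hl : HasDerivAt (fun w : ℂ => θ * ringConfig m z 0 z' 0 i +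
        w * (θ * ringConfig m 0 τ 0 τ' i)) (θ * ringConfig m 0 τ 0 τ' i) 0 := by
      simpa using ((hasDerivAt_id (0 : ℂ)).mul_const (θ * ringConfig m 0 τ 0 τ' i)).const_add
        (θ * ringConfig m z 0 z' 0 i)
    exact hd.comp (0 : ℂ) hl
  convert h1 using 1
  rw [Fin.sum_univ_add]
  simp only [ringConfig, Fin.append_left, Fin.append_right]
  have h2 : ∀ z τ : ℂ, ∑ l : Fin m, deriv P (θ * ringBlock m z 0 l) * (θ * ringBlock m 0 τ l) =
      θ * (τ * deriv P (θ * z)) := by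
    intro z τ
    have := sum_ringBlock_mul hm (fun w => deriv P (θ * w)) z τ
    rw [mul_comm τ, ← this, Finset.mul_sum]
    exact Finset.sum_congr rfl fun l _ => by ring
  rw [h2, h2]

end ConfigEstimates

lemma continuous_rayDeriv_ringConfig {m : ℕ} {g : (Fin (m + m) → ℂ) → ℂ}
    (hg : AnalyticAt ℂ g 0) (n : ℕ) (t t' : ℂ) {X : Type*} [TopologicalSpace X] {a b : X → ℂ}
    (ha : Continuous a) (hb : Continuous b) :
    Continuous fun x => rayDeriv n g (ringConfig m (a x) t (b x) t') := by
  have h1 : Continuous fun x => ringConfig m (a x) t (b x) t' :=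
    (differentiable_ringConfig m t t').continuous.comp (ha.prodMk hb)
  exact (differentiable_rayDeriv hg n).continuous.comp h1

section RayLimit

variable {E : Type*} [NormedAddCommGroup E] [NormedSpace ℂ E]

lemma analyticAt_comp_smul {f : E → ℂ} {ρ : ℝ} (hρ : 0 < ρ)
    (hf : DifferentiableOn ℂ f (Metric.ball 0 ρ)) (v : E) :
    AnalyticAt ℂ (fun θ : ℂ => f (θ • v)) 0 := by
  have hc : Continuous fun θ : ℂ => θ • v := by fun_prop
  have ho : IsOpen ((fun θ : ℂ => θ • v) ⁻¹' Metric.ball 0 ρ) := Metric.isOpen_ball.preimage hc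
  have hd : DifferentiableOn ℂ (fun θ : ℂ => f (θ • v))
      ((fun θ : ℂ => θ • v) ⁻¹' Metric.ball 0 ρ) :=
    hf.comp (by fun_prop) fun _ h => h
  exact hd.analyticAt (ho.mem_nhds (by simpa using hρ))

/-- `rayDeriv` along a small displacement of a direction in which the function is flat. -/
lemma rayDeriv_add_eq {f G : E → ℂ} {ρ : ℝ} (hρ : 0 < ρ)
    (hf : DifferentiableOn ℂ f (Metric.ball 0 ρ)) (hG : AnalyticAt ℂ G 0) (hG0 : G 0 = 1) {M : ℂ}
    (hexp : G =ᶠ[𝓝 0] fun s => Complex.exp (M * f s)) {n : ℕ} {c : E}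
    (hflat : ∀ d, 1 ≤ d → d ≤ n → rayDeriv d G c = 0) (w : ℂ) (e : E) :
    rayDeriv n G (c + w • e) =
      iteratedDeriv n (fun θ : ℂ => Complex.exp (M * (f (θ • c + w • (θ • e)) - f (θ • c)))) 0 := by
  have h1 : (fun θ : ℂ => G (θ • (c + w • e))) =ᶠ[𝓝 0] fun θ : ℂ =>
      Complex.exp (M * (f (θ • c + w • (θ • e)) - f (θ • c))) * G (θ • c) := by
    have hc : ∀ v : E, Tendsto (fun θ : ℂ => θ • v) (𝓝 0) (𝓝 0) := fun v => by
      have : Continuous fun θ : ℂ => θ • v := by fun_prop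
      simpa using this.tendsto 0
    filter_upwards [(hc (c + w • e)).eventually hexp, (hc c).eventually hexp] with θ ha hb
    rw [ha, hb, ← Complex.exp_add, smul_add, smul_comm θ w e]
    congr 1
    ring
  rw [rayDeriv, h1.iteratedDeriv_eq]
  have ha : AnalyticAt ℂ (fun θ : ℂ =>
      Complex.exp (M * (f (θ • c + w • (θ • e)) - f (θ • c)))) 0 := by
    have h2 := analyticAt_comp_smul hρ hf (c + w • e)
    have h3 := analyticAt_comp_smul hρ hf c
    simp only [smul_add, smul_comm _ w e] at h2
    exact (analyticAt_const.mul (h2.sub h3)).cexp'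
  rw [iteratedDeriv_mul_of_flat ha (analyticAt_ray hG c) hflat]
  simp [hG0]

lemma norm_iteratedDeriv_exp_le {k : ℂ → ℂ} {r B : ℝ} (hr : 0 < r)
    (hk : DifferentiableOn ℂ k (Metric.closedBall 0 r)) (hB : ∀ θ, ‖θ‖ = r → ‖k θ‖ ≤ B) (n : ℕ) :
    ‖iteratedDeriv n (fun θ => Complex.exp (k θ)) 0‖ ≤
      (n ! : ℝ) * (r * ((r ^ (n + 1))⁻¹ * Real.exp B)) := by
  rw [iteratedDeriv_eq_contourInt hr n hk.cexp, norm_mul, Complex.norm_natCast]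
  refine mul_le_mul_of_nonneg_left (norm_contourInt_le hr.le fun θ hθ => ?_) (by positivity)
  rw [norm_mul, norm_div, norm_one, norm_pow, hθ, one_div]
  have : ‖Complex.exp (k θ)‖ ≤ Real.exp B := by
    rw [Complex.norm_exp]
    exact Real.exp_le_exp.mpr ((Complex.re_le_norm _).trans (hB θ hθ))
  gcongr

lemma tendsto_iteratedDeriv_exp {k : ℕ → ℂ → ℂ} {l : ℂ → ℂ} {r B : ℝ} (hr : 0 < r)
    (hk : ∀ᶠ N in atTop, DifferentiableOn ℂ (k N) (Metric.closedBall 0 r))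
    (hB : ∀ᶠ N in atTop, ∀ θ, ‖θ‖ = r → ‖k N θ‖ ≤ B)
    (hl : DifferentiableOn ℂ l (Metric.closedBall 0 r))
    (hlim : ∀ θ, ‖θ‖ = r → Tendsto (fun N => k N θ) atTop (𝓝 (l θ))) (n : ℕ) :
    Tendsto (fun N => iteratedDeriv n (fun θ => Complex.exp (k N θ)) 0) atTop
      (𝓝 (iteratedDeriv n (fun θ => Complex.exp (l θ)) 0)) := by
  rw [iteratedDeriv_eq_contourInt hr n hl.cexp]
  have hmem : ∀ α, circleMap 0 r α ∈ Metric.closedBall (0 : ℂ) r := fun α =>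
    circleMap_mem_closedBall 0 hr.le α
  have h0 : ∀ α, circleMap 0 r α ≠ 0 := fun α => circleMap_ne_center hr.ne'
  refine Tendsto.congr' (f₁ := fun N => (n ! : ℂ) * contourInt r fun θ =>
    (1 / θ ^ (n + 1)) * Complex.exp (k N θ)) ?_ (Tendsto.const_mul _ ?_)
  · filter_upwards [hk] with N h
    rw [iteratedDeriv_eq_contourInt hr n h.cexp]
  · refine tendsto_contourInt (B := (r ^ (n + 1))⁻¹ * Real.exp B) hr.le ?_ ?_ ?_
    · filter_upwards [hk] with N h
      refine Continuous.mul ?_ ?_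
      · refine continuous_const.div ((continuous_circleMap 0 r).pow _) fun α =>
          pow_ne_zero _ (h0 α)
      · exact Complex.continuous_exp.comp
          (h.continuousOn.comp_continuous (continuous_circleMap 0 r) hmem)
    · filter_upwards [hB] with N h θ hθ
      rw [norm_mul, norm_div, norm_one, norm_pow, hθ, one_div]
      have : ‖Complex.exp (k N θ)‖ ≤ Real.exp B := by
        rw [Complex.norm_exp]
        exact Real.exp_le_exp.mpr ((Complex.re_le_norm _).trans (h θ hθ))
      gcongr
    · intro θ hθ
      exact ((Complex.continuous_exp.tendsto _).comp (hlim θ hθ)).const_mul _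

end RayLimit

lemma tendsto_contourInt₂ {R R' B : ℝ} (hR : 0 ≤ R) (hR' : 0 ≤ R') {f : ℕ → ℂ → ℂ → ℂ}
    {g : ℂ → ℂ → ℂ}
    (hc : ∀ᶠ N in atTop, Continuous fun p : ℝ × ℝ => f N (circleMap 0 R p.1) (circleMap 0 R' p.2))
    (hB : ∀ᶠ N in atTop, ∀ z z', ‖z‖ = R → ‖z'‖ = R' → ‖f N z z'‖ ≤ B)
    (hl : ∀ z z', ‖z‖ = R → ‖z'‖ = R' → Tendsto (fun N => f N z z') atTop (𝓝 (g z z'))) :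
    Tendsto (fun N => contourInt R fun z => contourInt R' fun z' => f N z z') atTop
      (𝓝 (contourInt R fun z => contourInt R' fun z' => g z z')) := by
  refine tendsto_contourInt (B := R' * B) hR ?_ ?_ ?_
  · filter_upwards [hc] with N hN
    exact continuous_contourInt (f := fun α z' => f N (circleMap 0 R α) z') hN
  · filter_upwards [hB] with N hN z hz
    exact norm_contourInt_le hR' fun z' hz' => hN z z' hz hz'
  · intro z hz
    obtain ⟨α, hα⟩ : ∃ α : ℝ, circleMap 0 R α = z := by
      have : z ∈ Set.range (circleMap 0 R) := by
        rw [range_circleMap]; simpa [abs_of_nonneg hR] using hz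
      exact this
    refine tendsto_contourInt (B := B) hR' ?_ ?_ fun z' hz' => hl z z' hz hz'
    · filter_upwards [hc] with N hN
      rw [← hα]
      exact hN.comp (Continuous.prodMk_right α)
    · filter_upwards [hB] with N hN z' hz'
      exact hN z z' hz hz'

/-! ### Convergence of the contour integrals under an additive limit of logarithms -/

section MomentLimit

/-- Hypotheses on functions `G N = exp (N F N)` near the origin, of `2m` variables, whose
logarithms are asymptotically additive. -/
structure AdditiveLimit (m n : ℕ) (G F : ℕ → (Fin (m + m) → ℂ) → ℂ) (P : ℂ → ℂ) (ρ C : ℝ) :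
    Prop where
  pos : 0 < ρ
  analyticAt : ∀ᶠ N in atTop, AnalyticAt ℂ (G N) 0
  zero : ∀ᶠ N in atTop, G N 0 = 1
  flat : ∀ᶠ N in atTop, ∀ d, 1 ≤ d → d ≤ n → ∀ z z', rayDeriv d (G N) (ringConfig m z 0 z' 0) = 0
  differentiableOn : ∀ᶠ N in atTop, DifferentiableOn ℂ (F N) (Metric.ball 0 ρ)
  eq_exp : ∀ᶠ N in atTop, G N =ᶠ[𝓝 0] fun s => Complex.exp ((N : ℂ) * F N s)
  differentiableOn_lim : DifferentiableOn ℂ P (Metric.ball 0 ρ)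
  bound : ∀ s ∈ Metric.ball (0 : ℂ) ρ, ‖P s‖ ≤ C
  tendsto : TendstoUniformlyOn F (fun s => ∑ i, P (s i)) atTop (Metric.ball 0 ρ)

variable {m n : ℕ} {G F : ℕ → (Fin (m + m) → ℂ) → ℂ} {P : ℂ → ℂ} {ρ C : ℝ}

lemma AdditiveLimit.eventually_bound (h : AdditiveLimit m n G F P ρ C) :
    ∀ᶠ N in atTop, ∀ s ∈ Metric.ball (0 : Fin (m + m) → ℂ) ρ,
      ‖F N s‖ ≤ 1 + (m + m : ℕ) * C := by
  filter_upwards [Metric.tendstoUniformlyOn_iff.mp h.tendsto 1 one_pos] with N hN s hs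
  have h1 : ‖∑ i, P (s i)‖ ≤ (m + m : ℕ) * C := by
    refine (norm_sum_le_of_le _ (n := fun _ => C) fun i _ => h.bound _ ?_).trans (by simp)
    rw [mem_ball_zero_iff] at hs ⊢
    exact (norm_le_pi_norm s i).trans_lt hs
  have h2 := hN s hs
  rw [dist_eq_norm] at h2
  have := norm_sub_norm_le (F N s) (∑ i, P (s i))
  rw [norm_sub_rev] at this
  linarith

/-- The configurations have norm at most 2 and 1, which explains the radius ρ/4: 3ρ/4 < ρ. -/
lemma norm_add_norm_smul_lt {m : ℕ} {ρ : ℝ} (hρ : 0 < ρ) {z z' τ τ' θ : ℂ} (hz : ‖z‖ = 2)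
    (hz' : ‖z'‖ = 1) (hτ : ‖τ‖ ≤ 1) (hτ' : ‖τ'‖ ≤ 1) (hθ : ‖θ‖ ≤ ρ / 4) :
    ‖θ • ringConfig m z 0 z' 0‖ + ‖θ • ringConfig m 0 τ 0 τ'‖ < ρ := by
  have h1 : ‖ringConfig m z 0 z' 0‖ ≤ 2 :=
    norm_ringConfig_le two_pos.le (by simp [hz]) (by simp [hz'])
  have h2 : ‖ringConfig m 0 τ 0 τ'‖ ≤ 1 :=
    norm_ringConfig_le one_pos.le (by simpa using hτ) (by simpa using hτ')
  rw [norm_smul, norm_smul]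
  have := norm_nonneg θ
  nlinarith

lemma differentiableOn_ray_diff {f : (Fin (m + m) → ℂ) → ℂ}
    (hf : DifferentiableOn ℂ f (Metric.ball 0 ρ)) {c e : Fin (m + m) → ℂ} {r : ℝ}
    (hr : ∀ θ : ℂ, ‖θ‖ ≤ r → ‖θ • c‖ + ‖θ • e‖ < ρ) {w : ℂ} (hw : ‖w‖ ≤ 1) (M : ℂ) :
    DifferentiableOn ℂ (fun θ : ℂ => M * (f (θ • c + w • (θ • e)) - f (θ • c)))
      (Metric.closedBall 0 r) := by
  have h1 : DifferentiableOn ℂ (fun θ : ℂ => f (θ • c + w • (θ • e))) (Metric.closedBall 0 r) := by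
    refine hf.comp (by fun_prop) fun θ hθ => ?_
    rw [mem_closedBall_zero_iff] at hθ
    rw [mem_ball_zero_iff]
    refine lt_of_le_of_lt ((norm_add_le _ _).trans ?_) (hr θ hθ)
    rw [norm_smul w]
    have := norm_nonneg (θ • e)
    nlinarith
  have h2 : DifferentiableOn ℂ (fun θ : ℂ => f (θ • c)) (Metric.closedBall 0 r) := by
    refine hf.comp (by fun_prop) fun θ hθ => ?_
    rw [mem_closedBall_zero_iff] at hθ
    rw [mem_ball_zero_iff]
    have := norm_nonneg (θ • e)
    linarith [hr θ hθ]
  exact (h1.sub h2).const_mul M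

/-- At the unshifted configuration G is flat, so dividing by its value there does not affect the
n-th derivative (`rayDeriv_add_eq`). What remains is the exponential of N(F(c + e/N) - F(c)), a
difference quotient converging to the derivative of the additive limit; only the two displaced
points enter it. -/
lemma AdditiveLimit.tendsto_rayDeriv (h : AdditiveLimit m n G F P ρ C) (hm : 0 < m)
    {z z' τ τ' : ℂ} (hz : ‖z‖ = 2) (hz' : ‖z'‖ = 1) (hτ : ‖τ‖ ≤ 1) (hτ' : ‖τ'‖ ≤ 1) :
    Tendsto (fun N : ℕ => rayDeriv n (G N) (ringConfig m z (τ / N) z' (τ' / N))) atTop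
      (𝓝 (iteratedDeriv n (fun θ => Complex.exp (θ * (τ * deriv P (θ * z))) *
        Complex.exp (θ * (τ' * deriv P (θ * z')))) 0)) := by
  have hρ := h.pos
  have hr4 : 0 < ρ / 4 := by positivity
  have hsm : ∀ θ : ℂ, ‖θ‖ ≤ ρ / 4 →
      ‖θ • ringConfig m z 0 z' 0‖ + ‖θ • ringConfig m 0 τ 0 τ'‖ < ρ := fun θ hθ =>
    norm_add_norm_smul_lt hρ hz hz' hτ hτ' hθ
  simp only [← Complex.exp_add]
  refine Tendsto.congr' (f₁ := fun N : ℕ => iteratedDeriv n (fun θ : ℂ => Complex.exp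
    ((N : ℂ) * (F N (θ • ringConfig m z 0 z' 0 + (N : ℂ)⁻¹ • (θ • ringConfig m 0 τ 0 τ')) -
      F N (θ • ringConfig m z 0 z' 0)))) 0) ?_ ?_
  · filter_upwards [h.analyticAt, h.zero, h.flat, h.differentiableOn, h.eq_exp] with N h1 h2 h3 h4 h5
    rw [div_eq_inv_mul, div_eq_inv_mul, ringConfig_eq_add_smul,
      rayDeriv_add_eq hρ h4 h1 h2 h5 fun d hd hdn => h3 d hd hdn z z']
  · have hP' : DifferentiableOn ℂ (deriv P) (Metric.ball 0 ρ) :=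
      h.differentiableOn_lim.deriv Metric.isOpen_ball
    have hPz : ∀ w : ℂ, ‖w‖ ≤ 2 → DifferentiableOn ℂ (fun θ => deriv P (θ * w))
        (Metric.closedBall 0 (ρ / 4)) := by
      intro w hw
      refine hP'.comp (by fun_prop) fun θ hθ => ?_
      rw [mem_closedBall_zero_iff] at hθ
      rw [mem_ball_zero_iff, norm_mul]
      have := norm_nonneg θ
      nlinarith
    refine tendsto_iteratedDeriv_exp hr4 (B := 2 * (1 + (m + m : ℕ) * C)) ?_ ?_ ?_ ?_ n
    · filter_upwards [h.differentiableOn, eventually_ge_atTop 1] with N h1 hN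
      refine differentiableOn_ray_diff h1 hsm ?_ _
      rw [norm_inv, Complex.norm_natCast]
      exact inv_le_one_of_one_le₀ (by exact_mod_cast hN)
    · filter_upwards [h.differentiableOn, h.eventually_bound, eventually_gt_atTop 1]
        with N h1 h2 hN θ hθ
      exact norm_differenceQuotient_le h1 h2 (hsm θ hθ.le) hN
    · exact (differentiableOn_id.mul ((hPz z hz.le).const_mul τ)).add
        (differentiableOn_id.mul ((hPz z' (by linarith)).const_mul τ'))
    · intro θ hθ
      have hdiff : DifferentiableOn ℂ (fun s : Fin (m + m) → ℂ => ∑ i, P (s i))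
          (Metric.ball 0 ρ) := by
        refine DifferentiableOn.fun_sum fun i _ => ?_
        refine h.differentiableOn_lim.comp (by fun_prop) fun s hs => ?_
        rw [mem_ball_zero_iff] at hs ⊢
        exact (norm_le_pi_norm s i).trans_lt hs
      refine tendsto_differenceQuotient h.differentiableOn hdiff h.tendsto (hsm θ hθ.le) ?_
      refine hasDerivAt_sum_ringConfig h.differentiableOn_lim hm τ τ' ?_
      have := norm_nonneg (θ • ringConfig m 0 τ 0 τ')
      linarith [hsm θ hθ.le]

lemma AdditiveLimit.exists_bound_rayDeriv (h : AdditiveLimit m n G F P ρ C)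
    {τ τ' : ℂ} (hτ : ‖τ‖ ≤ 1) (hτ' : ‖τ'‖ ≤ 1) :
    ∃ B : ℝ, 0 ≤ B ∧ ∀ᶠ N : ℕ in atTop, ∀ z z' : ℂ, ‖z‖ = 2 → ‖z'‖ = 1 →
      ‖rayDeriv n (G N) (ringConfig m z (τ / N) z' (τ' / N))‖ ≤ B := by
  have hρ := h.pos
  have hr4 : 0 < ρ / 4 := by positivity
  refine ⟨(n ! : ℝ) * (ρ / 4 * (((ρ / 4) ^ (n + 1))⁻¹ * Real.exp (2 * (1 + (m + m : ℕ) * C)))),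
    by positivity, ?_⟩
  filter_upwards [h.analyticAt, h.zero, h.flat, h.differentiableOn, h.eq_exp, h.eventually_bound,
    eventually_gt_atTop 1] with N h1 h2 h3 h4 h5 h6 hN z z' hz hz'
  have hsm : ∀ θ : ℂ, ‖θ‖ ≤ ρ / 4 →
      ‖θ • ringConfig m z 0 z' 0‖ + ‖θ • ringConfig m 0 τ 0 τ'‖ < ρ := fun θ hθ =>
    norm_add_norm_smul_lt hρ hz hz' hτ hτ' hθ
  rw [div_eq_inv_mul, div_eq_inv_mul, ringConfig_eq_add_smul,
    rayDeriv_add_eq hρ h4 h1 h2 h5 fun d hd hdn => h3 d hd hdn z z']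
  refine norm_iteratedDeriv_exp_le hr4 ?_ ?_ n
  · refine differentiableOn_ray_diff h4 hsm ?_ _
    rw [norm_inv, Complex.norm_natCast]
    exact inv_le_one_of_one_le₀ (by exact_mod_cast hN.le)
  · intro θ hθ
    exact norm_differenceQuotient_le h4 h6 (hsm θ hθ.le) hN

/-- The contour integral representing the joint moments converges. -/
theorem AdditiveLimit.tendsto_contourInt (h : AdditiveLimit m n G F P ρ C) (hm : 0 < m)
    {τ τ' : ℂ} (hτ : ‖τ‖ ≤ 1) (hτ' : ‖τ'‖ ≤ 1) :
    Tendsto (fun N : ℕ => contourInt 2 (fun z => contourInt 1 (fun z' =>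
        shiftKernel N (‖τ' / N‖ / 4 : ℝ) (τ / N) z * shiftKernel N (‖τ' / N‖ / 4 : ℝ) (τ' / N) z' *
          crossFactor (τ / N) (τ' / N) z z' *
          rayDeriv n (G N) (ringConfig m z (τ / N) z' (τ' / N))))) atTop
      (𝓝 (contourInt 2 (fun z => contourInt 1 (fun z' =>
        Complex.exp (τ / z) * Complex.exp (τ' / z') *
          iteratedDeriv n (fun θ => Complex.exp (θ * (τ * deriv P (θ * z))) *
            Complex.exp (θ * (τ' * deriv P (θ * z')))) 0)))) := by
  obtain ⟨B, hB0, hB⟩ := h.exists_bound_rayDeriv hτ hτ'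
  have hsmall : ∀ᶠ N : ℕ in atTop, ∀ σ : ℂ, ‖σ‖ ≤ 1 → ‖σ / N‖ ≤ 1 / 4 := by
    filter_upwards [eventually_ge_atTop 4] with N hN σ hσ
    have h4 : (4 : ℝ) ≤ N := by exact_mod_cast hN
    rw [norm_div, Complex.norm_natCast, div_le_iff₀ (by linarith)]
    linarith
  have hε0 : ∀ N : ℕ, 0 ≤ ‖τ' / N‖ / 4 := fun N => by positivity
  have hε : ∀ᶠ N : ℕ in atTop, ‖τ' / N‖ / 4 ≤ 1 / 4 := by
    filter_upwards [hsmall] with N hN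
    linarith [hN τ' hτ']
  have hcont : ∀ᶠ N : ℕ in atTop, Continuous fun p : ℝ × ℝ =>
      shiftKernel N (‖τ' / N‖ / 4 : ℝ) (τ / N) (circleMap 0 2 p.1) *
        shiftKernel N (‖τ' / N‖ / 4 : ℝ) (τ' / N) (circleMap 0 1 p.2) *
          crossFactor (τ / N) (τ' / N) (circleMap 0 2 p.1) (circleMap 0 1 p.2) *
          rayDeriv n (G N) (ringConfig m (circleMap 0 2 p.1) (τ / N) (circleMap 0 1 p.2)
            (τ' / N)) := by
    filter_upwards [hε, hsmall, h.analyticAt, eventually_ge_atTop 1] with N h1 h2 h3 hN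
    have c1 : Continuous fun p : ℝ × ℝ => circleMap 0 2 p.1 :=
      (continuous_circleMap 0 2).comp continuous_fst
    have c2 : Continuous fun p : ℝ × ℝ => circleMap 0 1 p.2 :=
      (continuous_circleMap 0 1).comp continuous_snd
    have n1 : ∀ α, ‖circleMap 0 2 α‖ = 2 := fun α => by simp
    have n2 : ∀ α, ‖circleMap 0 1 α‖ = 1 := fun α => by simp
    refine ((Continuous.mul ?_ ?_).mul ?_).mul ?_
    · unfold shiftKernel
      exact Continuous.div (by fun_prop) (by fun_prop) fun p =>
        shiftKernel_denom_ne_zero hN (hε0 N) h1 (by rw [n1]; norm_num)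
    · unfold shiftKernel
      exact Continuous.div (by fun_prop) (by fun_prop) fun p =>
        shiftKernel_denom_ne_zero hN (hε0 N) h1 (by rw [n2])
    · unfold crossFactor
      refine Continuous.div (by fun_prop) (by fun_prop) fun p => ?_
      have := crossFactor_denom_ge (h2 τ hτ) (h2 τ' hτ') (n1 p.1) (n2 p.2)
      intro h0
      rw [h0, norm_zero] at this
      norm_num at this
    · exact continuous_rayDeriv_ringConfig h3 n (τ / N) (τ' / N) c1 c2
  have hbound : ∀ᶠ N : ℕ in atTop, ∀ z z' : ℂ, ‖z‖ = 2 → ‖z'‖ = 1 →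
      ‖shiftKernel N (‖τ' / N‖ / 4 : ℝ) (τ / N) z * shiftKernel N (‖τ' / N‖ / 4 : ℝ) (τ' / N) z' *
          crossFactor (τ / N) (τ' / N) z z' *
          rayDeriv n (G N) (ringConfig m z (τ / N) z' (τ' / N))‖ ≤ 8 * 8 * 20 * B := by
    filter_upwards [hε, hsmall, hB, eventually_ge_atTop 1] with N h1 h2 h3 hN z z' hz hz'
    have k1 := norm_shiftKernel_le hN (hε0 N) h1 (z := z) (by rw [hz]; norm_num) hτ
    have k2 := norm_shiftKernel_le hN (hε0 N) h1 (z := z') (by rw [hz']) hτ'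
    have k3 := norm_crossFactor_le (h2 τ hτ) (h2 τ' hτ') hz hz'
    have k4 := h3 z z' hz hz'
    rw [norm_mul, norm_mul, norm_mul]
    gcongr
  refine tendsto_contourInt₂ two_pos.le one_pos.le hcont hbound fun z z' hz hz' => ?_
  have := ((tendsto_shiftKernel hε0 hε τ (z := z) (by rw [hz]; norm_num)).mul
    (tendsto_shiftKernel hε0 hε τ' (z := z') (by rw [hz']))).mul
    (tendsto_crossFactor τ τ' hz hz')
  simp only [mul_one] at this
  exact this.mul (h.tendsto_rayDeriv hm hz hz' hτ hτ')

end MomentLimit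

/-! ### Residue evaluation of the limit integral -/

section TaylorCoefficients

lemma iteratedDeriv_pow_zero (i j : ℕ) :
    iteratedDeriv i (fun θ : ℂ => θ ^ j) 0 = if i = j then (j ! : ℂ) else 0 := by
  rw [iteratedDeriv_fun_pow_zero]
  norm_num [Finset.prod_eq_zero_iff]

lemma iteratedDeriv_pow_mul {g : ℂ → ℂ} (hg : AnalyticAt ℂ g 0) (n j : ℕ) :
    iteratedDeriv n (fun θ => θ ^ j * g θ) 0 =
      (n.descFactorial j : ℂ) * iteratedDeriv (n - j) g 0 := by
  have hp : ContDiffAt ℂ n (fun θ : ℂ => θ ^ j) 0 := by fun_prop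
  rw [iteratedDeriv_fun_mul hp hg.contDiffAt]
  simp only [iteratedDeriv_pow_zero]
  rcases le_or_gt j n with h | h
  · rw [Finset.sum_eq_single j]
    · rw [if_pos rfl, Nat.descFactorial_eq_factorial_mul_choose]
      push_cast; ring
    · intro i _ hi; simp [hi]
    · intro h'; exact absurd (Finset.mem_range.mpr (by omega)) h'
  · rw [Nat.descFactorial_of_lt h, Finset.sum_eq_zero]
    · simp
    · intro i hi
      have := Finset.mem_range.mp hi
      rw [if_neg (by omega)]; ring

lemma exists_exp_eq_sum_add (n : ℕ) : ∃ g : ℂ → ℂ, AnalyticAt ℂ g 0 ∧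
    ∀ᶠ w in 𝓝 (0 : ℂ), Complex.exp w =
      ∑ j ∈ Finset.range (n + 1), w ^ j / (j ! : ℂ) + w ^ (n + 1) * g w := by
  obtain ⟨g, hg, h⟩ := AnalyticAt.exists_eventuallyEq_sum_add_pow_mul
    (f := Complex.exp) (by fun_prop) (n + 1)
  refine ⟨g, hg, ?_⟩
  filter_upwards [h] with w hw
  simpa [iteratedDeriv_eq_iterate, Complex.iter_deriv_exp] using hw

/-- The exponent vanishes at 0, so terms of the exponential series beyond the n-th do not contribute
to the n-th derivative. -/
lemma iteratedDeriv_exp_mul {h : ℂ → ℂ} (hh : AnalyticAt ℂ h 0) (n : ℕ) :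
    iteratedDeriv n (fun θ => Complex.exp (θ * h θ)) 0 =
      ∑ j ∈ Finset.range (n + 1), (n.choose j : ℂ) *
        iteratedDeriv (n - j) (fun θ => h θ ^ j) 0 := by
  obtain ⟨g, hg, hexp⟩ := exists_exp_eq_sum_add n
  have hid : AnalyticAt ℂ (fun θ : ℂ => θ * h θ) 0 := analyticAt_id.mul hh
  have ht : Tendsto (fun θ : ℂ => θ * h θ) (𝓝 0) (𝓝 0) := by
    simpa using hid.continuousAt.tendsto
  have hgc : AnalyticAt ℂ (fun θ : ℂ => h θ ^ (n + 1) * g (θ * h θ)) 0 := by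
    refine (hh.pow _).mul (AnalyticAt.fun_comp ?_ hid)
    simpa using hg
  have e : (fun θ => Complex.exp (θ * h θ)) =ᶠ[𝓝 0] fun θ =>
      (∑ j ∈ Finset.range (n + 1), ((j ! : ℂ))⁻¹ * (θ ^ j * h θ ^ j)) +
        θ ^ (n + 1) * (h θ ^ (n + 1) * g (θ * h θ)) := by
    filter_upwards [ht.eventually hexp] with θ hθ
    rw [hθ]
    simp only [mul_pow, div_eq_inv_mul, mul_assoc]
  have hj : ∀ j, AnalyticAt ℂ (fun θ : ℂ => θ ^ j * h θ ^ j) 0 := fun j =>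
    (analyticAt_id.pow j).mul (hh.pow j)
  rw [e.iteratedDeriv_eq, iteratedDeriv_fun_add, iteratedDeriv_pow_mul hgc,
    Nat.descFactorial_of_lt (Nat.lt_succ_self n), Nat.cast_zero, zero_mul, add_zero,
    iteratedDeriv_fun_sum]
  · refine Finset.sum_congr rfl fun j _ => ?_
    have h2 : (j ! : ℂ) ≠ 0 := by exact_mod_cast j.factorial_ne_zero
    rw [iteratedDeriv_const_mul_field, iteratedDeriv_pow_mul (g := fun θ => h θ ^ j) (hh.pow j),
      Nat.descFactorial_eq_factorial_mul_choose]
    push_cast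
    rw [← mul_assoc, inv_mul_cancel_left₀ h2]
  · exact fun j _ => (analyticAt_const.mul (hj j)).contDiffAt
  · exact (Finset.analyticAt_fun_sum _ fun j _ => analyticAt_const.mul (hj j)).contDiffAt
  · exact ((analyticAt_id.pow _).mul hgc).contDiffAt

/-- The free-moment functional of a function `F` analytic at `0`. -/
def freeMoment (F : ℂ → ℂ) (k : ℕ) : ℂ :=
  ∑ m ∈ Finset.range (k + 1), (k.choose m : ℂ) / ((m + 1)! : ℂ) *
    iteratedDeriv m (fun u => F u ^ (k - m)) 0

lemma iteratedDeriv_comp_mul_zero {f : ℂ → ℂ} (hf : AnalyticAt ℂ f 0) (n : ℕ) (z : ℂ) :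
    iteratedDeriv n (fun θ => f (θ * z)) 0 = z ^ n * iteratedDeriv n f 0 := by
  have := rayDeriv_smul hf n z 1
  simpa [rayDeriv] using this

lemma iteratedDeriv_exp_scaled {F : ℂ → ℂ} (hF : AnalyticAt ℂ F 0) (n : ℕ) (τ z : ℂ) :
    iteratedDeriv n (fun θ => Complex.exp (θ * (τ * F (θ * z)))) 0 =
      ∑ m ∈ Finset.range (n + 1), (n.choose m : ℂ) * τ ^ (n - m) *
        iteratedDeriv m (fun u => F u ^ (n - m)) 0 * z ^ m := by
  have h1 : AnalyticAt ℂ (fun θ : ℂ => τ * F (θ * z)) 0 := by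
    refine analyticAt_const.mul (AnalyticAt.fun_comp ?_ (by fun_prop))
    simpa using hF
  rw [iteratedDeriv_exp_mul h1, ← Finset.sum_range_reflect]
  refine Finset.sum_congr rfl fun m hm => ?_
  have hm' := Finset.mem_range.mp hm
  rw [show n + 1 - 1 - m = n - m by omega, show n - (n - m) = m by omega,
    Nat.choose_symm (by omega)]
  simp only [mul_pow]
  rw [iteratedDeriv_const_mul_field, iteratedDeriv_comp_mul_zero (f := fun u => F u ^ (n - m))
    (hF.pow _)]
  ring

end TaylorCoefficients

section Evaluate

lemma contourInt_zpow {R : ℝ} (hR : 0 < R) (k : ℤ) :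
    contourInt R (fun z => z ^ k) = if k = -1 then 1 else 0 := by
  split_ifs with h
  · have := circleIntegral.integral_sub_center_inv 0 hR.ne'
    simp only [sub_zero] at this
    rw [contourInt, h]
    simp only [zpow_neg_one]
    rw [this, inv_mul_cancel₀ Complex.two_pi_I_ne_zero]
  · have := circleIntegral.integral_sub_zpow_of_ne h 0 0 R
    simp only [sub_zero] at this
    rw [contourInt, this, mul_zero]

lemma circleIntegrable_of_continuousOn {R : ℝ} (hR : 0 < R) {f : ℂ → ℂ}
    (hf : ContinuousOn f {0}ᶜ) : CircleIntegrable f 0 R :=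
  ContinuousOn.circleIntegrable hR.le (hf.mono fun z hz => by
    rintro rfl
    simp at hz
    exact hR.ne hz)

/-- The residue at the essential singularity comes from the term (τ/z)^{m+1}/(m+1)!. It is obtained
from partial sums of the exponential series, which are uniformly bounded on the circle. -/
lemma contourInt_exp_div_mul_pow {R : ℝ} (hR : 0 < R) (τ : ℂ) (m : ℕ) :
    contourInt R (fun z => Complex.exp (τ / z) * z ^ m) = τ ^ (m + 1) / ((m + 1)! : ℂ) := by
  have h0 : ∀ z : ℂ, ‖z‖ = R → z ≠ 0 := by
    rintro z hz rfl
    simp at hz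
    exact hR.ne hz
  have hval : ∀ N : ℕ, m + 1 < N → contourInt R (fun z =>
      (∑ k ∈ Finset.range N, (τ / z) ^ k / (k ! : ℂ)) * z ^ m) = τ ^ (m + 1) / ((m + 1)! : ℂ) := by
    intro N hN
    rw [contourInt_congr hR.le (g := fun z => ∑ k ∈ Finset.range N,
      τ ^ k / (k ! : ℂ) * z ^ ((m : ℤ) - k))]
    · rw [contourInt_sum]
      · simp only [contourInt_const_mul, contourInt_zpow hR]
        rw [Finset.sum_eq_single (m + 1)]
        · rw [if_pos (by push_cast; ring), mul_one]
        · intro k _ hk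
          rw [if_neg (by omega), mul_zero]
        · intro h; exact absurd (Finset.mem_range.mpr hN) h
      · intro k _
        refine circleIntegrable_of_continuousOn hR ?_
        exact continuousOn_const.mul (continuousOn_id.zpow₀ _ fun z hz => Or.inl hz)
    · intro z hz
      rw [Finset.sum_mul]
      refine Finset.sum_congr rfl fun k _ => ?_
      rw [zpow_sub₀ (h0 z hz), div_pow]
      simp only [zpow_natCast]
      ring
  have hlim := tendsto_contourInt (R := R) (B := Real.exp (‖τ‖ / R) * R ^ m) hR.le
    (f := fun N z => (∑ k ∈ Finset.range N, (τ / z) ^ k / (k ! : ℂ)) * z ^ m)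
    (g := fun z => Complex.exp (τ / z) * z ^ m) ?_ ?_ ?_
  · refine tendsto_nhds_unique hlim (tendsto_const_nhds.congr' ?_)
    filter_upwards [eventually_gt_atTop (m + 1)] with N hN
    exact (hval N hN).symm
  · refine Eventually.of_forall fun N => ?_
    have hne : ∀ α, circleMap 0 R α ≠ 0 := fun α => circleMap_ne_center hR.ne'
    have hc := continuous_circleMap 0 R
    refine Continuous.mul (continuous_finsetSum _ fun k _ => ?_) (hc.pow m)
    exact (((continuous_const.div hc hne).pow k).div_const _)
  · refine Eventually.of_forall fun N z hz => ?_
    rw [norm_mul, norm_pow, hz]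
    refine mul_le_mul_of_nonneg_right ?_ (by positivity)
    refine (norm_sum_le _ _).trans ?_
    simp only [norm_div, norm_pow, hz, Complex.norm_natCast]
    exact Real.sum_le_exp_of_nonneg (by positivity) N
  · intro z _
    have h := NormedSpace.expSeries_div_hasSum_exp (𝔸 := ℂ) (τ / z)
    rw [← Complex.exp_eq_exp_ℂ] at h
    exact h.tendsto_sum_nat.mul_const _

/-- The Taylor expansion in z pairs the power z^m, carrying τ^{n-m}, with the residue
τ^{m+1}/(m+1)!. The powers of τ combine to τ^{n+1} for every m, and the residues are the source of
the factor 1/(m+1)! in the moments. -/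
lemma contourInt_exp_div_mul_iteratedDeriv {F : ℂ → ℂ} (hF : AnalyticAt ℂ F 0) {R : ℝ}
    (hR : 0 < R) (n : ℕ) (τ : ℂ) :
    contourInt R (fun z => Complex.exp (τ / z) *
        iteratedDeriv n (fun θ => Complex.exp (θ * (τ * F (θ * z)))) 0) =
      τ ^ (n + 1) * freeMoment F n := by
  simp only [iteratedDeriv_exp_scaled hF, Finset.mul_sum]
  rw [contourInt_sum, freeMoment, Finset.mul_sum]
  · refine Finset.sum_congr rfl fun m hm => ?_
    have hm' := Finset.mem_range.mp hm
    rw [show (fun z : ℂ => Complex.exp (τ / z) * ((n.choose m : ℂ) * τ ^ (n - m) *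
        iteratedDeriv m (fun u => F u ^ (n - m)) 0 * z ^ m)) = fun z : ℂ =>
        ((n.choose m : ℂ) * τ ^ (n - m) * iteratedDeriv m (fun u => F u ^ (n - m)) 0) *
          (Complex.exp (τ / z) * z ^ m) from by ext; ring, contourInt_const_mul,
      contourInt_exp_div_mul_pow hR, show τ ^ (n + 1) = τ ^ (n - m) * τ ^ (m + 1) by
        rw [← pow_add]; congr 1; omega]
    ring
  · intro m _
    refine circleIntegrable_of_continuousOn hR ?_
    refine ContinuousOn.mul ?_ (by fun_prop)
    exact Complex.continuous_exp.comp_continuousOn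
      (continuousOn_const.div continuousOn_id fun z hz => hz)

lemma analyticAt_exp_scaled {F : ℂ → ℂ} (hF : AnalyticAt ℂ F 0) (τ z : ℂ) :
    AnalyticAt ℂ (fun θ : ℂ => Complex.exp (θ * (τ * F (θ * z)))) 0 := by
  refine (analyticAt_id.mul (analyticAt_const.mul (AnalyticAt.fun_comp ?_ (by fun_prop)))).cexp'
  simpa using hF

theorem contourInt_contourInt_eval {F : ℂ → ℂ} (hF : AnalyticAt ℂ F 0) (n : ℕ) (τ τ' : ℂ) :
    contourInt 2 (fun z => contourInt 1 (fun z' =>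
        Complex.exp (τ / z) * Complex.exp (τ' / z') *
          iteratedDeriv n (fun θ => Complex.exp (θ * (τ * F (θ * z))) *
            Complex.exp (θ * (τ' * F (θ * z')))) 0)) =
      τ * τ' * ∑ a ∈ Finset.range (n + 1), (n.choose a : ℂ) * τ ^ a * τ' ^ (n - a) *
        (freeMoment F a * freeMoment F (n - a)) := by
  have hci : ∀ {R : ℝ}, 0 < R → ∀ (c τ : ℂ) (a : ℕ),
      CircleIntegrable (fun z => c * (Complex.exp (τ / z) *
        iteratedDeriv a (fun θ => Complex.exp (θ * (τ * F (θ * z)))) 0)) 0 R := by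
    intro R hR c τ a
    refine circleIntegrable_of_continuousOn hR ?_
    simp only [iteratedDeriv_exp_scaled hF]
    refine continuousOn_const.mul (ContinuousOn.mul ?_ (by fun_prop))
    exact Complex.continuous_exp.comp_continuousOn
      (continuousOn_const.div continuousOn_id fun z hz => hz)
  -- Leibniz's rule separates the variables z and z', so the integral becomes a sum of products.
  have e : ∀ z z' : ℂ, Complex.exp (τ / z) * Complex.exp (τ' / z') *
      iteratedDeriv n (fun θ => Complex.exp (θ * (τ * F (θ * z))) *
        Complex.exp (θ * (τ' * F (θ * z')))) 0 =
      ∑ a ∈ Finset.range (n + 1), ((n.choose a : ℂ) * (Complex.exp (τ / z) *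
        iteratedDeriv a (fun θ => Complex.exp (θ * (τ * F (θ * z)))) 0)) *
        (Complex.exp (τ' / z') *
          iteratedDeriv (n - a) (fun θ => Complex.exp (θ * (τ' * F (θ * z')))) 0) := by
    intro z z'
    rw [iteratedDeriv_fun_mul (analyticAt_exp_scaled hF τ z).contDiffAt
      (analyticAt_exp_scaled hF τ' z').contDiffAt, Finset.mul_sum]
    exact Finset.sum_congr rfl fun a _ => by ring
  have e2 : ∀ z : ℂ, contourInt 1 (fun z' =>
        Complex.exp (τ / z) * Complex.exp (τ' / z') *
          iteratedDeriv n (fun θ => Complex.exp (θ * (τ * F (θ * z))) *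
            Complex.exp (θ * (τ' * F (θ * z')))) 0) =
      ∑ a ∈ Finset.range (n + 1), ((n.choose a : ℂ) * (τ' ^ (n - a + 1) * freeMoment F (n - a))) *
        (Complex.exp (τ / z) *
        iteratedDeriv a (fun θ => Complex.exp (θ * (τ * F (θ * z)))) 0) := by
    intro z
    simp only [e]
    rw [contourInt_sum _ fun a _ => hci one_pos _ τ' (n - a)]
    simp only [contourInt_const_mul, contourInt_exp_div_mul_iteratedDeriv hF one_pos]
    exact Finset.sum_congr rfl fun a _ => by ring
  simp only [e2]
  rw [contourInt_sum _ fun a _ => hci two_pos _ τ a, Finset.mul_sum]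
  simp only [contourInt_const_mul, contourInt_exp_div_mul_iteratedDeriv hF two_pos]
  exact Finset.sum_congr rfl fun a _ => by ring

end Evaluate

/-! ### The logarithm of the generating function in exponential coordinates -/

section LogBranch

lemma prod_Ioi_eq_prod_ite {N : ℕ} (i : Fin N) (g : Fin N → ℂ) :
    ∏ j ∈ Finset.Ioi i, g j = ∏ j, if i < j then g j else 1 := by
  rw [← Finset.prod_filter, Finset.filter_lt_eq_Ioi]

/-- Pairs inside the first r coordinates give a fixed product, mixed pairs give the power N - r, and
pairs of zeros give 1. The power is of order N and survives in (1/N) log as the extra term of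
`logLimit`. -/
lemma expDivProd_padZero {r N : ℕ} (hrN : r ≤ N) (s : Fin r → ℂ) :
    expDivProd (padZero N s) = expDivProd s * (∏ i, expDiv (s i) 0) ^ (N - r) := by
  obtain ⟨K, rfl⟩ := Nat.exists_eq_add_of_le hrN
  have hl : ∀ i : Fin r, padZero (r + K) s (Fin.castAdd K i) = s i := fun i => by simp [padZero]
  have hr : ∀ i : Fin K, padZero (r + K) s (Fin.natAdd r i) = 0 := fun i => by simp [padZero]
  unfold expDivProd
  simp only [prod_Ioi_eq_prod_ite]
  rw [Fin.prod_univ_add]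
  have h2 : ∏ i : Fin K, ∏ j : Fin (r + K), (if Fin.natAdd r i < j then
      expDiv (padZero (r + K) s (Fin.natAdd r i)) (padZero (r + K) s j) else 1) = 1 := by
    refine Finset.prod_eq_one fun i _ => ?_
    rw [Fin.prod_univ_add]
    have a1 : ∀ j : Fin r, ¬ Fin.natAdd r i < Fin.castAdd K j := fun j => by
      rw [Fin.lt_def]; simp; omega
    simp [a1, hr, expDiv_self]
  have h1 : ∀ i : Fin r, ∏ j : Fin (r + K), (if Fin.castAdd K i < j then
      expDiv (padZero (r + K) s (Fin.castAdd K i)) (padZero (r + K) s j) else 1) =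
      (∏ j : Fin r, if i < j then expDiv (s i) (s j) else 1) * expDiv (s i) 0 ^ K := by
    intro i
    rw [Fin.prod_univ_add]
    have a1 : ∀ j : Fin K, Fin.castAdd K i < Fin.natAdd r j := fun j => by
      rw [Fin.lt_def]; simp; omega
    have a2 : ∀ j : Fin r, Fin.castAdd K i < Fin.castAdd K j ↔ i < j := fun j => by
      rw [Fin.lt_def, Fin.lt_def]; simp
    simp [a1, a2, hl, hr]
  rw [h2, mul_one, Finset.prod_congr rfl fun i _ => h1 i, Finset.prod_mul_distrib,
    Finset.prod_pow, Nat.add_sub_cancel_left]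

lemma padOne_exp {r N : ℕ} (s : Fin r → ℂ) :
    padOne N (fun i => Complex.exp (s i)) = fun i => Complex.exp (padZero N s i) := by
  ext i
  simp only [padOne, padZero]
  split_ifs <;> simp

/-- The limiting logarithm in exponential coordinates. -/
def logLimit (Psi : ℂ → ℂ) (s : ℂ) : ℂ := Psi (Complex.exp s) + Complex.log (expDiv s 0)

/-- The normalized logarithm of the generating function in exponential coordinates. -/
def logBranch {r : ℕ} (L : (Fin r → ℂ) → ℂ) (N : ℕ) (s : Fin r → ℂ) : ℂ :=
  (N : ℂ)⁻¹ * L (fun i => Complex.exp (s i)) +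
    (N : ℂ)⁻¹ * (∑ i, ∑ j ∈ Finset.Ioi i, Complex.log (expDiv (s i) (s j))) +
    (((N - r : ℕ) : ℂ) / N) * ∑ i, Complex.log (expDiv (s i) 0)

lemma exists_radius {r : ℕ} {Psi : ℂ → ℂ} (hPsi : AnalyticAt ℂ Psi 1) {U : Set (Fin r → ℂ)}
    (hU : IsOpen U) (hU1 : (1 : Fin r → ℂ) ∈ U) :
    ∃ ρ C : ℝ, 0 < ρ ∧ 0 ≤ C ∧ (∀ s ∈ Metric.ball (0 : Fin r → ℂ) ρ,
        (fun i => Complex.exp (s i)) ∈ U) ∧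
      (∀ a ∈ Metric.ball (0 : ℂ) ρ, ∀ b ∈ Metric.ball (0 : ℂ) ρ,
        expDiv a b ∈ Complex.slitPlane ∧ ‖Complex.log (expDiv a b)‖ ≤ 1) ∧
      (∀ s ∈ Metric.ball (0 : ℂ) ρ, AnalyticAt ℂ (logLimit Psi) s ∧ ‖logLimit Psi s‖ ≤ C) := by
  have h1 : ∀ᶠ s in 𝓝 (0 : Fin r → ℂ), (fun i => Complex.exp (s i)) ∈ U := by
    have hc : Continuous fun s : Fin r → ℂ => fun i => Complex.exp (s i) := by fun_prop
    refine hc.continuousAt.eventually_mem (hU.mem_nhds ?_)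
    convert hU1 using 1
    ext; simp
  have he : AnalyticAt ℂ (fun p : ℂ × ℂ => expDiv p.1 p.2) (0, 0) :=
    analyticAt_expDiv analyticAt_fst analyticAt_snd
  have he0 : expDiv (0 : ℂ) 0 = 1 := by simp [expDiv_self]
  have hlog : AnalyticAt ℂ (fun p : ℂ × ℂ => Complex.log (expDiv p.1 p.2)) (0, 0) :=
    he.clog (by simp [he0])
  have h2 : ∀ᶠ p in 𝓝 ((0, 0) : ℂ × ℂ),
      expDiv p.1 p.2 ∈ Complex.slitPlane ∧ ‖Complex.log (expDiv p.1 p.2)‖ ≤ 1 := by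
    refine Eventually.and ?_ ?_
    · exact he.continuousAt.eventually_mem (Complex.isOpen_slitPlane.mem_nhds (by simp [he0]))
    · have := hlog.continuousAt.norm.eventually_le_const (u := 1) (by simp [he0])
      exact this
  have hP : AnalyticAt ℂ (logLimit Psi) 0 := by
    unfold logLimit
    refine AnalyticAt.add (AnalyticAt.fun_comp (by simpa using hPsi) analyticAt_cexp) ?_
    exact (analyticAt_expDiv analyticAt_id analyticAt_const).clog (by simp [he0])
  have h3 : ∀ᶠ s in 𝓝 (0 : ℂ), AnalyticAt ℂ (logLimit Psi) s ∧
      ‖logLimit Psi s‖ ≤ ‖logLimit Psi 0‖ + 1 := by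
    refine hP.eventually_analyticAt.and ?_
    exact hP.continuousAt.norm.eventually_le_const (by linarith)
  obtain ⟨ρ1, hρ1, h1⟩ := Metric.eventually_nhds_iff_ball.mp h1
  obtain ⟨ρ2, hρ2, h2⟩ := Metric.eventually_nhds_iff_ball.mp h2
  obtain ⟨ρ3, hρ3, h3⟩ := Metric.eventually_nhds_iff_ball.mp h3
  refine ⟨min ρ1 (min ρ2 ρ3), ‖logLimit Psi 0‖ + 1, by positivity, by positivity, ?_, ?_, ?_⟩
  · exact fun s hs => h1 s (Metric.ball_subset_ball (min_le_left _ _) hs)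
  · intro a ha b hb
    refine h2 (a, b) ?_
    have : min ρ1 (min ρ2 ρ3) ≤ ρ2 := (min_le_right _ _).trans (min_le_left _ _)
    rw [Metric.mem_ball, Prod.dist_eq]
    exact max_lt (Metric.ball_subset_ball this ha) (Metric.ball_subset_ball this hb)
  · exact fun s hs => h3 s (Metric.ball_subset_ball
      ((min_le_right _ _).trans (min_le_right _ _)) hs)

variable {r : ℕ} {ρ C : ℝ} {Psi : ℂ → ℂ} {U : Set (Fin r → ℂ)}

lemma mem_ball_coord {s : Fin r → ℂ} (hs : s ∈ Metric.ball (0 : Fin r → ℂ) ρ) (i : Fin r) :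
    s i ∈ Metric.ball (0 : ℂ) ρ := by
  rw [mem_ball_zero_iff] at hs ⊢
  exact (norm_le_pi_norm s i).trans_lt hs

lemma analyticAt_logBranch {L : (Fin r → ℂ) → ℂ} (hL : AnalyticOnNhd ℂ L U) (hρ : 0 < ρ)
    (h1 : ∀ s ∈ Metric.ball (0 : Fin r → ℂ) ρ, (fun i => Complex.exp (s i)) ∈ U)
    (h2 : ∀ a ∈ Metric.ball (0 : ℂ) ρ, ∀ b ∈ Metric.ball (0 : ℂ) ρ,
        expDiv a b ∈ Complex.slitPlane ∧ ‖Complex.log (expDiv a b)‖ ≤ 1) (N : ℕ)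
    {s : Fin r → ℂ} (hs : s ∈ Metric.ball (0 : Fin r → ℂ) ρ) :
    AnalyticAt ℂ (logBranch L N) s := by
  have h0 : (0 : ℂ) ∈ Metric.ball (0 : ℂ) ρ := by simpa using hρ
  unfold logBranch
  refine ((analyticAt_const.mul ?_).add (analyticAt_const.mul ?_)).add (analyticAt_const.mul ?_)
  · exact AnalyticAt.fun_comp (hL _ (h1 s hs)) (analyticAt_exp_comp s)
  · refine Finset.analyticAt_fun_sum _ fun i _ => Finset.analyticAt_fun_sum _ fun j _ => ?_
    exact (analyticAt_expDiv (analyticAt_coord i s) (analyticAt_coord j s)).clog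
      (h2 _ (mem_ball_coord hs i) _ (mem_ball_coord hs j)).1
  · refine Finset.analyticAt_fun_sum _ fun i _ => ?_
    exact (analyticAt_expDiv (analyticAt_coord i s) analyticAt_const).clog
      (h2 _ (mem_ball_coord hs i) _ h0).1

lemma exp_logBranch {L : (Fin r → ℂ) → ℂ} (hρ : 0 < ρ)
    (h2 : ∀ a ∈ Metric.ball (0 : ℂ) ρ, ∀ b ∈ Metric.ball (0 : ℂ) ρ,
        expDiv a b ∈ Complex.slitPlane ∧ ‖Complex.log (expDiv a b)‖ ≤ 1) {N : ℕ} (hN : 1 ≤ N)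
    (hrN : r ≤ N) {rho : PMF (Signature N)} {s : Fin r → ℂ}
    (hs : s ∈ Metric.ball (0 : Fin r → ℂ) ρ)
    (hL : Complex.exp (L fun i => Complex.exp (s i)) =
      schurGen rho (padOne N fun i => Complex.exp (s i))) :
    Complex.exp (N * logBranch L N s) = besselGen rho (padZero N s) := by
  have h0 : (0 : ℂ) ∈ Metric.ball (0 : ℂ) ρ := by simpa using hρ
  have hN0 : (N : ℂ) ≠ 0 := by exact_mod_cast (by omega : N ≠ 0)
  have e : (N : ℂ) * logBranch L N s = L (fun i => Complex.exp (s i)) +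
      (∑ i, ∑ j ∈ Finset.Ioi i, Complex.log (expDiv (s i) (s j))) +
      ((N - r : ℕ) : ℂ) * ∑ i, Complex.log (expDiv (s i) 0) := by
    unfold logBranch
    field_simp
  have hne : ∀ a ∈ Metric.ball (0 : ℂ) ρ, ∀ b ∈ Metric.ball (0 : ℂ) ρ, expDiv a b ≠ 0 :=
    fun a ha b hb => Complex.slitPlane_ne_zero (h2 a ha b hb).1
  rw [e, Complex.exp_add, Complex.exp_add, hL, Complex.exp_nat_mul, Complex.exp_sum,
    Complex.exp_sum, besselGen, expDivProd_padZero hrN, padOne_exp, mul_assoc]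
  congr 2
  · refine Finset.prod_congr rfl fun i _ => ?_
    rw [Complex.exp_sum]
    exact Finset.prod_congr rfl fun j _ =>
      Complex.exp_log (hne _ (mem_ball_coord hs i) _ (mem_ball_coord hs j))
  · congr 1
    exact Finset.prod_congr rfl fun i _ => Complex.exp_log (hne _ (mem_ball_coord hs i) _ h0)

lemma tendstoUniformlyOn_logBranch {L : ℕ → (Fin r → ℂ) → ℂ} (hρ : 0 < ρ)
    (h1 : ∀ s ∈ Metric.ball (0 : Fin r → ℂ) ρ, (fun i => Complex.exp (s i)) ∈ U)
    (h2 : ∀ a ∈ Metric.ball (0 : ℂ) ρ, ∀ b ∈ Metric.ball (0 : ℂ) ρ,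
        expDiv a b ∈ Complex.slitPlane ∧ ‖Complex.log (expDiv a b)‖ ≤ 1)
    (hL : TendstoUniformlyOn (fun (N : ℕ) (u : Fin r → ℂ) => (N : ℂ)⁻¹ * L N u)
        (fun u => ∑ i, Psi (u i)) atTop U) :
    TendstoUniformlyOn (fun N => logBranch (L N) N) (fun s => ∑ i, logLimit Psi (s i)) atTop
      (Metric.ball 0 ρ) := by
  have h0 : (0 : ℂ) ∈ Metric.ball (0 : ℂ) ρ := by simpa using hρ
  rw [Metric.tendstoUniformlyOn_iff] at hL ⊢
  intro ε hε
  -- The first r² bounds the logarithms over pairs, the second the defect r/N in (N - r)/N = 1 -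
  -- r/N; each logarithm is at most 1 in norm.
  have hsmall : ∀ᶠ N : ℕ in atTop, ((r : ℝ) * r + r * r) / N < ε / 2 :=
    (tendsto_const_div_atTop_nhds_zero_nat _).eventually_lt_const (by positivity)
  filter_upwards [hL (ε / 2) (by positivity), hsmall, eventually_ge_atTop (max 1 r)]
    with N hN1 hN2 hN s hs
  have hN0 : (0 : ℝ) < N := by
    have : 1 ≤ N := (le_max_left _ _).trans hN
    exact_mod_cast this
  have hrN : r ≤ N := (le_max_right _ _).trans hN
  have a1 := hN1 _ (h1 s hs)
  have a2 : ‖∑ i, ∑ j ∈ Finset.Ioi i, Complex.log (expDiv (s i) (s j))‖ ≤ (r : ℝ) * r := by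
    refine (norm_sum_le_of_le _ (n := fun _ => (r : ℝ)) fun i _ => ?_).trans (by simp)
    refine (norm_sum_le_of_le _ (n := fun _ => (1 : ℝ)) fun j _ =>
      (h2 _ (mem_ball_coord hs i) _ (mem_ball_coord hs j)).2).trans ?_
    rw [Finset.sum_const, nsmul_eq_mul, mul_one]
    exact_mod_cast (Finset.card_le_univ _).trans (by simp)
  have a3 : ‖∑ i, Complex.log (expDiv (s i) 0)‖ ≤ r :=
    (norm_sum_le_of_le _ (n := fun _ => (1 : ℝ)) fun i _ =>
      (h2 _ (mem_ball_coord hs i) _ h0).2).trans (by simp)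
  have e : ∑ i, logLimit Psi (s i) - logBranch (L N) N s =
      (∑ i, Psi (Complex.exp (s i)) - (N : ℂ)⁻¹ * L N fun i => Complex.exp (s i)) -
        (N : ℂ)⁻¹ * (∑ i, ∑ j ∈ Finset.Ioi i, Complex.log (expDiv (s i) (s j))) +
        (N : ℂ)⁻¹ * (r * ∑ i, Complex.log (expDiv (s i) 0)) := by
    have hNc : (N : ℂ) ≠ 0 := by exact_mod_cast hN0.ne'
    simp only [logLimit, logBranch, Finset.sum_add_distrib, Nat.cast_sub hrN]
    field_simp
    ring
  rw [dist_eq_norm, e]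
  rw [dist_eq_norm] at a1
  have b2 : ‖(N : ℂ)⁻¹ * (∑ i, ∑ j ∈ Finset.Ioi i, Complex.log (expDiv (s i) (s j)))‖ ≤
      (N : ℝ)⁻¹ * (r * r) := by
    rw [norm_mul, norm_inv, Complex.norm_natCast]; gcongr
  have b3 : ‖(N : ℂ)⁻¹ * (r * ∑ i, Complex.log (expDiv (s i) 0))‖ ≤ (N : ℝ)⁻¹ * (r * r) := by
    rw [norm_mul, norm_inv, Complex.norm_natCast, norm_mul, Complex.norm_natCast]; gcongr
  rw [add_div, div_eq_inv_mul, ] at hN2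
  refine (norm_add_le _ _).trans_lt ?_
  have := norm_sub_le (∑ i, Psi (Complex.exp (s i)) - (N : ℂ)⁻¹ * L N fun i => Complex.exp (s i))
    ((N : ℂ)⁻¹ * (∑ i, ∑ j ∈ Finset.Ioi i, Complex.log (expDiv (s i) (s j))))
  linarith

end LogBranch

/-! ### Consequences of the hypothesis on the Schur generating function -/

section Hypotheses

variable {rho : (N : ℕ) → PMF (Signature N)} {Psi : ℂ → ℂ}

/-- The case r = 0 already gives this: the branch vanishes at the only point, so S = e^0. -/
lemma LogSchurGenTendsto.schurGen_one (h : LogSchurGenTendsto rho Psi) :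
    ∀ᶠ N in atTop, schurGen (rho N) 1 = 1 := by
  obtain ⟨U, -, hU1, L, hL, -⟩ := h 0
  filter_upwards [hL] with N hN
  have := hN.2.2 1 hU1
  rw [hN.2.1, Complex.exp_zero] at this
  rw [this]
  congr 1

/-- Total mass: the weights sum to 1, and so does S at 1. With 0/0 = 0, signatures whose character
vanishes at 1 drop out of S, so they carry no mass. No dimension formula is needed. -/
lemma schurChar_one_ne_zero_of_schurGen {N : ℕ} {p : PMF (Signature N)}
    (hV : ∃ V ∈ 𝓝 (1 : Fin N → ℂ), SummableUniformlyOn (schurTerm p) V)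
    (h : schurGen p 1 = 1) (l : Signature N) (hl : p l ≠ 0) : schurChar l 1 ≠ 0 := by
  obtain ⟨V, hV1, hV⟩ := hV
  have h1 : HasSum (fun l => schurTerm p l 1) 1 := by
    rw [← h]
    exact (hV.summable (mem_of_mem_nhds hV1)).hasSum
  have h2 : HasSum (fun l => (((p l).toReal : ℝ) : ℂ)) 1 := by
    have := ENNReal.hasSum_toReal (f := fun l => p l) (by rw [p.tsum_coe]; simp)
    rw [← ENNReal.tsum_toReal_eq p.apply_ne_top, p.tsum_coe, ENNReal.toReal_one] at this
    have := Complex.hasSum_ofReal.mpr this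
    rwa [Complex.ofReal_one] at this
  have h3 : HasSum (fun l => (if schurChar l 1 = 0 then (p l).toReal else 0 : ℝ)) 0 := by
    have := h2.sub h1
    rw [sub_self] at this
    refine Complex.hasSum_ofReal.mp ?_
    rw [Complex.ofReal_zero]
    refine (congrArg (fun f => HasSum f _) (funext fun l => ?_)).mp this
    by_cases hc : schurChar l 1 = 0
    · rw [if_pos hc, schurTerm, hc, zero_div, mul_zero, sub_zero]
    · rw [if_neg hc, schurTerm, div_self hc, mul_one, sub_self, Complex.ofReal_zero]
  intro hc
  have h4 := (hasSum_zero_iff_of_nonneg fun l => by split_ifs <;> simp).mp h3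
  have h5 := congrFun h4 l
  simp only [hc, if_true, Pi.zero_apply] at h5
  rw [ENNReal.toReal_eq_zero_iff] at h5
  exact h5.elim hl (p.apply_ne_top l)

theorem LogSchurGenTendsto.exists_additiveLimit (h : LogSchurGenTendsto rho Psi)
    (hPsi : AnalyticAt ℂ Psi 1)
    (h_conv : ∀ N : ℕ, ∃ V ∈ 𝓝 (1 : Fin N → ℂ), SummableUniformlyOn (schurTerm (rho N)) V)
    {m n : ℕ} (hn : n < m) :
    ∃ F ρ C, AdditiveLimit m n (fun N c => besselGen (rho N) (padZero N c)) F (logLimit Psi) ρ C := by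
  obtain ⟨U, hU, hU1, L, hL, hlim⟩ := h (m + m)
  obtain ⟨ρ, C, hρ, hC, h1, h2, h3⟩ := exists_radius hPsi hU hU1
  have hexp : ∀ᶠ N in atTop, (fun c : Fin (m + m) → ℂ => besselGen (rho N) (padZero N c)) =ᶠ[𝓝 0]
      fun s => Complex.exp ((N : ℂ) * logBranch (L N) N s) := by
    filter_upwards [hL, eventually_ge_atTop (max 1 (m + m))] with N hN hmN
    filter_upwards [Metric.ball_mem_nhds 0 hρ] with s hs
    exact (exp_logBranch hρ h2 ((le_max_left _ _).trans hmN) ((le_max_right _ _).trans hmN) hs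
      (hN.2.2 _ (h1 s hs))).symm
  have hzero : ∀ᶠ N in atTop, besselGen (rho N) (padZero N (0 : Fin (m + m) → ℂ)) = 1 := by
    filter_upwards [h.schurGen_one] with N hN
    have e : padZero N (0 : Fin (m + m) → ℂ) = 0 := by ext i; simp [padZero]
    have e1 : (fun i : Fin N => Complex.exp ((0 : Fin N → ℂ) i)) = 1 := by ext; simp
    rw [e, besselGen, e1, hN, expDivProd_zero, one_mul]
  refine ⟨fun N => logBranch (L N) N, ρ, C, hρ, ?_, hzero, ?_, ?_, hexp, ?_, ?_, ?_⟩
  · filter_upwards [hL, hexp] with N hN he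
    refine AnalyticAt.congr ?_ he.symm
    exact (analyticAt_const.mul (analyticAt_logBranch hN.1 hρ h1 h2 N (by simpa using hρ))).cexp'
  -- The undisplaced two-block configuration has the same power sums as 0 in degrees 1, ..., n,
  -- which is the flatness required.
  · filter_upwards [eventually_ge_atTop (m + m)] with N hN d hd hdn z z'
    rw [← rayDeriv_padZero, rayDeriv_besselGen_eq_of_psum_eq (h_conv N) (b := 0)]
    · have : (fun θ : ℂ => besselGen (rho N) (θ • (0 : Fin N → ℂ))) =
          fun _ => besselGen (rho N) 0 := by
        ext; simp
      rw [rayDeriv, this, iteratedDeriv_const, if_neg (by omega)]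
    · intro j hj hjd
      rw [sum_padZero_pow hN hj, sum_ringConfig_pow hj (by omega)]
      have hj0 : j ≠ 0 := by omega
      simp [hj0]
  · filter_upwards [hL] with N hN
    exact fun s hs => (analyticAt_logBranch hN.1 hρ h1 h2 N hs).differentiableAt.differentiableWithinAt
  · exact fun s hs => (h3 s hs).1.differentiableAt.differentiableWithinAt
  · exact fun s hs => (h3 s hs).2
  · exact tendstoUniformlyOn_logBranch hρ h1 h2 hlim

end Hypotheses

/-! ### Joint moments of the counting measures -/

section JointMoments

/-- The `k`-th moment of the uniform measure on the points `(λ_i + N - i) / N`. -/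
def countingMoment (k : ℕ) {N : ℕ} (l : Signature N) : ℝ :=
  (N : ℝ)⁻¹ * ∑ i, ((l.shifted i : ℝ) / N) ^ k

lemma countingMoment_zero {N : ℕ} (hN : N ≠ 0) (l : Signature N) : countingMoment 0 l = 1 := by
  have : (N : ℝ) ≠ 0 := by exact_mod_cast hN
  simp [countingMoment, this]

lemma sum_sum_pow_eq_countingMoment {N : ℕ} (l : Signature N) (n : ℕ) (τ : ℂ) :
    ((N : ℂ) ^ 2)⁻¹ * ∑ i, ∑ j, (τ / N * (l.shifted i : ℤ) + 1 / N * (l.shifted j : ℤ)) ^ n =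
      ∑ a ∈ Finset.range (n + 1), (n.choose a : ℂ) * τ ^ a *
        ((countingMoment a l * countingMoment (n - a) l : ℝ) : ℂ) := by
  have e : ∀ i j, (τ / N * (l.shifted i : ℤ) + 1 / N * (l.shifted j : ℤ) : ℂ) ^ n =
      ∑ a ∈ Finset.range (n + 1), (n.choose a : ℂ) * τ ^ a *
        ((((l.shifted i : ℝ) / N) ^ a * ((l.shifted j : ℝ) / N) ^ (n - a) : ℝ) : ℂ) := by
    intro i j
    rw [add_pow]
    refine Finset.sum_congr rfl fun a _ => ?_
    push_cast
    rw [show τ / N * (l.shifted i : ℂ) = τ * ((l.shifted i : ℂ) / N) by ring, mul_pow,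
      show (1 : ℂ) / N * (l.shifted j : ℂ) = (l.shifted j : ℂ) / N by ring]
    ring
  simp only [e]
  rw [Finset.sum_congr rfl fun i _ => Finset.sum_comm, Finset.sum_comm, Finset.mul_sum]
  refine Finset.sum_congr rfl fun a _ => ?_
  simp only [countingMoment, ← Finset.mul_sum, ← Complex.ofReal_sum]
  rw [← Finset.sum_mul]
  push_cast
  ring

/-- Orthogonality of the characters of the cyclic group of order M; it extracts single coefficients
of polynomials in τ of degree below M. -/
lemma sum_roots_filter {M : ℕ} (hM : M ≠ 0) {a k : ℕ} (ha : a < M) (hk : k < M) :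
    ∑ i ∈ Finset.range M, ((unityRoot M ^ i) ^ k)⁻¹ * (unityRoot M ^ i) ^ a =
      if a = k then (M : ℂ) else 0 := by
  have hp := unityRoot_isPrimitiveRoot hM
  have h0 : unityRoot M ≠ 0 := hp.ne_zero hM
  have e : ∀ i, ((unityRoot M ^ i) ^ k)⁻¹ * (unityRoot M ^ i) ^ a =
      ((unityRoot M ^ k)⁻¹ * unityRoot M ^ a) ^ i := fun i => by
    rw [mul_pow, inv_pow, ← pow_mul, ← pow_mul, ← pow_mul, ← pow_mul, mul_comm k i, mul_comm a i]
  simp only [e]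
  split_ifs with h
  · rw [h, inv_mul_cancel₀ (pow_ne_zero _ h0)]
    simp
  · have hne : (unityRoot M ^ k)⁻¹ * unityRoot M ^ a ≠ 1 := by
      intro h1
      rw [inv_mul_eq_one₀ (pow_ne_zero _ h0)] at h1
      exact h (hp.pow_inj ha hk h1.symm)
    rw [geom_sum_eq hne, mul_pow, inv_pow, ← pow_mul, ← pow_mul, mul_comm k, mul_comm a, pow_mul,
      pow_mul, hp.pow_eq_one]
    simp

variable {rho : (N : ℕ) → PMF (Signature N)} {Psi : ℂ → ℂ}

lemma analyticAt_logLimit (hPsi : AnalyticAt ℂ Psi 1) : AnalyticAt ℂ (logLimit Psi) 0 := by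
  unfold logLimit
  refine AnalyticAt.add (AnalyticAt.fun_comp (by simpa using hPsi) analyticAt_cexp) ?_
  exact (analyticAt_expDiv analyticAt_id analyticAt_const).clog (by simp [expDiv_self])

/-- The limit moments of the counting measures. -/
def countingLimit (Psi : ℂ → ℂ) (k : ℕ) : ℂ := freeMoment (deriv (logLimit Psi)) k

/-- The contour formula with t = τ/N and t' = 1/N. The binomial expansion turns it into a generating
polynomial in τ of the products of counting moments of total degree n. -/
lemma LogSchurGenTendsto.tendsto_mixedMoment (h : LogSchurGenTendsto rho Psi)
    (hPsi : AnalyticAt ℂ Psi 1)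
    (h_conv : ∀ N : ℕ, ∃ V ∈ 𝓝 (1 : Fin N → ℂ), SummableUniformlyOn (schurTerm (rho N)) V)
    (n : ℕ) {τ : ℂ} (hτ : ‖τ‖ = 1) :
    ∃ v : ℕ → ℂ, (∀ᶠ N in atTop, HasSum (fun l => ((rho N l).toReal : ℂ) *
        ∑ a ∈ Finset.range (n + 1), (n.choose a : ℂ) * τ ^ a *
          ((countingMoment a l * countingMoment (n - a) l : ℝ) : ℂ)) (v N)) ∧
      Tendsto v atTop (𝓝 (∑ a ∈ Finset.range (n + 1), (n.choose a : ℂ) * τ ^ a *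
        (countingLimit Psi a * countingLimit Psi (n - a)))) := by
  have hτ0 : τ ≠ 0 := by rintro rfl; simp at hτ
  obtain ⟨F, ρ, C, hF⟩ := h.exists_additiveLimit hPsi h_conv (Nat.lt_succ_self n)
  have hlim := hF.tendsto_contourInt (Nat.succ_pos n) (τ := τ) (τ' := 1) hτ.le (by simp)
  rw [contourInt_contourInt_eval (analyticAt_logLimit hPsi).deriv] at hlim
  have hlim2 := hlim.const_mul τ⁻¹
  simp only [mul_one, one_pow] at hlim2
  rw [inv_mul_cancel_left₀ hτ0] at hlim2
  refine ⟨_, ?_, hlim2⟩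
  filter_upwards [eventually_ge_atTop ((n + 1) + (n + 1)), eventually_ge_atTop 3,
    h.schurGen_one, hF.analyticAt] with N hN hN3 h1 hG
  have hN3' : (3 : ℝ) ≤ N := by exact_mod_cast hN3
  have hNc : (N : ℂ) ≠ 0 := by exact_mod_cast (by omega : N ≠ 0)
  have hsmall : ∀ σ : ℂ, ‖σ‖ = 1 → ‖σ / N‖ < 1 / 2 := by
    intro σ hσ
    rw [norm_div, hσ, Complex.norm_natCast, div_lt_div_iff₀ (by linarith) (by norm_num)]
    linarith
  have key := (hasSum_moments hN (Nat.lt_succ_self n) (h_conv N)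
    (schurChar_one_ne_zero_of_schurGen (h_conv N) h1) hG (hsmall τ hτ) (hsmall 1 (by simp))
    (div_ne_zero hτ0 hNc) (div_ne_zero one_ne_zero hNc)).mul_left ((N : ℂ) ^ 2)⁻¹
  -- The normalization 1/N² of the two counting measures cancels (t t')⁻¹ up to τ⁻¹, which removes
  -- the factor τ of the limit integral.
  have e1 : ((N : ℂ) ^ 2)⁻¹ * (τ / N * (1 / N))⁻¹ = τ⁻¹ := by field_simp
  rw [← mul_assoc, e1] at key
  refine (congrArg (fun f => HasSum f _) (funext fun l => ?_)).mp key
  rw [mul_left_comm, sum_sum_pow_eq_countingMoment]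

/-- Averaging the mixed moments over τ in the roots of unity of order k + j + 1, weighted by τ^{-k},
isolates one product of moments, both for each N and in the limit. -/
theorem LogSchurGenTendsto.tendsto_expect_mul (h : LogSchurGenTendsto rho Psi)
    (hPsi : AnalyticAt ℂ Psi 1)
    (h_conv : ∀ N : ℕ, ∃ V ∈ 𝓝 (1 : Fin N → ℂ), SummableUniformlyOn (schurTerm (rho N)) V)
    (k j : ℕ) :
    ∃ v : ℕ → ℝ, (∀ᶠ N in atTop, HasSum (fun l => (rho N l).toReal *
        (countingMoment k l * countingMoment j l)) (v N)) ∧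
      Tendsto (fun N => (v N : ℂ)) atTop (𝓝 (countingLimit Psi k * countingLimit Psi j)) := by
  obtain ⟨n, hn⟩ : ∃ n, n = k + j := ⟨_, rfl⟩
  have hM : n + 1 ≠ 0 := by omega
  have hζ : ∀ i : ℕ, ‖unityRoot (n + 1) ^ i‖ = 1 := fun i => by
    rw [norm_pow, norm_unityRoot hM, one_pow]
  choose v hv hvl using fun i : ℕ => h.tendsto_mixedMoment hPsi h_conv n (hζ i)
  have hc : (n.choose k : ℂ) ≠ 0 := by
    exact_mod_cast (Nat.choose_pos (by omega : k ≤ n)).ne'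
  have hn1 : ((n + 1 : ℕ) : ℂ) ≠ 0 := by exact_mod_cast hM
  have hfilter : ∀ c : ℕ → ℂ, (((n + 1 : ℕ) : ℂ) * n.choose k)⁻¹ *
      ∑ i ∈ Finset.range (n + 1), ((unityRoot (n + 1) ^ i) ^ k)⁻¹ *
        ∑ a ∈ Finset.range (n + 1), (n.choose a : ℂ) * (unityRoot (n + 1) ^ i) ^ a * c a = c k := by
    intro c
    have : ∑ i ∈ Finset.range (n + 1), ((unityRoot (n + 1) ^ i) ^ k)⁻¹ *
        ∑ a ∈ Finset.range (n + 1), (n.choose a : ℂ) * (unityRoot (n + 1) ^ i) ^ a * c a =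
        ((n + 1 : ℕ) : ℂ) * n.choose k * c k := by
      simp only [Finset.mul_sum]
      rw [Finset.sum_comm, Finset.sum_eq_single k]
      · have := sum_roots_filter hM (a := k) (k := k) (by omega) (by omega)
        rw [if_pos rfl] at this
        rw [← this, Finset.sum_mul, Finset.sum_mul]
        exact Finset.sum_congr rfl fun i _ => by ring
      · intro a ha hak
        have := sum_roots_filter hM (a := a) (k := k) (Finset.mem_range.mp ha) (by omega)
        rw [if_neg hak] at this
        calc _ = (∑ i ∈ Finset.range (n + 1), ((unityRoot (n + 1) ^ i) ^ k)⁻¹ *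
              (unityRoot (n + 1) ^ i) ^ a) * (n.choose a * c a) := by
              rw [Finset.sum_mul]; exact Finset.sum_congr rfl fun i _ => by ring
          _ = 0 := by rw [this, zero_mul]
      · intro h; exact absurd (Finset.mem_range.mpr (by omega)) h
    rw [this, inv_mul_cancel_left₀ (mul_ne_zero hn1 hc)]
  have hlim : Tendsto (fun N => (((n + 1 : ℕ) : ℂ) * n.choose k)⁻¹ *
      ∑ i ∈ Finset.range (n + 1), ((unityRoot (n + 1) ^ i) ^ k)⁻¹ * v i N) atTop
      (𝓝 (countingLimit Psi k * countingLimit Psi j)) := by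
    have h1 := (tendsto_finsetSum (Finset.range (n + 1)) fun i _ =>
      (hvl i).const_mul ((unityRoot (n + 1) ^ i) ^ k)⁻¹).const_mul
        (((n + 1 : ℕ) : ℂ) * n.choose k)⁻¹
    rw [hfilter (fun a => countingLimit Psi a * countingLimit Psi (n - a))] at h1
    simpa [hn] using h1
  have hsum : ∀ᶠ N in atTop, HasSum (fun l => (((rho N l).toReal *
      (countingMoment k l * countingMoment j l) : ℝ) : ℂ)) ((((n + 1 : ℕ) : ℂ) * n.choose k)⁻¹ *
      ∑ i ∈ Finset.range (n + 1), ((unityRoot (n + 1) ^ i) ^ k)⁻¹ * v i N) := by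
    have hall : ∀ᶠ N in atTop, ∀ i ∈ Finset.range (n + 1), HasSum (fun l =>
        ((rho N l).toReal : ℂ) * ∑ a ∈ Finset.range (n + 1), (n.choose a : ℂ) *
          (unityRoot (n + 1) ^ i) ^ a *
          ((countingMoment a l * countingMoment (n - a) l : ℝ) : ℂ)) (v i N) :=
      (Finset.eventually_all _).mpr fun i _ => hv i
    filter_upwards [hall] with N hN
    have h1 := (hasSum_sum fun i hi =>
      (hN i hi).mul_left ((unityRoot (n + 1) ^ i) ^ k)⁻¹).mul_left
        (((n + 1 : ℕ) : ℂ) * n.choose k)⁻¹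
    refine (congrArg (fun f => HasSum f _) (funext fun l => ?_)).mp h1
    have h2 := hfilter fun a => ((countingMoment a l * countingMoment (n - a) l : ℝ) : ℂ)
    rw [show n - k = j by omega] at h2
    rw [Complex.ofReal_mul, ← h2]
    simp only [Finset.mul_sum]
    exact Finset.sum_congr rfl fun i _ => Finset.sum_congr rfl fun a _ => by ring
  refine ⟨fun N => ((((n + 1 : ℕ) : ℂ) * n.choose k)⁻¹ *
      ∑ i ∈ Finset.range (n + 1), ((unityRoot (n + 1) ^ i) ^ k)⁻¹ * v i N).re, ?_, ?_⟩
  · filter_upwards [hsum] with N hN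
    simpa using Complex.hasSum_re hN
  · refine hlim.congr' ?_
    filter_upwards [hsum] with N hN
    have h1 := Complex.hasSum_re hN
    simp only [Complex.ofReal_re] at h1
    exact hN.unique (Complex.hasSum_ofReal.mpr h1)

end JointMoments

/-! ### Convergence in probability of the counting moments -/

section InProbability

/-- Convergence in probability of statistics of signatures to a constant. -/
def TendstoInProb (rho : (N : ℕ) → PMF (Signature N)) (X : (N : ℕ) → Signature N → ℝ) (c : ℝ) :
    Prop :=
  ∀ ε : ℝ, 0 < ε → Tendsto (fun N => (rho N).toMeasure {l | ε ≤ |X N l - c|}) atTop (𝓝 0)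

variable {rho : (N : ℕ) → PMF (Signature N)} {X Y : (N : ℕ) → Signature N → ℝ} {a b : ℝ}

lemma TendstoInProb.congr' (h : TendstoInProb rho X a)
    (hXY : ∀ᶠ N in atTop, ∀ l, X N l = Y N l) : TendstoInProb rho Y a := by
  intro ε hε
  refine (h ε hε).congr' ?_
  filter_upwards [hXY] with N hN
  simp only [hN]

lemma tendstoInProb_of_tendsto {x : ℕ → ℝ} (h : Tendsto x atTop (𝓝 a)) :
    TendstoInProb rho (fun N _ => x N) a := by
  intro ε hε
  refine tendsto_const_nhds.congr' ?_
  filter_upwards [Metric.tendsto_nhds.mp h ε hε] with N hN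
  rw [Real.dist_eq] at hN
  simp [not_le.mpr hN]

lemma tendsto_zero_of_subset {A B C : (N : ℕ) → Set (Signature N)}
    (hA : Tendsto (fun N => (rho N).toMeasure (A N)) atTop (𝓝 0))
    (hB : Tendsto (fun N => (rho N).toMeasure (B N)) atTop (𝓝 0))
    (h : ∀ N, C N ⊆ A N ∪ B N) : Tendsto (fun N => (rho N).toMeasure (C N)) atTop (𝓝 0) := by
  have h2 := hA.add hB
  rw [add_zero] at h2
  exact tendsto_of_tendsto_of_tendsto_of_le_of_le tendsto_const_nhds h2 (fun _ => zero_le)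
    fun N => (measure_mono (h N)).trans (measure_union_le _ _)

lemma TendstoInProb.add (hX : TendstoInProb rho X a) (hY : TendstoInProb rho Y b) :
    TendstoInProb rho (fun N l => X N l + Y N l) (a + b) := by
  intro ε hε
  refine tendsto_zero_of_subset (hX (ε / 2) (by positivity)) (hY (ε / 2) (by positivity))
    fun N l hl => ?_
  by_contra hc
  simp only [Set.mem_union, Set.mem_ofPred_eq, not_or, not_le] at hc hl
  have : |X N l + Y N l - (a + b)| ≤ |X N l - a| + |Y N l - b| := by
    rw [add_sub_add_comm]; exact abs_add_le _ _
  linarith [hc.1, hc.2]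

lemma TendstoInProb.mul (hX : TendstoInProb rho X a) (hY : TendstoInProb rho Y b) :
    TendstoInProb rho (fun N l => X N l * Y N l) (a * b) := by
  intro ε hε
  have hD : 0 < 1 + |a| + |b| := by positivity
  have hδ : 0 < min 1 (ε / (1 + |a| + |b|)) := by positivity
  refine tendsto_zero_of_subset (hX _ hδ) (hY _ hδ) fun N l hl => ?_
  by_contra hc
  simp only [Set.mem_union, Set.mem_ofPred_eq, not_or, not_le] at hc hl
  obtain ⟨hx, hy⟩ := hc
  have hx1 := hx.trans_le (min_le_left _ _)
  -- For a deviation δ at most 1 in both factors, the product deviates by less than δ(1 + |a| +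
  -- |b|), hence the choice of the minimum.
  have hx2 := hx.trans_le (min_le_right _ _)
  have hy2 := hy.trans_le (min_le_right _ _)
  rw [lt_div_iff₀ hD] at hx2 hy2
  have e : X N l * Y N l - a * b = (X N l - a) * (Y N l - b) + a * (Y N l - b) +
      b * (X N l - a) := by ring
  have h1 : |X N l * Y N l - a * b| ≤ |X N l - a| * |Y N l - b| + |a| * |Y N l - b| +
      |b| * |X N l - a| := by
    rw [e, ← abs_mul, ← abs_mul, ← abs_mul]
    exact (abs_add_le _ _).trans (by gcongr; exact abs_add_le _ _)
  have hδx := hx.le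
  rcases le_total |X N l - a| |Y N l - b| with h | h
  · nlinarith [abs_nonneg a, abs_nonneg b, abs_nonneg (X N l - a), abs_nonneg (Y N l - b)]
  · have hy1 := hy.trans_le (min_le_left _ _)
    nlinarith [abs_nonneg a, abs_nonneg b, abs_nonneg (X N l - a), abs_nonneg (Y N l - b)]

lemma TendstoInProb.const_mul (c : ℝ) (hX : TendstoInProb rho X a) :
    TendstoInProb rho (fun N l => c * X N l) (c * a) :=
  (tendstoInProb_of_tendsto (x := fun _ => c) tendsto_const_nhds).mul hX

lemma TendstoInProb.sum {ι : Type*} (s : Finset ι) {X : ι → (N : ℕ) → Signature N → ℝ}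
    {a : ι → ℝ} (h : ∀ i ∈ s, TendstoInProb rho (X i) (a i)) :
    TendstoInProb rho (fun N l => ∑ i ∈ s, X i N l) (∑ i ∈ s, a i) := by
  classical
  induction s using Finset.induction_on with
  | empty => simpa using tendstoInProb_of_tendsto (x := fun _ => 0) tendsto_const_nhds
  | insert i s hi ih =>
    simp only [Finset.sum_insert hi]
    exact (h i (Finset.mem_insert_self _ _)).add
      (ih fun j hj => h j (Finset.mem_insert_of_mem hj))

/-- Chebyshev's inequality. -/
lemma toMeasure_le_of_hasSum {N : ℕ} (p : PMF (Signature N)) {X : Signature N → ℝ} {c s ε : ℝ}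
    (hε : 0 < ε) (h : HasSum (fun l => (p l).toReal * (X l - c) ^ 2) s) :
    p.toMeasure {l | ε ≤ |X l - c|} ≤ ENNReal.ofReal (s / ε ^ 2) := by
  rw [PMF.toMeasure_apply _ (Set.to_countable _).measurableSet]
  have h2 := h.div_const (ε ^ 2)
  rw [← h2.tsum_eq, ENNReal.ofReal_tsum_of_nonneg (fun l => by positivity) h2.summable]
  refine ENNReal.tsum_le_tsum fun l => ?_
  by_cases hl : l ∈ {l | ε ≤ |X l - c|}
  · rw [Set.indicator_of_mem hl]
    conv_lhs => rw [← ENNReal.ofReal_toReal (p.apply_ne_top l)]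
    refine ENNReal.ofReal_le_ofReal ?_
    rw [mul_div_assoc]
    refine le_mul_of_one_le_right ENNReal.toReal_nonneg ?_
    rw [one_le_div (by positivity), ← sq_abs (X l - c)]
    rw [Set.mem_ofPred_eq] at hl
    gcongr
  · rw [Set.indicator_of_notMem hl]; exact zero_le

variable {Psi : ℂ → ℂ}

/-- The joint moments with j = 0 and j = k give the first and second moments of the k-th counting
moment, because the zeroth counting moment is 1. Their limits are c and c², so the second moment
about c tends to 0. -/
theorem LogSchurGenTendsto.exists_tendstoInProb (h : LogSchurGenTendsto rho Psi)
    (hPsi : AnalyticAt ℂ Psi 1)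
    (h_conv : ∀ N : ℕ, ∃ V ∈ 𝓝 (1 : Fin N → ℂ), SummableUniformlyOn (schurTerm (rho N)) V)
    (k : ℕ) :
    ∃ c : ℝ, (c : ℂ) = countingLimit Psi k ∧
      TendstoInProb rho (fun _ l => countingMoment k l) c := by
  have hM0 : countingLimit Psi 0 = 1 := by simp [countingLimit, freeMoment]
  obtain ⟨v, hv, hvl⟩ := h.tendsto_expect_mul hPsi h_conv k 0
  obtain ⟨w, hw, hwl⟩ := h.tendsto_expect_mul hPsi h_conv k k
  rw [hM0, mul_one] at hvl
  have hre : Tendsto v atTop (𝓝 (countingLimit Psi k).re) := by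
    simpa [Function.comp_def] using (Complex.continuous_re.tendsto _).comp hvl
  -- A limit of real numbers is real.
  have hc : (((countingLimit Psi k).re : ℝ) : ℂ) = countingLimit Psi k :=
    tendsto_nhds_unique ((Complex.continuous_ofReal.tendsto _).comp hre) hvl
  refine ⟨(countingLimit Psi k).re, hc, fun ε hε => ?_⟩
  set c := (countingLimit Psi k).re
  rw [← hc] at hwl
  have hwr : Tendsto w atTop (𝓝 (c * c)) := by
    have := (Complex.continuous_re.tendsto _).comp hwl
    simpa [Function.comp_def] using this
  have hlim : Tendsto (fun N => (w N - 2 * c * v N + c ^ 2) / ε ^ 2) atTop (𝓝 0) := by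
    have := ((hwr.sub (hre.const_mul (2 * c))).add_const (c ^ 2)).div_const (ε ^ 2)
    convert this using 2
    ring
  have hlim2 : Tendsto (fun N => ENNReal.ofReal ((w N - 2 * c * v N + c ^ 2) / ε ^ 2)) atTop
      (𝓝 0) := by
    simpa [Function.comp_def] using (ENNReal.continuous_ofReal.tendsto _).comp hlim
  refine tendsto_of_tendsto_of_tendsto_of_le_of_le' tendsto_const_nhds hlim2
    (Eventually.of_forall fun _ => zero_le) ?_
  filter_upwards [hv, hw, eventually_ne_atTop 0] with N h1 h2 hN
  refine toMeasure_le_of_hasSum (rho N) hε ?_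
  have h3 : HasSum (fun l => ((rho N) l).toReal) 1 := by
    have := ENNReal.hasSum_toReal (f := fun l => rho N l) (by rw [(rho N).tsum_coe]; simp)
    rwa [← ENNReal.tsum_toReal_eq (rho N).apply_ne_top, (rho N).tsum_coe,
      ENNReal.toReal_one] at this
  have h4 := (h2.sub (h1.mul_left (2 * c))).add (h3.mul_left (c ^ 2))
  rw [mul_one] at h4
  refine (congrArg (fun f => HasSum f _) (funext fun l => ?_)).mp h4
  rw [countingMoment_zero hN]
  ring

end InProbability

/-! ### Lagrange inversion -/

section Lagrange

lemma contourInt_add {R : ℝ} {f g : ℂ → ℂ} (hf : CircleIntegrable f 0 R)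
    (hg : CircleIntegrable g 0 R) :
    contourInt R (fun z => f z + g z) = contourInt R f + contourInt R g := by
  simp only [contourInt]
  rw [circleIntegral.integral_add hf hg, mul_add]

/-- Contour integrals of `φ ^ k φ'` for a function `φ = z / W` with a simple zero. -/
lemma contourInt_zpow_mul_deriv {W : ℂ → ℂ} {R : ℝ} (hR : 0 < R) {V : Set ℂ} (hV : IsOpen V)
    (hRV : Metric.closedBall 0 R ⊆ V) (hW : DifferentiableOn ℂ W V) (hW0 : ∀ z ∈ V, W z ≠ 0)
    (k : ℤ) :
    contourInt R (fun z => (z / W z) ^ k * deriv (fun z => z / W z) z) =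
      if k = -1 then 1 else 0 := by
  have hd : ∀ z ∈ V, HasDerivAt (fun z => z / W z) ((W z - z * deriv W z) / W z ^ 2) z := by
    intro z hz
    have h1 := (hasDerivAt_id' z).fun_div (hW.differentiableAt (hV.mem_nhds hz)).hasDerivAt
      (hW0 z hz)
    rwa [one_mul] at h1
  have hV' : ∀ z, ‖z‖ = R → z ∈ V ∧ z ≠ 0 := by
    intro z hz
    refine ⟨hRV (by simp [hz]), ?_⟩
    rintro rfl
    simp at hz
    exact hR.ne hz
  split_ifs with hk
  -- Exponent -1: the logarithmic derivative of z/W is 1/z - W'/W, with W'/W holomorphic.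
  · have hW' : DifferentiableOn ℂ (fun z => -deriv W z / W z) V :=
      (hW.deriv hV).neg.div hW hW0
    rw [contourInt_congr hR.le (g := fun z => z⁻¹ + -deriv W z / W z), contourInt_add,
      contourInt_of_differentiable hR.le (hW'.mono hRV), add_zero]
    · simpa using contourInt_zpow hR (-1)
    · exact circleIntegrable_of_continuousOn hR (continuousOn_inv₀.mono fun z hz => hz)
    · exact ContinuousOn.circleIntegrable hR.le
        (hW'.continuousOn.mono (Metric.sphere_subset_closedBall.trans hRV))
    · intro z hz
      obtain ⟨hzV, hz0⟩ := hV' z hz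
      have := hW0 z hzV
      rw [hk, zpow_neg_one, (hd z hzV).deriv]
      field_simp
      ring
  -- For the other exponents φ^{k+1}/(k+1) is a single-valued primitive on the circle.
  · have hk1 : ((k + 1 : ℤ) : ℂ) ≠ 0 := by
      exact_mod_cast fun h => hk (by omega)
    rw [contourInt, circleIntegral.integral_eq_zero_of_hasDerivWithinAt hR.le
      (f := fun z => ((k + 1 : ℤ) : ℂ)⁻¹ * (z / W z) ^ (k + 1)), mul_zero]
    intro z hz
    obtain ⟨hzV, hz0⟩ := hV' z (by simpa using hz)
    have hφ0 : z / W z ≠ 0 := div_ne_zero hz0 (hW0 z hzV)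
    have h1 := ((hasDerivAt_zpow (k + 1) (z / W z) (Or.inl hφ0)).comp z (hd z hzV)).const_mul
      (((k + 1 : ℤ) : ℂ)⁻¹)
    rw [mul_assoc, inv_mul_cancel_left₀ hk1, add_sub_cancel_right, ← (hd z hzV).deriv] at h1
    exact h1.hasDerivWithinAt

/-- The function `z / (1 + z F z) = 1 / (1 / z + F z)`. -/
def reciprocalShift (F : ℂ → ℂ) (z : ℂ) : ℂ := z / (1 + z * F z)

variable {F : ℂ → ℂ}

lemma analyticAt_reciprocalShift (hF : AnalyticAt ℂ F 0) :
    AnalyticAt ℂ (reciprocalShift F) 0 := by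
  unfold reciprocalShift
  exact analyticAt_id.div (analyticAt_const.add (analyticAt_id.mul hF)) (by simp)

lemma reciprocalShift_zero (F : ℂ → ℂ) : reciprocalShift F 0 = 0 := by simp [reciprocalShift]

lemma deriv_reciprocalShift (hF : AnalyticAt ℂ F 0) : deriv (reciprocalShift F) 0 = 1 := by
  have h1 : HasDerivAt (fun z => 1 + z * F z) (1 * F 0 + 0 * deriv F 0) 0 := by
    have := ((hasDerivAt_id (0 : ℂ)).mul hF.differentiableAt.hasDerivAt).const_add 1
    simpa using this
  have h2 := (hasDerivAt_id' (0 : ℂ)).fun_div h1 (by simp)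
  have h3 : HasDerivAt (reciprocalShift F) 1 0 := by
    rw [show (1 : ℂ) = (1 * (1 + 0 * F 0) - 0 * (1 * F 0 + 0 * deriv F 0)) / (1 + 0 * F 0) ^ 2 by
      simp]
    exact h2
  exact h3.deriv

/-- The binomial theorem: the j-th term contributes through the derivative of order k - j of F^j,
and j = k - m matches the summation in `freeMoment`. -/
lemma iteratedDeriv_one_add_mul_pow (hF : AnalyticAt ℂ F 0) (k : ℕ) :
    iteratedDeriv k (fun z => (1 + z * F z) ^ (k + 1)) 0 =
      ((k + 1)! : ℂ) * freeMoment F k := by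
  have e : (fun z => (1 + z * F z) ^ (k + 1)) = fun z =>
      ∑ j ∈ Finset.range (k + 1 + 1), ((k + 1).choose j : ℂ) * (z ^ j * F z ^ j) := by
    ext z
    rw [add_comm, add_pow]
    refine Finset.sum_congr rfl fun j _ => ?_
    rw [one_pow, mul_one, mul_pow]
    ring
  have ha : ∀ j, AnalyticAt ℂ (fun z => z ^ j * F z ^ j) 0 := fun j =>
    (analyticAt_id.pow j).mul (hF.pow j)
  have ha' : ∀ j, AnalyticAt ℂ (fun z => ((k + 1).choose j : ℂ) * (z ^ j * F z ^ j)) 0 := fun j =>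
    analyticAt_const.mul (ha j)
  rw [e, iteratedDeriv_fun_sum fun j _ => (ha' j).contDiffAt]
  have hterm : ∀ j, iteratedDeriv k (fun z => ((k + 1).choose j : ℂ) * (z ^ j * F z ^ j)) 0 =
      ((k + 1).choose j : ℂ) * ((k.descFactorial j : ℂ) *
        iteratedDeriv (k - j) (fun z => F z ^ j) 0) := fun j => by
    rw [iteratedDeriv_const_mul_field, iteratedDeriv_pow_mul (g := fun z => F z ^ j) (hF.pow j)]
  simp only [hterm]
  rw [Finset.sum_range_succ, Nat.descFactorial_of_lt (Nat.lt_succ_self k), Nat.cast_zero, zero_mul,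
    mul_zero, add_zero, ← Finset.sum_range_reflect, freeMoment, Finset.mul_sum]
  refine Finset.sum_congr rfl fun m hm => ?_
  have hm' := Finset.mem_range.mp hm
  rw [show k + 1 - 1 - m = k - m by omega, show k - (k - m) = m by omega, ← mul_assoc, ← mul_assoc]
  congr 1
  have h1 := Nat.choose_mul_factorial_mul_factorial (show k - m ≤ k + 1 by omega)
  have h2 := Nat.choose_mul_factorial_mul_factorial (show m ≤ k by omega)
  have h3 := Nat.factorial_mul_descFactorial (show k - m ≤ k by omega)
  rw [show k + 1 - (k - m) = m + 1 by omega] at h1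
  rw [show k - (k - m) = m by omega] at h3
  have hm1 : ((m + 1)! : ℂ) ≠ 0 := by exact_mod_cast (m + 1).factorial_ne_zero
  have hm0 : (m ! : ℂ) ≠ 0 := by exact_mod_cast m.factorial_ne_zero
  have hkm : ((k - m)! : ℂ) ≠ 0 := by exact_mod_cast (k - m).factorial_ne_zero
  have h1' : ((k + 1).choose (k - m) : ℂ) * ((k - m)! : ℂ) * ((m + 1)! : ℂ) = ((k + 1)! : ℂ) := by
    exact_mod_cast h1
  have h2' : (k.choose m : ℂ) * (m ! : ℂ) * ((k - m)! : ℂ) = (k ! : ℂ) := by exact_mod_cast h2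
  have h3' : (m ! : ℂ) * (k.descFactorial (k - m) : ℂ) = (k ! : ℂ) := by exact_mod_cast h3
  rw [← h1']
  field_simp
  rw [← mul_right_inj' hm0, mul_left_comm, h3', ← h2']
  ring

/-- **Lagrange inversion**: the Taylor coefficients of the inverse of `z / (1 + z F z)`. -/
theorem exists_inverse_reciprocalShift (hF : AnalyticAt ℂ F 0) :
    ∃ S : ℂ → ℂ, AnalyticAt ℂ S 0 ∧ S 0 = 0 ∧ (∀ᶠ z in 𝓝 0, S (reciprocalShift F z) = z) ∧
      ∀ k : ℕ, iteratedDeriv (k + 1) S 0 = ((k + 1)! : ℂ) * freeMoment F k := by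
  have hφ := analyticAt_reciprocalShift hF
  have hφ0 := reciprocalShift_zero F
  have hφ1 : deriv (reciprocalShift F) 0 ≠ 0 := by rw [deriv_reciprocalShift hF]; exact one_ne_zero
  set S := hφ.hasStrictDerivAt.localInverse _ _ _ hφ1 with hS
  have hSa : AnalyticAt ℂ S 0 := by
    have := hφ.analyticAt_localInverse hφ1
    rwa [hφ0] at this
  have hleft : ∀ᶠ z in 𝓝 0, S (reciprocalShift F z) = z :=
    hφ.hasStrictDerivAt.eventually_left_inverse hφ1
  have hS0 : S 0 = 0 := by
    have := hleft.self_of_nhds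
    rwa [hφ0] at this
  refine ⟨S, hSa, hS0, hleft, fun k => ?_⟩
  -- With a remainder of order k + 2, differentiating S(φ(z)) = z and dividing by φ^{k+1} leaves a
  -- holomorphic remainder.
  obtain ⟨g, hg, hT⟩ := hSa.exists_eventuallyEq_sum_add_pow_mul (k + 2)
  set c : ℕ → ℂ := fun j => iteratedDeriv j S 0 / (j ! : ℂ) with hc
  have hWa : AnalyticAt ℂ (fun z => 1 + z * F z) 0 := analyticAt_const.add (analyticAt_id.mul hF)
  have hga : AnalyticAt ℂ (fun z => g (reciprocalShift F z)) 0 :=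
    AnalyticAt.fun_comp (by rwa [hφ0]) hφ
  have hφt : Tendsto (reciprocalShift F) (𝓝 0) (𝓝 0) := by
    have := hφ.continuousAt.tendsto
    rwa [hφ0] at this
  have hev : ∀ᶠ z in 𝓝 (0 : ℂ), AnalyticAt ℂ (fun z => 1 + z * F z) z ∧ 1 + z * F z ≠ 0 ∧
      AnalyticAt ℂ (fun z => g (reciprocalShift F z)) z ∧
      (∑ j ∈ Finset.range (k + 2), c j * reciprocalShift F z ^ j) +
        reciprocalShift F z ^ (k + 2) * g (reciprocalShift F z) = z := by
    refine hWa.eventually_analyticAt.and ((hWa.continuousAt.eventually_ne (by simp)).and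
      (hga.eventually_analyticAt.and ?_))
    filter_upwards [hleft, hφt.eventually hT] with z h1 h2
    rw [h1] at h2
    conv_rhs => rw [h2]
    simp only [smul_eq_mul, hc]
    congr 1
    exact Finset.sum_congr rfl fun j _ => by ring
  obtain ⟨ρ, hρ, hball⟩ := Metric.eventually_nhds_iff_ball.mp hev
  set V := Metric.ball (0 : ℂ) ρ
  set R := ρ / 2 with hR'
  have hR : 0 < R := by positivity
  have hRV : Metric.closedBall 0 R ⊆ V := Metric.closedBall_subset_ball (by linarith)
  have hWd : DifferentiableOn ℂ (fun z => 1 + z * F z) V := fun z hz =>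
    (hball z hz).1.differentiableAt.differentiableWithinAt
  have hW0 : ∀ z ∈ V, 1 + z * F z ≠ 0 := fun z hz => (hball z hz).2.1
  have hφd : DifferentiableOn ℂ (reciprocalShift F) V := differentiableOn_id.div hWd hW0
  have hgd : DifferentiableOn ℂ (fun z => g (reciprocalShift F z)) V := fun z hz =>
    (hball z hz).2.2.1.differentiableAt.differentiableWithinAt
  have hφd' := hφd.deriv Metric.isOpen_ball
  have hgd' := hgd.deriv Metric.isOpen_ball
  have hsphere : ∀ z, ‖z‖ = R → z ∈ V ∧ reciprocalShift F z ≠ 0 := by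
    intro z hz
    have hzV := hRV (by simp [hz] : z ∈ Metric.closedBall 0 R)
    refine ⟨hzV, div_ne_zero ?_ (hW0 z hzV)⟩
    rintro rfl
    simp at hz
    exact hR.ne hz
  have hsub : Metric.sphere (0 : ℂ) R ⊆ V := Metric.sphere_subset_closedBall.trans hRV
  have hrem : DifferentiableOn ℂ (fun z => ((k + 2 : ℕ) : ℂ) * deriv (reciprocalShift F) z *
      g (reciprocalShift F z) + reciprocalShift F z *
        deriv (fun z => g (reciprocalShift F z)) z) V :=
    ((hφd'.const_mul _).mul hgd).add (hφd.mul hgd')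
  -- The integral of φ^{-(k+1)} in two ways. Here 1 is the derivative of S ∘ φ, so the integrand is
  -- ∑ j c_j φ^{j-k-2} φ' plus a holomorphic part, and only j = k + 1 has a residue.
  have hI1 : contourInt R (fun z => (reciprocalShift F z ^ (k + 1))⁻¹) = (k + 1 : ℕ) * c (k + 1) := by
    rw [contourInt_congr hR.le (g := fun z => (∑ j ∈ Finset.range (k + 2), ((j : ℂ) * c j) *
        (reciprocalShift F z ^ ((j : ℤ) - (k + 2 : ℕ)) * deriv (reciprocalShift F) z)) +
        (((k + 2 : ℕ) : ℂ) * deriv (reciprocalShift F) z * g (reciprocalShift F z) +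
          reciprocalShift F z * deriv (fun z => g (reciprocalShift F z)) z)),
      contourInt_add, contourInt_of_differentiable hR.le (hrem.mono hRV), add_zero, contourInt_sum]
    · simp only [contourInt_const_mul]
      have hz := fun j : ℤ => contourInt_zpow_mul_deriv hR Metric.isOpen_ball hRV hWd hW0 j
      rw [Finset.sum_eq_single (k + 1)]
      · have := hz (((k + 1 : ℕ) : ℤ) - (k + 2 : ℕ))
        rw [if_pos (by push_cast; ring)] at this
        unfold reciprocalShift
        rw [this, mul_one]
      · intro j _ hj
        have := hz ((j : ℤ) - (k + 2 : ℕ))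
        rw [if_neg (by omega)] at this
        unfold reciprocalShift
        rw [this, mul_zero]
      · intro h; exact absurd (Finset.mem_range.mpr (by omega)) h
    · intro j _
      refine ContinuousOn.circleIntegrable hR.le (continuousOn_const.mul (ContinuousOn.mul ?_ ?_))
      · refine (hφd.continuousOn.mono hsub).zpow₀ _ fun z hz => Or.inl ?_
        exact (hsphere z (by simpa using hz)).2
      · exact hφd'.continuousOn.mono hsub
    · refine ContinuousOn.circleIntegrable hR.le (continuousOn_finsetSum _ fun j _ => ?_)
      refine continuousOn_const.mul (ContinuousOn.mul ?_ ?_)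
      · refine (hφd.continuousOn.mono hsub).zpow₀ _ fun z hz => Or.inl ?_
        exact (hsphere z (by simpa using hz)).2
      · exact hφd'.continuousOn.mono hsub
    · exact ContinuousOn.circleIntegrable hR.le (hrem.continuousOn.mono hsub)
    · intro z hz
      obtain ⟨hzV, hφz⟩ := hsphere z hz
      have hVn := Metric.isOpen_ball.mem_nhds hzV
      have dφ := (hφd.differentiableAt hVn).hasDerivAt
      have dg := (hgd.differentiableAt hVn).hasDerivAt
      have dT := (HasDerivAt.fun_sum fun j (_ : j ∈ Finset.range (k + 2)) =>
        (dφ.fun_pow j).const_mul (c j)).add ((dφ.fun_pow (k + 2)).mul dg)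
      have did : HasDerivAt (fun z => (∑ j ∈ Finset.range (k + 2), c j * reciprocalShift F z ^ j) +
        reciprocalShift F z ^ (k + 2) * g (reciprocalShift F z)) 1 z := by
        refine (hasDerivAt_id z).congr_of_eventuallyEq ?_
        filter_upwards [hVn] with w hw
        exact (hball w hw).2.2.2
      have hone := did.unique dT
      have hpow : ∀ j : ℕ, (j : ℂ) * reciprocalShift F z ^ (j - 1) =
          reciprocalShift F z ^ (k + 1) *
            ((j : ℂ) * reciprocalShift F z ^ ((j : ℤ) - (k + 2 : ℕ))) := by
        intro j
        rcases Nat.eq_zero_or_pos j with rfl | hj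
        · simp
        · rw [mul_left_comm, ← zpow_natCast, ← zpow_natCast, ← zpow_add₀ hφz]
          congr 2
          push_cast [Nat.cast_sub hj]
          ring
      have hpk : reciprocalShift F z ^ (k + 1) ≠ 0 := pow_ne_zero _ hφz
      refine inv_eq_of_mul_eq_one_left ?_
      rw [hone, add_mul, Finset.sum_mul]
      congr 1
      · refine Finset.sum_congr rfl fun j _ => ?_
        rw [hpow j]
        ring
      · rw [show k + 2 - 1 = k + 1 by omega]
        ring
  -- Directly, φ^{-(k+1)} = (1 + z F)^{k+1} / z^{k+1}, whose residue is a Taylor coefficient.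
  have hI2 : contourInt R (fun z => (reciprocalShift F z ^ (k + 1))⁻¹) =
      (k + 1 : ℕ) * freeMoment F k := by
    have h1 := iteratedDeriv_eq_contourInt hR k ((hWd.fun_pow (k + 1)).mono hRV)
    rw [iteratedDeriv_one_add_mul_pow hF] at h1
    have hk : (k ! : ℂ) ≠ 0 := by exact_mod_cast k.factorial_ne_zero
    rw [← mul_right_inj' hk, ← mul_assoc, contourInt_congr hR.le
      (g := fun z => 1 / z ^ (k + 1) * (1 + z * F z) ^ (k + 1)), ← h1, Nat.factorial_succ]
    · push_cast; ring
    · intro z _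
      rw [reciprocalShift, div_pow, inv_div, one_div, div_eq_inv_mul]
  rw [hI1] at hI2
  have hk1 : ((k + 1 : ℕ) : ℂ) ≠ 0 := by exact_mod_cast k.succ_ne_zero
  have h3 := mul_left_cancel₀ hk1 hI2
  rw [← h3, hc]
  have : ((k + 1)! : ℂ) ≠ 0 := by exact_mod_cast (k + 1).factorial_ne_zero
  field_simp

end Lagrange

/-! ### The Perelomov-Popov weights and their moments -/

section Weights

variable {N : ℕ}

lemma Signature.shifted_strictAnti (l : Signature N) : StrictAnti l.shifted := by
  intro i j hij
  have h1 := l.2 hij.le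
  have h2 : (i : ℤ) < (j : ℤ) := by exact_mod_cast hij
  unfold Signature.shifted
  linarith

/-- The differences are nonzero integers, so subtracting q with |q| ≤ 1 cannot reverse their sign.
-/
lemma ppWeight_nonneg {q : ℝ} (hq : q ∈ Set.Icc (-1 : ℝ) 1) (l : Signature N) (i : Fin N) :
    0 ≤ ppWeight q l i := by
  refine Finset.prod_nonneg fun j hj => ?_
  have hne : l.shifted i - l.shifted j ≠ 0 :=
    sub_ne_zero.mpr (l.shifted_strictAnti.injective.ne (Finset.ne_of_mem_erase hj).symm)
  rcases lt_or_gt_of_ne hne with h | h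
  · have h1 : ((l.shifted i - l.shifted j : ℤ) : ℝ) ≤ -1 := by exact_mod_cast (by omega)
    exact div_nonneg_of_nonpos (by linarith [hq.1]) (by linarith)
  · have h1 : (1 : ℝ) ≤ ((l.shifted i - l.shifted j : ℤ) : ℝ) := by exact_mod_cast (by omega)
    exact div_nonneg (by linarith [hq.2]) (by linarith)

/-- The moments of the Perelomov-Popov measure. -/
def ppMoment (q : ℝ) (k : ℕ) (l : Signature N) : ℝ :=
  ∑ i, (N : ℝ)⁻¹ * ppWeight q l i * ((l.shifted i : ℝ) / N) ^ k

lemma integral_ppMeasure {q : ℝ} (hq : q ∈ Set.Icc (-1 : ℝ) 1) (l : Signature N) (f : ℝ → ℝ) :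
    ∫ t, f t ∂ppMeasure q l =
      ∑ i, (N : ℝ)⁻¹ * ppWeight q l i * f ((l.shifted i : ℝ) / N) := by
  rw [ppMeasure, integral_finsetSum_measure]
  · refine Finset.sum_congr rfl fun i _ => ?_
    rw [integral_smul_measure, integral_dirac, ENNReal.toReal_ofReal, smul_eq_mul]
    exact mul_nonneg (by positivity) (ppWeight_nonneg hq l i)
  · intro i _
    exact (integrable_dirac (by simp)).smul_measure ENNReal.ofReal_ne_top

lemma integral_pow_ppMeasure {q : ℝ} (hq : q ∈ Set.Icc (-1 : ℝ) 1) (l : Signature N) (k : ℕ) :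
    ∫ t, t ^ k ∂ppMeasure q l = ppMoment q k l :=
  integral_ppMeasure hq l fun t => t ^ k

lemma ppMoment_zero_left (k : ℕ) (l : Signature N) : ppMoment 0 k l = countingMoment k l := by
  have hw : ∀ i, ppWeight 0 l i = 1 := fun i => by
    refine Finset.prod_eq_one fun j hj => ?_
    have hne : l.shifted i - l.shifted j ≠ 0 :=
      sub_ne_zero.mpr (l.shifted_strictAnti.injective.ne (Finset.ne_of_mem_erase hj).symm)
    rw [sub_zero, div_self]
    exact_mod_cast hne
  simp only [ppMoment, countingMoment, hw, mul_one, Finset.mul_sum]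

end Weights

/-! ### Generating series of the Perelomov-Popov moments -/

section FormalProducts

open PowerSeries

/-- The formal geometric series `∑ a ^ n X ^ n`. -/
def geomSeries (a : ℝ) : PowerSeries ℝ := PowerSeries.mk fun n => a ^ n

lemma one_sub_mul_geomSeries (a : ℝ) : (1 - C a * X) * geomSeries a = 1 := by
  ext n
  rw [sub_mul, one_mul, mul_assoc, map_sub]
  cases n with
  | zero => simp [geomSeries]
  | succ n => simp [geomSeries, coeff_succ_X_mul, pow_succ', coeff_one]

lemma derivative_prod_one_sub {ι : Type*} (s : Finset ι) (a : ι → ℝ) :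
    d⁄dX ℝ (∏ i ∈ s, (1 - C (a i) * X)) =
      -((∏ i ∈ s, (1 - C (a i) * X)) * ∑ i ∈ s, C (a i) * geomSeries (a i)) := by
  classical
  induction s using Finset.induction_on with
  | empty => simp
  | insert i s hi ih =>
    rw [Finset.prod_insert hi, Finset.sum_insert hi, Derivation.leibniz, ih]
    have h1 : d⁄dX ℝ (1 - C (a i) * X : PowerSeries ℝ) = -C (a i) := by
      simp
    rw [h1]
    simp only [smul_eq_mul]
    linear_combination (C (a i) * ∏ i ∈ s, (1 - C (a i) * X)) * one_sub_mul_geomSeries (a i)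

lemma prod_one_sub_eq_mul {ι : Type*} [Fintype ι] [DecidableEq ι] {y : ι → ℝ}
    (hy : Function.Injective y) (t : ℝ) :
    ∏ j, (1 - C (y j + t) * X : PowerSeries ℝ) = (∏ j, (1 - C (y j) * X)) *
      (1 - X * ∑ i, C (t * ∏ j ∈ Finset.univ.erase i, (y i - t - y j) / (y i - y j)) *
        geomSeries (y i)) := by
  let K := FractionRing (PowerSeries ℝ)
  let f := algebraMap (PowerSeries ℝ) K
  have hf : Function.Injective f := IsFractionRing.injective _ K
  let ψ : ℝ →+* K := f.comp C
  have hψ : ∀ a, f (C a) = ψ a := fun a => rfl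
  have hx : f X ≠ 0 := by
    rw [Ne, map_eq_zero_iff f hf]
    exact X_ne_zero
  have hgeo : ∀ a, (1 - ψ a * f X) * f (geomSeries a) = 1 := fun a => by
    have := congrArg f (one_sub_mul_geomSeries a)
    simpa [hψ] using this
  have hne : ∀ a, 1 - ψ a * f X ≠ 0 := fun a h => by
    have := hgeo a
    rw [h, zero_mul] at this
    exact zero_ne_one this
  have hz : ∀ i, (f X)⁻¹ ≠ ψ (y i) := fun i h => by
    apply hne (y i)
    rw [← h, inv_mul_cancel₀ hx, sub_self]
  -- The partial fraction identity is purely algebraic; it is used at z = 1/X in the fraction field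
  -- of the power series ring, with shift -t.
  have key := prod_shift_div (s := fun i => ψ (y i)) (ψ.injective.comp hy) (ψ (-t)) hz
  have e1 : ∀ j, ((f X)⁻¹ + ψ (-t) - ψ (y j)) / ((f X)⁻¹ - ψ (y j)) =
      (1 - ψ (y j + t) * f X) / (1 - ψ (y j) * f X) := fun j => by
    rw [← mul_div_mul_right _ _ hx]
    congr 1
    · rw [sub_mul, add_mul, inv_mul_cancel₀ hx, map_neg, map_add]; ring
    · rw [sub_mul, inv_mul_cancel₀ hx]
  have e2 : ∀ i, ((∏ j ∈ Finset.univ.erase i, (ψ (y i) + ψ (-t) - ψ (y j)) / (ψ (y i) - ψ (y j))) /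
      ((f X)⁻¹ - ψ (y i))) = f X * (ψ (∏ j ∈ Finset.univ.erase i, (y i - t - y j) / (y i - y j)) *
        f (geomSeries (y i))) := fun i => by
    have h1 : ((f X)⁻¹ - ψ (y i))⁻¹ = f X * f (geomSeries (y i)) := by
      refine inv_eq_of_mul_eq_one_left ?_
      have := hgeo (y i)
      rw [mul_comm (f X), mul_assoc, mul_sub, mul_inv_cancel₀ hx, mul_comm (f X), mul_comm]
      exact this
    rw [div_eq_mul_inv, h1, map_prod]
    have h2 : ∀ j, (ψ (y i) + ψ (-t) - ψ (y j)) / (ψ (y i) - ψ (y j)) =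
        ψ ((y i - t - y j) / (y i - y j)) := fun j => by
      rw [map_div₀, map_sub, map_sub, map_sub, map_neg, sub_eq_add_neg (ψ (y i)) (ψ t)]
    simp only [h2]
    ring
  simp only [e1, e2] at key
  rw [Finset.prod_div_distrib, div_eq_iff (Finset.prod_ne_zero_iff.mpr fun j _ => hne _)] at key
  apply hf
  rw [map_prod, map_mul, map_prod]
  simp only [map_sub, map_mul, map_one, map_sum, hψ]
  rw [key, mul_comm]
  congr 1
  rw [map_neg, neg_mul, ← sub_eq_add_neg, ← Finset.mul_sum, Finset.mul_sum, Finset.mul_sum,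
    Finset.mul_sum]
  congr 1
  refine Finset.sum_congr rfl fun i _ => ?_
  ring

end FormalProducts

section Recursion

variable {N : ℕ}

/-- The coefficients of `1 - q ∑ I_k X ^ (k + 1)` with `I_k` the Perelomov-Popov moments. -/
def ppCoeff (q : ℝ) (l : Signature N) : ℕ → ℝ
  | 0 => 1
  | k + 1 => -q * ppMoment q k l

/-- The coefficients of the logarithmic derivative. -/
def ppLogCoeff (q : ℝ) (k : ℕ) (l : Signature N) : ℝ :=
  ∑ i, (((l.shifted i : ℝ) / N + q / N) ^ (k + 1) - ((l.shifted i : ℝ) / N) ^ (k + 1))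

open PowerSeries in
-- The generating series P is a quotient of two products of linear factors, so P'/P is an explicit
-- sum of geometric series. Comparing coefficients in P' = P · (P'/P) determines the moments from
-- `ppLogCoeff` recursively, as in Newton's identities.
lemma ppCoeff_recursion (hN : N ≠ 0) (q : ℝ) (l : Signature N) (n : ℕ) :
    ((n : ℝ) + 1) * ppCoeff q l (n + 1) =
      -∑ p ∈ Finset.HasAntidiagonal.antidiagonal n, ppCoeff q l p.1 * ppLogCoeff q p.2 l := by
  have hNr : (N : ℝ) ≠ 0 := by exact_mod_cast hN
  let y : Fin N → ℝ := fun i => (l.shifted i : ℝ) / N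
  have hy : Function.Injective y := by
    intro i j h
    apply l.shifted_strictAnti.injective
    have := (div_left_inj' hNr).mp h
    exact_mod_cast this
  let P : PowerSeries ℝ := 1 - X * ∑ i, C (q / N * ∏ j ∈ Finset.univ.erase i,
    (y i - q / N - y j) / (y i - y j)) * geomSeries (y i)
  let B : PowerSeries ℝ := ∏ j, (1 - C (y j) * X)
  have hB : B ≠ 0 := Finset.prod_ne_zero_iff.mpr fun j _ h => by
    have := one_sub_mul_geomSeries (y j)
    rw [h, zero_mul] at this
    exact zero_ne_one this
  have hA : ∏ j, (1 - C (y j + q / N) * X : PowerSeries ℝ) = B * P := prod_one_sub_eq_mul hy _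
  have hd := derivative_prod_one_sub Finset.univ fun j => y j + q / N
  have hdB := derivative_prod_one_sub Finset.univ y
  rw [hA, Derivation.leibniz] at hd
  simp only [smul_eq_mul] at hd
  have hP : d⁄dX ℝ P = -(P * ∑ j, (C (y j + q / N) * geomSeries (y j + q / N) -
      C (y j) * geomSeries (y j))) := by
    apply mul_left_cancel₀ hB
    rw [Finset.sum_sub_distrib]
    linear_combination hd - P * hdB
  have hw : ∀ i, ∏ j ∈ Finset.univ.erase i, (y i - q / N - y j) / (y i - y j) = ppWeight q l i := by
    intro i
    refine Finset.prod_congr rfl fun j _ => ?_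
    simp only [y]
    rw [← mul_div_mul_right _ _ hNr]
    push_cast
    congr 1
    · field_simp; ring
    · field_simp
  have hcoeff : ∀ n, coeff n P = ppCoeff q l n := by
    intro n
    cases n with
    | zero => simp [P, ppCoeff]
    | succ n =>
      simp only [P, hw, map_sub, coeff_succ_X_mul, map_sum, coeff_C_mul, geomSeries, coeff_mk,
        ppCoeff, ppMoment, coeff_one]
      rw [if_neg (Nat.succ_ne_zero n), zero_sub, neg_mul, Finset.mul_sum]
      congr 1
      exact Finset.sum_congr rfl fun i _ => by simp only [y]; ring
  have hlog : ∀ k, coeff k (∑ j, (C (y j + q / N) * geomSeries (y j + q / N) -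
      C (y j) * geomSeries (y j))) = ppLogCoeff q k l := by
    intro k
    simp only [map_sum, map_sub, coeff_C_mul, geomSeries, coeff_mk, ppLogCoeff, y, pow_succ']
  have h := congrArg (coeff n) hP
  rw [coeff_derivative, map_neg, coeff_mul, hcoeff] at h
  simp only [hcoeff, hlog] at h
  rw [mul_comm, h]

/-- In the binomial expansion the top power cancels, leaving a factor 1/N that normalizes the
counting measure. Every term but i = k carries a further power of 1/N and is lost in the limit. -/
lemma ppLogCoeff_eq (hN : N ≠ 0) (q : ℝ) (k : ℕ) (l : Signature N) :
    ppLogCoeff q k l = ∑ i ∈ Finset.range (k + 1), (((k + 1).choose i : ℝ) * q ^ (k + 1 - i) *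
      ((N : ℝ)⁻¹) ^ (k - i)) * countingMoment i l := by
  have hNr : (N : ℝ) ≠ 0 := by exact_mod_cast hN
  have e : ∀ y : ℝ, (y + q / N) ^ (k + 1) - y ^ (k + 1) = ∑ i ∈ Finset.range (k + 1),
      (((k + 1).choose i : ℝ) * q ^ (k + 1 - i) * ((N : ℝ)⁻¹) ^ (k - i)) * ((N : ℝ)⁻¹ * y ^ i) := by
    intro y
    rw [add_pow, Finset.sum_range_succ]
    simp only [Nat.sub_self, pow_zero, mul_one, Nat.choose_self, Nat.cast_one, add_sub_cancel_right]
    refine Finset.sum_congr rfl fun i hi => ?_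
    have hi' := Finset.mem_range.mp hi
    rw [div_pow, show k + 1 - i = k - i + 1 by omega, pow_succ (N : ℝ), inv_pow]
    field_simp
  simp only [ppLogCoeff, e, countingMoment, Finset.mul_sum]
  exact Finset.sum_comm

variable {rho : (N : ℕ) → PMF (Signature N)}

lemma TendstoInProb.ppLogCoeff {c : ℕ → ℝ}
    (h : ∀ k, TendstoInProb rho (fun _ l => countingMoment k l) (c k)) (q : ℝ) (k : ℕ) :
    TendstoInProb rho (fun _ l => ppLogCoeff q k l) ((k + 1) * q * c k) := by
  have h1 : ∀ i ∈ Finset.range (k + 1), TendstoInProb rho (fun N l =>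
      (((k + 1).choose i : ℝ) * q ^ (k + 1 - i) * ((N : ℝ)⁻¹) ^ (k - i)) * countingMoment i l)
      ((((k + 1).choose i : ℝ) * q ^ (k + 1 - i) * (0 : ℝ) ^ (k - i)) * c i) := by
    intro i _
    refine (tendstoInProb_of_tendsto ?_).mul (h i)
    exact (tendsto_inv_atTop_nhds_zero_nat.pow _).const_mul _
  have h2 := TendstoInProb.sum _ h1
  have e : ∑ i ∈ Finset.range (k + 1), (((k + 1).choose i : ℝ) * q ^ (k + 1 - i) *
      (0 : ℝ) ^ (k - i)) * c i = (k + 1) * q * c k := by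
    rw [Finset.sum_eq_single k]
    · simp [Nat.choose_succ_self_right]
    · intro i hi hik
      have := Finset.mem_range.mp hi
      rw [zero_pow (by omega)]; ring
    · simp
  rw [e] at h2
  refine h2.congr' ?_
  filter_upwards [eventually_ne_atTop 0] with N hN l
  exact (ppLogCoeff_eq hN q k l).symm

/-- Convergence of the Perelomov-Popov moments from that of the counting moments, in terms of a
function with Taylor coefficients `c k` shifted by one. -/
theorem tendstoInProb_ppCoeff {c : ℕ → ℝ} {S : ℂ → ℂ} (hS : AnalyticAt ℂ S 0) (hS0 : S 0 = 0)
    (hSc : ∀ k : ℕ, iteratedDeriv (k + 1) S 0 = ((k + 1)! : ℂ) * c k)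
    (h : ∀ k, TendstoInProb rho (fun _ l => countingMoment k l) (c k)) (q : ℝ) (n : ℕ) :
    ∃ p : ℝ, (n ! : ℂ) * p = iteratedDeriv n (fun v => Complex.exp (-q * S v)) 0 ∧
      TendstoInProb rho (fun _ l => ppCoeff q l n) p := by
  induction n using Nat.strong_induction_on with
  | _ n ih =>
    cases n with
    | zero =>
      refine ⟨1, by simp [hS0], ?_⟩
      exact tendstoInProb_of_tendsto (x := fun _ => 1) tendsto_const_nhds
    | succ n =>
      choose! p hp hpl using ih
      set f : ℂ → ℂ := fun v => Complex.exp (-q * S v) with hf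
      have hfa : AnalyticAt ℂ f 0 := (analyticAt_const.mul hS).cexp'
      -- The equation f' = -q S' f for f = exp(-q S) is the limit of the recursion for the
      -- coefficients; strong induction on n compares the two.
      have hder : deriv f =ᶠ[𝓝 0] fun v => -q * (f v * deriv S v) := by
        filter_upwards [hS.eventually_analyticAt] with v hv
        have := ((hv.differentiableAt.hasDerivAt.const_mul (-q : ℂ)).cexp).deriv
        rw [hf, this]
        ring
      have hrec : iteratedDeriv (n + 1) f 0 = -q * ∑ i ∈ Finset.range (n + 1),
          (n.choose i : ℂ) * iteratedDeriv i f 0 * iteratedDeriv (n - i + 1) S 0 := by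
        rw [iteratedDeriv_succ', hder.iteratedDeriv_eq, iteratedDeriv_const_mul_field,
          iteratedDeriv_fun_mul hfa.contDiffAt hS.deriv.contDiffAt]
        simp only [iteratedDeriv_succ']
      have hlim : TendstoInProb rho (fun N l => (-((n : ℝ) + 1)⁻¹) *
          ∑ i ∈ Finset.range (n + 1), ppCoeff q l i * PerelomovPopov.ppLogCoeff q (n - i) l)
          ((-((n : ℝ) + 1)⁻¹) *
            ∑ i ∈ Finset.range (n + 1), p i * ((((n - i : ℕ) : ℝ) + 1) * q * c (n - i))) := by
        refine TendstoInProb.const_mul _ (TendstoInProb.sum _ fun i hi => ?_)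
        exact (hpl i (Finset.mem_range.mp hi)).mul (TendstoInProb.ppLogCoeff h q (n - i))
      have hn1 : (n : ℝ) + 1 ≠ 0 := by positivity
      refine ⟨_, ?_, hlim.congr' ?_⟩
      · rw [hrec]
        push_cast
        have hn1' : (n : ℂ) + 1 ≠ 0 := by exact_mod_cast hn1
        rw [Nat.factorial_succ]
        push_cast
        rw [Finset.mul_sum, Finset.mul_sum, Finset.mul_sum]
        refine Finset.sum_congr rfl fun i hi => ?_
        have hi' := Finset.mem_range.mp hi
        rw [hSc, ← hp i hi', Nat.factorial_succ,
          ← Nat.choose_mul_factorial_mul_factorial (show i ≤ n by omega)]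
        push_cast
        field_simp
      · filter_upwards [eventually_ne_atTop 0] with N hN l
        have h1 := ppCoeff_recursion hN q l n
        rw [Finset.Nat.sum_antidiagonal_eq_sum_range_succ_mk] at h1
        rw [neg_mul, ← mul_neg, ← h1, inv_mul_cancel_left₀ hn1]

end Recursion

/-! ### From q = 0 to general q: the change of variable log e_q -/

section QExponential

/-- The logarithm of `qExp q`. -/
def qLog (q : ℝ) (z : ℂ) : ℂ :=
  if q = 0 then z else -(1 / (q : ℂ)) * Complex.log (1 - q * z)

lemma one_sub_mul_mem_slitPlane (q : ℝ) : ∀ᶠ z in 𝓝 (0 : ℂ), 1 - (q : ℂ) * z ∈ Complex.slitPlane := by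
  have hc : ContinuousAt (fun z : ℂ => 1 - (q : ℂ) * z) 0 := by fun_prop
  exact hc.eventually_mem (Complex.isOpen_slitPlane.mem_nhds (by simp))

lemma qLog_zero (q : ℝ) : qLog q 0 = 0 := by
  unfold qLog; split_ifs <;> simp

lemma analyticAt_qLog (q : ℝ) : AnalyticAt ℂ (qLog q) 0 := by
  unfold qLog
  split_ifs
  · exact analyticAt_id
  · exact analyticAt_const.mul (AnalyticAt.clog (by fun_prop) (by simp))

lemma deriv_qLog (q : ℝ) : deriv (qLog q) 0 = 1 := by
  unfold qLog
  split_ifs with h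
  · simp
  · have hq : (q : ℂ) ≠ 0 := by exact_mod_cast h
    have h1 : HasDerivAt (fun z : ℂ => 1 - (q : ℂ) * z) (-(q : ℂ)) 0 := by
      simpa using ((hasDerivAt_id' (0 : ℂ)).const_mul (q : ℂ)).const_sub 1
    have h2 := (h1.clog (by simp)).const_mul (-(1 / (q : ℂ)))
    rw [h2.deriv]
    simp [hq]

lemma exp_qLog (q : ℝ) : ∀ᶠ z in 𝓝 (0 : ℂ), Complex.exp (qLog q z) = qExp q z := by
  filter_upwards [one_sub_mul_mem_slitPlane q] with z hz
  unfold qLog qExp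
  split_ifs with h
  · rfl
  · rw [Complex.cpow_def_of_ne_zero (Complex.slitPlane_ne_zero hz)]
    congr 1
    ring

lemma one_sub_exp_qLog (q : ℝ) (hq : q ≠ 0) :
    ∀ᶠ z in 𝓝 (0 : ℂ), Complex.exp (-q * qLog q z) = 1 - q * z := by
  filter_upwards [one_sub_mul_mem_slitPlane q] with z hz
  have hq' : (q : ℂ) ≠ 0 := by exact_mod_cast hq
  rw [qLog, if_neg hq, ← mul_assoc, neg_mul_neg, mul_one_div_cancel hq', one_mul,
    Complex.exp_log (Complex.slitPlane_ne_zero hz)]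

lemma analyticAt_qExp (q : ℝ) : AnalyticAt ℂ (qExp q) 0 :=
  ((analyticAt_qLog q).cexp').congr (exp_qLog q)

lemma qExp_zero (q : ℝ) : qExp q 0 = 1 := by
  rw [← (exp_qLog q).self_of_nhds, qLog_zero, Complex.exp_zero]

lemma eventually_ne_zero_of_deriv {f : ℂ → ℂ} (hf : AnalyticAt ℂ f 0)
    (h1 : deriv f 0 ≠ 0) : ∀ᶠ z in 𝓝[≠] (0 : ℂ), f z ≠ 0 := by
  have := hf.differentiableAt.hasDerivAt.eventually_ne (c := 0) h1
  simpa using this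

lemma analyticAt_dslope {f : ℂ → ℂ} (hf : AnalyticAt ℂ f 0) : AnalyticAt ℂ (dslope f 0) 0 := by
  obtain ⟨s, hs, hd⟩ := hf.eventually_analyticAt.exists_mem
  have h1 : DifferentiableOn ℂ f s := fun z hz => (hd z hz).differentiableAt.differentiableWithinAt
  exact ((Complex.differentiableOn_dslope hs).mpr h1).analyticAt hs

/-- The difference of reciprocals of two functions vanishing to first order extends. -/
lemma exists_analytic_inv_sub_inv {T : ℂ → ℂ} (hT : AnalyticAt ℂ T 0) (h0 : T 0 = 0)
    (h1 : deriv T 0 = 1) : ∃ h : ℂ → ℂ, AnalyticAt ℂ h 0 ∧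
      ∀ᶠ z in 𝓝[≠] (0 : ℂ), (T z)⁻¹ - z⁻¹ = h z := by
  have hd := analyticAt_dslope hT
  have hd0 : dslope T 0 0 = 1 := by rw [dslope_same, h1]
  refine ⟨fun z => -dslope (dslope T 0) 0 z / dslope T 0 z,
    (analyticAt_dslope hd).neg.div hd (by rw [hd0]; exact one_ne_zero), ?_⟩
  filter_upwards [eventually_ne_zero_of_deriv hT (by rw [h1]; exact one_ne_zero),
    self_mem_nhdsWithin] with z hTz hz
  have hz0 : z ≠ 0 := hz
  have e1 : T z = z * dslope T 0 z := by
    have := sub_smul_dslope T 0 z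
    simpa [h0] using this.symm
  have e2 : dslope T 0 z - 1 = z * dslope (dslope T 0) 0 z := by
    have := sub_smul_dslope (dslope T 0) 0 z
    rw [hd0] at this
    simpa using this.symm
  have hne : dslope T 0 z ≠ 0 := by
    intro h
    rw [e1, h, mul_zero] at hTz
    exact hTz rfl
  rw [e1]
  field_simp
  linear_combination -e2

variable {Psi : ℂ → ℂ}

lemma expDiv_zero_right {s : ℂ} (hs : s ≠ 0) : expDiv s 0 = (Complex.exp s - 1) / s := by
  rw [eq_div_iff hs]
  have := sub_mul_expDiv s 0
  rw [sub_zero, Complex.exp_zero] at this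
  rw [← this, mul_comm]

lemma deriv_logLimit (hPsi : AnalyticAt ℂ Psi 1) :
    ∀ᶠ s in 𝓝[≠] (0 : ℂ), deriv (logLimit Psi) s =
      Complex.exp s * deriv Psi (Complex.exp s) + Complex.exp s / (Complex.exp s - 1) - s⁻¹ := by
  have h1 : ∀ᶠ s in 𝓝 (0 : ℂ), AnalyticAt ℂ Psi (Complex.exp s) := by
    have := hPsi.eventually_analyticAt
    rw [← Complex.exp_zero] at this
    exact Complex.continuous_exp.continuousAt.eventually this
  have h2 : ∀ᶠ s in 𝓝 (0 : ℂ), expDiv s 0 ∈ Complex.slitPlane := by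
    have ha : AnalyticAt ℂ (fun s : ℂ => expDiv s 0) 0 :=
      analyticAt_expDiv analyticAt_id analyticAt_const
    exact ha.continuousAt.eventually_mem
      (Complex.isOpen_slitPlane.mem_nhds (by simp [expDiv_self]))
  filter_upwards [nhdsWithin_le_nhds h1, nhdsWithin_le_nhds h2, self_mem_nhdsWithin] with s hs hs2 hs0
  have hs0' : s ≠ 0 := hs0
  have he := expDiv_zero_right hs0'
  have hne : (Complex.exp s - 1) / s ≠ 0 := by
    rw [← he]; exact Complex.slitPlane_ne_zero hs2
  have hne1 : Complex.exp s - 1 ≠ 0 := fun h => hne (by rw [h, zero_div])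
  have d1 : HasDerivAt (fun s => Psi (Complex.exp s)) (deriv Psi (Complex.exp s) * Complex.exp s) s :=
    hs.differentiableAt.hasDerivAt.comp s (Complex.hasDerivAt_exp s)
  have d2 : HasDerivAt (fun s => (Complex.exp s - 1) / s)
      ((Complex.exp s * s - (Complex.exp s - 1) * 1) / s ^ 2) s :=
    ((Complex.hasDerivAt_exp s).sub_const 1).fun_div (hasDerivAt_id' s) hs0'
  have d3 : HasDerivAt (fun s => expDiv s 0)
      ((Complex.exp s * s - (Complex.exp s - 1) * 1) / s ^ 2) s := by
    refine d2.congr_of_eventuallyEq ?_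
    filter_upwards [isOpen_ne.mem_nhds hs0'] with w hw
    exact expDiv_zero_right hw
  have d4 := (d1.add (d3.clog hs2)).deriv
  have e : deriv (logLimit Psi) s = _ := d4
  rw [e, he]
  field_simp
  ring

/-- `1 / z + F z`, with `F = qFun q Psi`, is the corresponding function for `q = 0`
at `qLog q z`. -/
theorem qFun_spec (hPsi : AnalyticAt ℂ Psi 1) (q : ℝ) :
    AnalyticAt ℂ (qFun q Psi) 0 ∧ ∀ᶠ z in 𝓝[≠] (0 : ℂ),
      qFun q Psi z + z⁻¹ = deriv (logLimit Psi) (qLog q z) + (qLog q z)⁻¹ := by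
  obtain ⟨h, hh, hinv⟩ := exists_analytic_inv_sub_inv (analyticAt_qLog q) (qLog_zero q)
    (deriv_qLog q)
  have hL : AnalyticAt ℂ (fun z => deriv (logLimit Psi) (qLog q z) + h z) 0 := by
    refine AnalyticAt.add (AnalyticAt.fun_comp ?_ (analyticAt_qLog q)) hh
    rw [qLog_zero]
    exact (analyticAt_logLimit hPsi).deriv
  have hT0 : Tendsto (qLog q) (𝓝[≠] 0) (𝓝[≠] 0) := by
    rw [tendsto_nhdsWithin_iff]
    refine ⟨?_, eventually_ne_zero_of_deriv (analyticAt_qLog q)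
      (by rw [deriv_qLog]; exact one_ne_zero)⟩
    have := (analyticAt_qLog q).continuousAt.tendsto
    rw [qLog_zero] at this
    exact this.mono_left nhdsWithin_le_nhds
  set F : ℂ → ℂ := fun u =>
    qExp q u * deriv Psi (qExp q u) + qExp q u / (qExp q u - 1) - 1 / u with hF
  have hFeq : ∀ᶠ z in 𝓝[≠] (0 : ℂ), deriv (logLimit Psi) (qLog q z) + h z = F z := by
    filter_upwards [hT0.eventually (deriv_logLimit hPsi), nhdsWithin_le_nhds (exp_qLog q), hinv]
      with z h1 h2 h3
    rw [h1, h2, ← h3, hF]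
    ring
  -- The analytic expression agrees with the raw formula off 0, so the limit defining the value at 0
  -- is the value of this expression.
  have hlim : limUnder (𝓝[≠] (0 : ℂ)) F = deriv (logLimit Psi) (qLog q 0) + h 0 := by
    refine Tendsto.limUnder_eq ?_
    refine (hL.continuousAt.tendsto.mono_left nhdsWithin_le_nhds).congr' ?_
    exact hFeq
  have hq : (fun z => deriv (logLimit Psi) (qLog q z) + h z) =ᶠ[𝓝 0] qFun q Psi := by
    rw [eventually_nhdsWithin_iff] at hFeq
    filter_upwards [hFeq] with z hz
    rcases eq_or_ne z 0 with rfl | hz0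
    · rw [← hlim]
      simp [qFun, hF]
    · rw [hz hz0]
      simp [qFun, hF, hz0]
  refine ⟨hL.congr hq, ?_⟩
  filter_upwards [nhdsWithin_le_nhds hq, hinv] with z h1 h2
  rw [← h1, ← h2]
  ring

lemma reciprocalShift_eq_inv {F : ℂ → ℂ} {z : ℂ} (hz : z ≠ 0) :
    reciprocalShift F z = (F z + z⁻¹)⁻¹ := by
  rw [reciprocalShift, ← inv_div]
  congr 1
  field_simp
  ring

/-- Taking reciprocals in `qFun_spec`. Replacing q = 0 by q amounts to composing with log e_q, so
the inverse functions are related explicitly. -/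
lemma reciprocalShift_qFun (hPsi : AnalyticAt ℂ Psi 1) (q : ℝ) :
    ∀ᶠ z in 𝓝 (0 : ℂ),
      reciprocalShift (qFun q Psi) z = reciprocalShift (deriv (logLimit Psi)) (qLog q z) := by
  have h1 := (qFun_spec hPsi q).2
  have h2 := eventually_ne_zero_of_deriv (analyticAt_qLog q)
      (by rw [deriv_qLog]; exact one_ne_zero)
  have h3 := h1.and h2
  rw [eventually_nhdsWithin_iff] at h3
  filter_upwards [h3] with z hz
  rcases eq_or_ne z 0 with rfl | hz0
  · rw [qLog_zero, reciprocalShift_zero, reciprocalShift_zero]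
  · obtain ⟨a, b⟩ := hz hz0
    rw [reciprocalShift_eq_inv hz0, reciprocalShift_eq_inv b, a]

/-- Left inverses of `z / (1 + z F z)` near the origin are unique. -/
lemma eventuallyEq_of_leftInverse {F S S' : ℂ → ℂ} (hF : AnalyticAt ℂ F 0)
    (h : ∀ᶠ z in 𝓝 0, S (reciprocalShift F z) = z)
    (h' : ∀ᶠ z in 𝓝 0, S' (reciprocalShift F z) = z) : S =ᶠ[𝓝 0] S' := by
  have hφ := analyticAt_reciprocalShift hF
  have hmap := hφ.hasStrictDerivAt.map_nhds_eq
    (by rw [deriv_reciprocalShift hF]; exact one_ne_zero)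
  rw [reciprocalShift_zero] at hmap
  rw [EventuallyEq, ← hmap, eventually_map]
  filter_upwards [h, h'] with z h1 h2
  rw [h1, h2]

end QExponential

/-! ### Limits of the Perelomov-Popov moments -/

section PPLimit

variable {rho : (N : ℕ) → PMF (Signature N)} {Psi : ℂ → ℂ}

/-- For q ≠ 0 the limit series is exp(-q S0), where S0 generates the limits of the counting moments.
Uniqueness of left inverses identifies (1 - exp(-q S0))/q with the inverse belonging to `qFun q
Psi`, and Lagrange inversion reads off its coefficients. -/
theorem LogSchurGenTendsto.exists_tendstoInProb_ppMoment (h : LogSchurGenTendsto rho Psi)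
    (hPsi : AnalyticAt ℂ Psi 1)
    (h_conv : ∀ N : ℕ, ∃ V ∈ 𝓝 (1 : Fin N → ℂ), SummableUniformlyOn (schurTerm (rho N)) V)
    (q : ℝ) (k : ℕ) :
    ∃ c : ℝ, (c : ℂ) = freeMoment (qFun q Psi) k ∧
      TendstoInProb rho (fun _ l => ppMoment q k l) c := by
  have hF0 : AnalyticAt ℂ (deriv (logLimit Psi)) 0 := (analyticAt_logLimit hPsi).deriv
  obtain ⟨S0, hS0a, hS00, hS0inv, hS0c⟩ := exists_inverse_reciprocalShift hF0
  obtain ⟨hqF, -⟩ := qFun_spec hPsi q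
  obtain ⟨S, hSa, hS0, hSinv, hSc⟩ := exists_inverse_reciprocalShift hqF
  have hTt : Tendsto (qLog q) (𝓝 0) (𝓝 0) := by
    have := (analyticAt_qLog q).continuousAt.tendsto
    rwa [qLog_zero] at this
  have hcomp : ∀ᶠ z in 𝓝 0, S0 (reciprocalShift (qFun q Psi) z) = qLog q z := by
    filter_upwards [reciprocalShift_qFun hPsi q, hTt.eventually hS0inv] with z h1 h2
    rw [h1, h2]
  choose c hc hcl using h.exists_tendstoInProb hPsi h_conv
  rcases eq_or_ne q 0 with rfl | hq
  · refine ⟨c k, ?_, ?_⟩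
    · have hSS : S =ᶠ[𝓝 0] S0 := eventuallyEq_of_leftInverse hqF hSinv (by simpa [qLog] using hcomp)
      have e := hSS.iteratedDeriv_eq (k + 1)
      rw [hSc, hS0c] at e
      have hk : ((k + 1)! : ℂ) ≠ 0 := by exact_mod_cast (k + 1).factorial_ne_zero
      rw [mul_left_cancel₀ hk e, hc]
      rfl
    · simpa only [ppMoment_zero_left] using hcl k
  · have hq' : (q : ℂ) ≠ 0 := by exact_mod_cast hq
    obtain ⟨p, hp, hpl⟩ := tendstoInProb_ppCoeff hS0a hS00
      (fun k => by rw [hS0c, hc]; rfl) hcl q (k + 1)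
    -- Since S0 takes the value log e_q(z) here and exp(-q log e_q(z)) = 1 - q z, the right-hand
    -- side returns z.
    have hSS : S =ᶠ[𝓝 0] fun v => -(q : ℂ)⁻¹ * (Complex.exp (-q * S0 v) - 1) := by
      refine eventuallyEq_of_leftInverse hqF hSinv ?_
      filter_upwards [hcomp, one_sub_exp_qLog q hq] with z h1 h2
      rw [h1, h2]
      field_simp
      ring
    have e := hSS.iteratedDeriv_eq (k + 1)
    have hea : AnalyticAt ℂ (fun v => Complex.exp (-q * S0 v)) 0 :=
      (analyticAt_const.mul hS0a).cexp'
    rw [hSc, iteratedDeriv_const_mul_field, iteratedDeriv_fun_sub hea.contDiffAt contDiffAt_const,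
      iteratedDeriv_const, if_neg (Nat.succ_ne_zero k), sub_zero, ← hp] at e
    have hk : ((k + 1)! : ℂ) ≠ 0 := by exact_mod_cast (k + 1).factorial_ne_zero
    refine ⟨-q⁻¹ * p, ?_, ?_⟩
    · apply mul_left_cancel₀ hk
      rw [e]
      push_cast
      ring
    · refine (hpl.const_mul (-q⁻¹)).congr' (Eventually.of_forall fun N l => ?_)
      rw [ppCoeff, ← mul_assoc, neg_mul_neg, inv_mul_cancel₀ hq, one_mul]

/-- The sums differ by the term m = k, a derivative of order k ≥ 1 of a constant. -/
lemma limitMoment_eq_freeMoment (q : ℝ) (Psi : ℂ → ℂ) {k : ℕ} (hk : 1 ≤ k) :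
    limitMoment q Psi k = freeMoment (qFun q Psi) k := by
  rw [freeMoment, Finset.sum_range_succ]
  have h0 : iteratedDeriv k (fun u => qFun q Psi u ^ (k - k)) 0 = 0 := by
    simp only [Nat.sub_self, pow_zero]
    rw [iteratedDeriv_const, if_neg (by omega)]
  rw [h0, mul_zero, add_zero, limitMoment]
  refine Finset.sum_congr rfl fun m hm => ?_
  have hm' := Finset.mem_range.mp hm
  congr 1
  rw [← Nat.choose_mul_factorial_mul_factorial (show m ≤ k by omega)]
  have h1 : (m ! : ℂ) ≠ 0 := by exact_mod_cast m.factorial_ne_zero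
  have h2 : ((m + 1)! : ℂ) ≠ 0 := by exact_mod_cast (m + 1).factorial_ne_zero
  have h3 : ((k - m)! : ℂ) ≠ 0 := by exact_mod_cast (k - m).factorial_ne_zero
  push_cast
  field_simp

end PPLimit

/-! ### Moments and the R-transform -/

section Stieltjes

variable {mu : Measure ℝ} {A : ℝ}

lemma ae_abs_le (hA : mu (Set.Icc (-A) A)ᶜ = 0) : ∀ᵐ t ∂mu, |t| ≤ A := by
  filter_upwards [mem_ae_iff.mpr hA] with t ht
  exact abs_le.mpr ht

lemma integrable_pow_of_bounded [IsProbabilityMeasure mu] (hA : mu (Set.Icc (-A) A)ᶜ = 0) (k : ℕ) :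
    Integrable (fun t : ℝ => t ^ k) mu := by
  refine Integrable.of_bound (by fun_prop) (A ^ k) ?_
  filter_upwards [ae_abs_le hA] with t ht
  rw [Real.norm_eq_abs, abs_pow]
  gcongr

/-- Geometric series for 1/(w - t), integrated termwise; |t| ≤ A < |w| gives absolute convergence.
-/
lemma hasSum_stieltjes [IsProbabilityMeasure mu] (hA0 : 0 ≤ A) (hA : mu (Set.Icc (-A) A)ᶜ = 0)
    {w : ℂ} (hw : A < ‖w‖) :
    HasSum (fun k : ℕ => ((∫ t, t ^ k ∂mu : ℝ) : ℂ) * w⁻¹ ^ (k + 1)) (stieltjes mu w) := by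
  have hw0 : 0 < ‖w‖ := hA0.trans_lt hw
  have hwne : w ≠ 0 := norm_pos_iff.mp hw0
  have hi : ∀ k : ℕ, Integrable (fun t : ℝ => ((t ^ k : ℝ) : ℂ) * w⁻¹ ^ (k + 1)) mu := fun k =>
    ((integrable_pow_of_bounded hA k).ofReal).mul_const _
  have hr : A / ‖w‖ < 1 := (div_lt_one hw0).mpr hw
  have hs : Summable fun k : ℕ => ∫ t, ‖((t ^ k : ℝ) : ℂ) * w⁻¹ ^ (k + 1)‖ ∂mu := by
    refine Summable.of_nonneg_of_le (fun k => integral_nonneg fun t => norm_nonneg _) (fun k => ?_)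
      ((summable_geometric_of_lt_one (by positivity) hr).mul_left ‖w‖⁻¹)
    refine (integral_mono_ae (hi k).norm (integrable_const (‖w‖⁻¹ * (A / ‖w‖) ^ k)) ?_).trans
      (by simp)
    filter_upwards [ae_abs_le hA] with t ht
    rw [norm_mul, Complex.norm_real, Real.norm_eq_abs, abs_pow, norm_pow, norm_inv, div_pow,
      pow_succ, inv_pow]
    calc |t| ^ k * ((‖w‖ ^ k)⁻¹ * ‖w‖⁻¹) ≤ A ^ k * ((‖w‖ ^ k)⁻¹ * ‖w‖⁻¹) := by gcongr
      _ = ‖w‖⁻¹ * (A ^ k / ‖w‖ ^ k) := by ring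
  have h := hasSum_integral_of_summable_integral_norm hi hs
  have e1 : ∀ k : ℕ, ∫ t, ((t ^ k : ℝ) : ℂ) * w⁻¹ ^ (k + 1) ∂mu =
      ((∫ t, t ^ k ∂mu : ℝ) : ℂ) * w⁻¹ ^ (k + 1) := fun k => by
    rw [integral_mul_const]
    congr 1
    exact integral_ofReal
  have e2 : ∫ t, ∑' k : ℕ, ((t ^ k : ℝ) : ℂ) * w⁻¹ ^ (k + 1) ∂mu = stieltjes mu w := by
    refine integral_congr_ae ?_
    filter_upwards [ae_abs_le hA] with t ht
    have hlt : ‖(t : ℂ) * w⁻¹‖ < 1 := by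
      rw [norm_mul, Complex.norm_real, Real.norm_eq_abs, norm_inv, ← div_eq_mul_inv, div_lt_one hw0]
      exact ht.trans_lt hw
    have hg := (hasSum_geometric_of_norm_lt_one hlt).mul_left w⁻¹
    have e3 : (fun k : ℕ => w⁻¹ * ((t : ℂ) * w⁻¹) ^ k) =
        fun k : ℕ => ((t ^ k : ℝ) : ℂ) * w⁻¹ ^ (k + 1) := by
      ext k
      push_cast
      ring
    rw [e3] at hg
    rw [hg.tsum_eq, ← mul_inv]
    congr 1
    field_simp
  simp only [e1] at h
  rwa [e2] at h

lemma hasSum_taylor {S : ℂ → ℂ} (hS : AnalyticAt ℂ S 0) :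
    ∀ᶠ v in 𝓝 (0 : ℂ), HasSum (fun n : ℕ => v ^ n * (iteratedDeriv n S 0 / (n ! : ℂ))) (S v) := by
  filter_upwards [hS.hasFPowerSeriesAt.eventually_hasSum] with v hv
  simpa [FormalMultilinearSeries.ofScalars, mul_comm] using hv

/-- A function is the R-transform as soon as the moment generating function inverts it. -/
theorem isRTransform_of_leftInverse [IsProbabilityMeasure mu] (hA0 : 0 ≤ A)
    (hA : mu (Set.Icc (-A) A)ᶜ = 0) {F S : ℂ → ℂ} (hF : AnalyticAt ℂ F 0) (hS : AnalyticAt ℂ S 0)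
    (hS0 : S 0 = 0) (hinv : ∀ᶠ z in 𝓝 0, S (reciprocalShift F z) = z)
    (hSc : ∀ k : ℕ, iteratedDeriv (k + 1) S 0 = ((k + 1)! : ℂ) * ((∫ t, t ^ k ∂mu : ℝ) : ℂ)) :
    IsRTransform mu F := by
  refine ⟨inferInstance, ⟨A, hA⟩, hF, ?_⟩
  have hφ := analyticAt_reciprocalShift hF
  have hφt : Tendsto (reciprocalShift F) (𝓝 0) (𝓝 0) := by
    have := hφ.continuousAt.tendsto
    rwa [reciprocalShift_zero] at this
  have hφne := eventually_ne_zero_of_deriv hφ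
    (by rw [deriv_reciprocalShift hF]; exact one_ne_zero)
  have hsmall : ∀ᶠ v in 𝓝 (0 : ℂ), ‖v‖ < (A + 1)⁻¹ := by
    have := Metric.ball_mem_nhds (0 : ℂ) (show 0 < (A + 1)⁻¹ by positivity)
    filter_upwards [this] with v hv
    simpa using hv
  filter_upwards [hφne, self_mem_nhdsWithin, nhdsWithin_le_nhds hinv,
    nhdsWithin_le_nhds (hφt.eventually hsmall),
    nhdsWithin_le_nhds (hφt.eventually (hasSum_taylor hS))] with z h1 h2 h3 h4 h5
  have hz0 : z ≠ 0 := h2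
  have hw : F z + 1 / z = (reciprocalShift F z)⁻¹ := by
    rw [reciprocalShift_eq_inv hz0, inv_inv, one_div]
  have hnorm : A < ‖F z + 1 / z‖ := by
    rw [hw, norm_inv]
    have := (lt_inv_comm₀ (norm_pos_iff.mpr h1) (by positivity)).mp h4
    linarith
  have hst := hasSum_stieltjes hA0 hA hnorm
  rw [hw] at hst
  simp only [inv_inv] at hst
  rw [← hw] at hst
  refine hst.unique ?_
  rw [h3] at h5
  -- The Taylor series of S has no constant term; with the index shifted by one its terms are those
  -- of the Stieltjes transform at w = 1/φ(z).
  have h6 := (hasSum_nat_add_iff' 1).mpr h5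
  simp only [Finset.range_one, Finset.sum_singleton, hS0, iteratedDeriv_zero, zero_div, mul_zero,
    sub_zero] at h6
  refine (congrArg (fun f => HasSum f _) (funext fun k => ?_)).mp h6
  have hk : ((k + 1)! : ℂ) ≠ 0 := by exact_mod_cast (k + 1).factorial_ne_zero
  rw [hSc, mul_div_cancel_left₀ _ hk, mul_comm]

end Stieltjes

/-! ### A compactly supported measure with the limit moments -/

section MomentProblem

/-- Truncation changes nothing where |t| ≤ A; elsewhere the error is at most 2|t|^k, and |t|/A > 1
raises the power to n. Evenness of n makes t^n = |t|^n. -/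
lemma abs_clamp_pow_sub_le {A : ℝ} (hA : 0 < A) (t : ℝ) {k n : ℕ} (hkn : k ≤ n) (hn : Even n) :
    |(max (-A) (min A t)) ^ k - t ^ k| ≤ 2 / A ^ (n - k) * t ^ n := by
  have htn : t ^ n = |t| ^ n := (hn.pow_abs t).symm
  rcases le_or_gt |t| A with h | h
  · have h1 := abs_le.mp h
    rw [min_eq_right h1.2, max_eq_right h1.1, sub_self, abs_zero, htn]
    positivity
  · have hc : |max (-A) (min A t)| = A := by
      rcases lt_abs.mp h with h1 | h1
      · rw [min_eq_left h1.le, max_eq_right (by linarith), abs_of_pos hA]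
      · rw [min_eq_right (by linarith), max_eq_left (by linarith), abs_neg, abs_of_pos hA]
    have h1 : |(max (-A) (min A t)) ^ k - t ^ k| ≤ A ^ k + |t| ^ k := by
      refine (abs_sub _ _).trans ?_
      rw [abs_pow, abs_pow, hc]
    have h2 : A ^ k ≤ |t| ^ k := by gcongr
    have h3 : A ^ (n - k) * |t| ^ k ≤ |t| ^ n := by
      calc A ^ (n - k) * |t| ^ k ≤ |t| ^ (n - k) * |t| ^ k := by gcongr
        _ = |t| ^ n := by rw [← pow_add, Nat.sub_add_cancel hkn]
    have h4 : |t| ^ k ≤ |t| ^ n / A ^ (n - k) := by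
      rw [le_div_iff₀ (by positivity), mul_comm]; exact h3
    rw [htn]
    calc _ ≤ 2 * (|t| ^ n / A ^ (n - k)) := by linarith
      _ = 2 / A ^ (n - k) * |t| ^ n := by ring

/-- Limits of moment sequences of probability measures that grow at most geometrically are the
moments of a compactly supported probability measure. -/
theorem exists_measure_of_tendsto_moments {nu : ℕ → Measure ℝ} [∀ n, IsProbabilityMeasure (nu n)]
    (hint : ∀ n k, Integrable (fun t : ℝ => t ^ k) (nu n)) {c : ℕ → ℝ}
    (hlim : ∀ k, Tendsto (fun n => ∫ t, t ^ k ∂nu n) atTop (𝓝 (c k))) {B D : ℝ} (hD : 0 ≤ D)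
    (hc : ∀ k, |c k| ≤ B * D ^ k) :
    ∃ mu : Measure ℝ, IsProbabilityMeasure mu ∧ mu (Set.Icc (-(D + 1)) (D + 1))ᶜ = 0 ∧
      ∀ k, ∫ t, t ^ k ∂mu = c k := by
  set A := D + 1 with hA
  have hA0 : 0 < A := by positivity
  have hAA : -A ≤ A := by linarith
  let K := Set.Icc (-A) A
  have hproj : Continuous (Set.projIcc (-A) A hAA) := continuous_projIcc
  let nuK : ℕ → ProbabilityMeasure K := fun n =>
    ⟨(nu n).map (Set.projIcc (-A) A hAA),
      Measure.isProbabilityMeasure_map hproj.measurable.aemeasurable⟩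
  -- Probability measures on the compact interval form a compact space, so the truncated measures
  -- converge along an ultrafilter.
  obtain ⟨muK, -, hmu⟩ := (isCompact_univ (X := ProbabilityMeasure K)).ultrafilter_le_nhds
    ((hyperfilter ℕ).map nuK) (by simp)
  have hU : Tendsto nuK (hyperfilter ℕ : Filter ℕ) (𝓝 muK) := hmu
  have hval : Measurable (Subtype.val : K → ℝ) := measurable_subtype_coe
  refine ⟨(muK : Measure K).map Subtype.val,
    Measure.isProbabilityMeasure_map hval.aemeasurable, ?_, fun k => ?_⟩
  · rw [Measure.map_apply hval measurableSet_Icc.compl]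
    have : (Subtype.val : K → ℝ) ⁻¹' (Set.Icc (-A) A)ᶜ = ∅ := by
      ext x; simp
    rw [this, measure_empty]
  · rw [integral_map hval.aemeasurable (by fun_prop)]
    have hk : Tendsto (fun n => ∫ t, (max (-A) (min A t)) ^ k ∂nu n) (hyperfilter ℕ : Filter ℕ)
        (𝓝 (∫ x : K, (x : ℝ) ^ k ∂(muK : Measure K))) := by
      let f : BoundedContinuousFunction K ℝ :=
        BoundedContinuousFunction.mkOfCompact ⟨fun x : K => (x : ℝ) ^ k, by fun_prop⟩
      have := (ProbabilityMeasure.tendsto_iff_forall_integral_tendsto.mp hU) f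
      refine this.congr fun n => ?_
      change ∫ x, f x ∂((nu n).map (Set.projIcc (-A) A hAA)) = _
      rw [integral_map hproj.measurable.aemeasurable f.continuous.aestronglyMeasurable]
      refine integral_congr_ae (Eventually.of_forall fun t => ?_)
      simp [f, Set.coe_projIcc]
    have hbound : ∀ j, k ≤ 2 * j →
        |(∫ x : K, (x : ℝ) ^ k ∂(muK : Measure K)) - c k| ≤ 2 / A ^ (2 * j - k) * c (2 * j) := by
      intro j hj
      have l1 := ((hk.sub ((hlim k).mono_left Nat.hyperfilter_le_atTop)).abs)
      have l2 := ((hlim (2 * j)).mono_left Nat.hyperfilter_le_atTop).const_mul (2 / A ^ (2 * j - k))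
      refine le_of_tendsto_of_tendsto' l1 l2 fun n => ?_
      have hcl : Integrable (fun t : ℝ => (max (-A) (min A t)) ^ k) (nu n) := by
        refine Integrable.of_bound (by fun_prop) (A ^ k) (Eventually.of_forall fun t => ?_)
        rw [Real.norm_eq_abs, abs_pow]
        gcongr
        exact abs_le.mpr ⟨le_max_left _ _, max_le hAA (min_le_left _ _)⟩
      rw [← integral_sub hcl (hint n k), ← integral_const_mul]
      refine (abs_integral_le_integral_abs).trans (integral_mono ((hcl.sub (hint n k)).abs)
        ((hint n (2 * j)).const_mul _) fun t => ?_)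
      exact abs_clamp_pow_sub_le hA0 t hj (even_two_mul j)
    -- The interval is larger than the growth rate D, so the truncation error, controlled by the
    -- moments of order 2j, vanishes as j → ∞.
    have hr : D / A < 1 := (div_lt_one hA0).mpr (by linarith)
    have hzero : Tendsto (fun j : ℕ => 2 * B * A ^ k * ((D / A) ^ 2) ^ j) atTop (𝓝 0) := by
      have := (tendsto_pow_atTop_nhds_zero_of_lt_one (r := (D / A) ^ 2) (by positivity)
        (pow_lt_one₀ (by positivity) hr (by norm_num))).const_mul (2 * B * A ^ k)
      simpa using this
    have hle : |(∫ x : K, (x : ℝ) ^ k ∂(muK : Measure K)) - c k| ≤ 0 := by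
      refine ge_of_tendsto hzero ?_
      filter_upwards [eventually_ge_atTop k] with j hj
      refine (hbound j (by omega)).trans ?_
      calc 2 / A ^ (2 * j - k) * c (2 * j) ≤ 2 / A ^ (2 * j - k) * (B * D ^ (2 * j)) := by
            gcongr
            exact (le_abs_self _).trans (hc _)
        _ = 2 * B * A ^ k * ((D / A) ^ 2) ^ j := by
            rw [← pow_mul, div_pow, show A ^ (2 * j) = A ^ (2 * j - k) * A ^ k by
              rw [← pow_add]; congr 1; omega]
            field_simp
    exact sub_eq_zero.mp (abs_nonpos_iff.mp hle)

end MomentProblem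

/-! ### Existence of the limit measure -/

section PPMeasure

variable {N : ℕ} {q : ℝ}

/-- The weights sum to N by the lowest coefficient of the recursion, after division by q; for q = 0
every weight is 1. -/
lemma ppMoment_zero_right (hN : N ≠ 0) (q : ℝ) (l : Signature N) : ppMoment q 0 l = 1 := by
  rcases eq_or_ne q 0 with rfl | hq
  · rw [ppMoment_zero_left, countingMoment_zero hN]
  · have hNr : (N : ℝ) ≠ 0 := by exact_mod_cast hN
    have h := ppCoeff_recursion hN q l 0
    have h1 : ppLogCoeff q 0 l = q := by
      simp only [ppLogCoeff, zero_add, pow_one, add_sub_cancel_left, Finset.sum_const,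
        Finset.card_univ, Fintype.card_fin, nsmul_eq_mul]
      field_simp
    rw [Finset.HasAntidiagonal.antidiagonal_zero, Finset.sum_singleton, h1] at h
    simp only [ppCoeff, Nat.cast_zero, zero_add, one_mul, neg_mul, neg_inj] at h
    exact mul_left_cancel₀ hq (by linarith)

lemma isProbabilityMeasure_ppMeasure (hN : N ≠ 0) (hq : q ∈ Set.Icc (-1 : ℝ) 1)
    (l : Signature N) : IsProbabilityMeasure (ppMeasure q l) := by
  refine ⟨?_⟩
  have h := ppMoment_zero_right hN q l
  simp only [ppMoment, pow_zero, mul_one] at h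
  simp only [ppMeasure, Measure.coe_finsetSum, Finset.sum_apply, Measure.smul_apply,
    measure_univ, smul_eq_mul, mul_one]
  rw [← ENNReal.ofReal_sum_of_nonneg fun i _ => mul_nonneg (by positivity) (ppWeight_nonneg hq l i),
    h, ENNReal.ofReal_one]

lemma integrable_ppMeasure (l : Signature N) (f : ℝ → ℝ) : Integrable f (ppMeasure q l) := by
  rw [ppMeasure, integrable_finsetSum_measure]
  exact fun i _ => (integrable_dirac (by simp)).smul_measure ENNReal.ofReal_ne_top

end PPMeasure

section Choice

variable {rho : (N : ℕ) → PMF (Signature N)}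

/-- Finitely many sequences converging in probability are simultaneously close to their limits at
some point. -/
lemma exists_abs_sub_lt_of_tendstoInProb {X : ℕ → (N : ℕ) → Signature N → ℝ} {c : ℕ → ℝ}
    (h : ∀ k, TendstoInProb rho (X k) (c k)) (n : ℕ) {ε : ℝ} (hε : 0 < ε) :
    ∃ N : ℕ, N ≠ 0 ∧ ∃ l : Signature N, ∀ k ≤ n, |X k N l - c k| < ε := by
  have h1 : Tendsto (fun N => ∑ k ∈ Finset.range (n + 1),
      (rho N).toMeasure {l | ε ≤ |X k N l - c k|}) atTop (𝓝 0) := by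
    have := tendsto_finsetSum (Finset.range (n + 1)) fun k _ => h k ε hε
    simpa using this
  obtain ⟨N, hN, hN0⟩ := ((h1.eventually (gt_mem_nhds one_pos)).and (eventually_ne_atTop 0)).exists
  refine ⟨N, hN0, ?_⟩
  by_contra! hc
  have h2 : (Set.univ : Set (Signature N)) ⊆
      ⋃ k ∈ Finset.range (n + 1), {l | ε ≤ |X k N l - c k|} := fun l _ => by
    obtain ⟨k, hk, hl⟩ := hc l
    simp only [Set.mem_iUnion]
    exact ⟨k, Finset.mem_range.mpr (by omega), hl⟩
  have h3 := (measure_mono h2).trans (measure_biUnion_finset_le (μ := (rho N).toMeasure) _ _)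
  rw [measure_univ] at h3
  exact absurd hN (not_lt.mpr h3)

end Choice

/-- Cauchy's estimate for the Taylor coefficients of an analytic function. -/
lemma exists_norm_iteratedDeriv_le {S : ℂ → ℂ} (hS : AnalyticAt ℂ S 0) :
    ∃ B D : ℝ, 0 ≤ D ∧ ∀ k, ‖iteratedDeriv (k + 1) S 0‖ ≤ ((k + 1)! : ℝ) * (B * D ^ k) := by
  obtain ⟨r, hr, hd⟩ := Metric.eventually_nhds_iff_ball.mp hS.eventually_analyticAt
  have hr2 : 0 < r / 2 := by positivity
  have hsub : Metric.closedBall (0 : ℂ) (r / 2) ⊆ Metric.ball 0 r :=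
    Metric.closedBall_subset_ball (by linarith)
  have hdiff : DifferentiableOn ℂ S (Metric.closedBall 0 (r / 2)) := fun z hz =>
    (hd z (hsub hz)).differentiableAt.differentiableWithinAt
  obtain ⟨M, hM⟩ := (isCompact_closedBall (0 : ℂ) (r / 2)).exists_bound_of_continuousOn
    hdiff.continuousOn
  refine ⟨M * (r / 2)⁻¹, (r / 2)⁻¹, by positivity, fun k => ?_⟩
  rw [iteratedDeriv_eq_contourInt hr2 _ hdiff, norm_mul, Complex.norm_natCast]
  refine mul_le_mul_of_nonneg_left ((norm_contourInt_le
    (B := ((r / 2) ^ (k + 2))⁻¹ * M) hr2.le fun z hz => ?_).trans_eq ?_) (by positivity)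
  · rw [norm_mul, norm_div, norm_one, norm_pow, hz, one_div]
    exact mul_le_mul_of_nonneg_left (hM z (by simp [hz])) (by positivity)
  · generalize r / 2 = s at hr2 ⊢
    rw [inv_pow, pow_add]
    field_simp

variable {rho : (N : ℕ) → PMF (Signature N)} {Psi : ℂ → ℂ}

/-- The limit of the `q`-deformed Perelomov-Popov measures. -/
theorem LogSchurGenTendsto.exists_limit_ppMeasure (h : LogSchurGenTendsto rho Psi)
    (hPsi : AnalyticAt ℂ Psi 1)
    (h_conv : ∀ N : ℕ, ∃ V ∈ 𝓝 (1 : Fin N → ℂ), SummableUniformlyOn (schurTerm (rho N)) V)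
    {q : ℝ} (hq : q ∈ Set.Icc (-1 : ℝ) 1) :
    ∃ mu : Measure ℝ, IsRTransform mu (qFun q Psi) ∧
      ∀ k, ((∫ t, t ^ k ∂mu : ℝ) : ℂ) = freeMoment (qFun q Psi) k ∧
        TendstoInProb rho (fun _ l => ppMoment q k l) (∫ t, t ^ k ∂mu) := by
  choose c hc hcl using h.exists_tendstoInProb_ppMoment hPsi h_conv q
  have hF := (qFun_spec hPsi q).1
  obtain ⟨S, hSa, hS0, hSinv, hSc⟩ := exists_inverse_reciprocalShift hF
  obtain ⟨B, D, hD, hB⟩ := exists_norm_iteratedDeriv_le hSa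
  have hcB : ∀ k, |c k| ≤ B * D ^ k := fun k => by
    have := hB k
    rw [hSc, ← hc, norm_mul, Complex.norm_natCast, Complex.norm_real, Real.norm_eq_abs] at this
    exact le_of_mul_le_mul_left this (by positivity)
  -- Diagonal choice of deterministic signatures: the n-th one has its first n moments within 1/(n +
  -- 1) of the limits. Thus the limits are realized along an actual sequence of probability
  -- measures.
  choose N hN l hl using fun n : ℕ =>
    exists_abs_sub_lt_of_tendstoInProb hcl n (ε := 1 / ((n : ℝ) + 1)) (by positivity)
  have hprob : ∀ n, IsProbabilityMeasure (ppMeasure q (l n)) := fun n =>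
    isProbabilityMeasure_ppMeasure (hN n) hq (l n)
  obtain ⟨mu, hmu, hsupp, hmom⟩ := exists_measure_of_tendsto_moments
    (nu := fun n => ppMeasure q (l n)) (fun n k => integrable_ppMeasure (l n) _) (c := c)
    (fun k => by
      rw [tendsto_iff_dist_tendsto_zero]
      refine squeeze_zero' (.of_forall fun n => dist_nonneg) ?_ tendsto_one_div_add_atTop_nhds_zero_nat
      filter_upwards [eventually_ge_atTop k] with n hn
      rw [integral_pow_ppMeasure hq, Real.dist_eq]
      exact (hl n k hn).le) hD hcB
  refine ⟨mu, isRTransform_of_leftInverse (by positivity) hsupp hF hSa hS0 hSinv fun k => ?_,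
    fun k => ?_⟩
  · rw [hSc, hmom, hc]
  · rw [hmom]
    exact ⟨hc k, hcl k⟩

/-! ### The beta distribution and its R-transform -/

section BetaMoments

lemma Gamma_add_natCast {a : ℝ} (ha : 0 < a) (k : ℕ) :
    Real.Gamma (a + k) = (∏ i ∈ Finset.range k, (a + i)) * Real.Gamma a := by
  induction k with
  | zero => simp
  | succ k ih =>
    rw [Nat.cast_succ, ← add_assoc, Real.Gamma_add_one (by positivity), ih,
      Finset.prod_range_succ]
    ring

variable {a b : ℝ}

lemma betaPDFReal_nonneg (ha : 0 < a) (hb : 0 < b) (x : ℝ) : 0 ≤ betaPDFReal a b x := by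
  by_cases h : 0 < x ∧ x < 1
  · exact (betaPDFReal_pos h.1 h.2 ha hb).le
  · rw [betaPDFReal, if_neg h]

lemma integral_betaPDFReal (ha : 0 < a) (hb : 0 < b) : ∫ x, betaPDFReal a b x = 1 := by
  rw [integral_eq_lintegral_of_nonneg_ae (.of_forall (betaPDFReal_nonneg ha hb))
    (measurable_betaPDFReal a b).aestronglyMeasurable]
  have := lintegral_betaPDF_eq_one ha hb
  simp only [betaPDF] at this
  rw [this, ENNReal.toReal_one]

lemma betaPDFReal_mul_pow (ha : 0 < a) (hb : 0 < b) (k : ℕ) (x : ℝ) :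
    betaPDFReal a b x * x ^ k = beta (a + k) b / beta a b * betaPDFReal (a + k) b x := by
  by_cases h : 0 < x ∧ x < 1
  · have h1 := (beta_pos ha hb).ne'
    have h2 := (beta_pos (α := a + k) (by positivity) hb).ne'
    rw [betaPDFReal, if_pos h, betaPDFReal, if_pos h, show a + k - 1 = (a - 1) + k by ring,
      Real.rpow_add h.1, Real.rpow_natCast]
    field_simp
  · simp [betaPDFReal, if_neg h]

lemma integral_pow_betaMeasure (ha : 0 < a) (hb : 0 < b) (k : ℕ) :
    ∫ x, x ^ k ∂betaMeasure a b = beta (a + k) b / beta a b := by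
  rw [betaMeasure, integral_withDensity_eq_integral_toReal_smul (f := betaPDF a b)
    (measurable_betaPDFReal a b).ennreal_ofReal (.of_forall fun x => ENNReal.ofReal_lt_top)]
  simp only [betaPDF, ENNReal.toReal_ofReal (betaPDFReal_nonneg ha hb _), smul_eq_mul,
    betaPDFReal_mul_pow ha hb]
  rw [integral_const_mul, integral_betaPDFReal (by positivity) hb, mul_one]

lemma betaMeasure_compl_Icc (a b : ℝ) : betaMeasure a b (Set.Icc (-1) 1)ᶜ = 0 := by
  rw [betaMeasure, withDensity_apply _ measurableSet_Icc.compl]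
  refine setLIntegral_eq_zero measurableSet_Icc.compl fun x hx => ?_
  rcases le_or_gt x 0 with h | h
  · exact betaPDF_eq_zero_of_nonpos h
  · refine betaPDF_eq_zero_of_one_le (not_lt.mp fun h1 => hx ⟨by linarith, h1.le⟩)

variable {q : ℝ}

lemma isProbabilityMeasure_betaLaw (hq : q ∈ Set.Icc (-1 : ℝ) 1) :
    IsProbabilityMeasure (betaLaw q) := by
  unfold betaLaw
  split_ifs with h1 h2
  · infer_instance
  · infer_instance
  · exact isProbabilityMeasureBeta (sub_pos.mpr (lt_of_le_of_ne hq.2 h1))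
      (by linarith [lt_of_le_of_ne hq.1 (Ne.symm h2)])

lemma betaLaw_compl_Icc (q : ℝ) : betaLaw q (Set.Icc (-1) 1)ᶜ = 0 := by
  unfold betaLaw
  split_ifs with h1 h2
  · rw [Measure.dirac_apply' _ measurableSet_Icc.compl]
    simp
  · rw [Measure.dirac_apply' _ measurableSet_Icc.compl]
    simp
  · exact betaMeasure_compl_Icc _ _

/-- A ratio of beta functions is a ratio of rising factorials of 1 - q and 2, the latter being (k +
1)!. The same formula covers both point masses: at q = 1 the product vanishes for k ≥ 1, at q = -1
it equals (k + 1)!. -/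
lemma integral_pow_betaLaw (hq : q ∈ Set.Icc (-1 : ℝ) 1) (k : ℕ) :
    ∫ t, t ^ k ∂betaLaw q = (∏ i ∈ Finset.range k, (1 - q + i)) / ((k + 1)! : ℝ) := by
  unfold betaLaw
  split_ifs with h1 h2
  · subst h1
    rw [integral_dirac]
    cases k with
    | zero => simp
    | succ k => rw [Finset.prod_range_succ']; simp
  · subst h2
    rw [integral_dirac, one_pow, eq_div_iff (by positivity), one_mul]
    induction k with
    | zero => simp
    | succ k ih =>
      rw [Finset.prod_range_succ, ← ih, Nat.factorial_succ (k + 1)]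
      push_cast
      ring
  · have ha : 0 < 1 - q := sub_pos.mpr (lt_of_le_of_ne hq.2 h1)
    have hb : 0 < 1 + q := by linarith [lt_of_le_of_ne hq.1 (Ne.symm h2)]
    rw [integral_pow_betaMeasure ha hb, beta, beta, Gamma_add_natCast ha,
      show 1 - q + k + (1 + q) = ((k + 1 : ℕ) : ℝ) + 1 by push_cast; ring,
      show 1 - q + (1 + q) = ((1 : ℕ) : ℝ) + 1 by push_cast; ring,
      Real.Gamma_nat_eq_factorial, Real.Gamma_nat_eq_factorial]
    have h3 := (Real.Gamma_pos_of_pos ha).ne'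
    have h4 := (Real.Gamma_pos_of_pos hb).ne'
    have h5 : ((k + 1)! : ℝ) ≠ 0 := by positivity
    field_simp
    simp

end BetaMoments

section BetaRTransform

lemma eventually_one_sub_mem_slitPlane : ∀ᶠ v in 𝓝 (0 : ℂ), 1 - v ∈ Complex.slitPlane := by
  have : ContinuousAt (fun v : ℂ => 1 - v) 0 := by fun_prop
  exact this.eventually_mem (Complex.isOpen_slitPlane.mem_nhds (by simp))

lemma hasDerivAt_log_one_sub {v : ℂ} (hv : 1 - v ∈ Complex.slitPlane) :
    HasDerivAt (fun v : ℂ => Complex.log (1 - v)) (-(1 - v)⁻¹) v := by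
  have h := ((hasDerivAt_id v).const_sub 1).clog hv
  rwa [neg_div, one_div] at h

lemma hasDerivAt_exp_mul_log_one_sub (a : ℂ) {v : ℂ} (hv : 1 - v ∈ Complex.slitPlane) :
    HasDerivAt (fun v : ℂ => Complex.exp (-a * Complex.log (1 - v)))
      (a * Complex.exp (-(a + 1) * Complex.log (1 - v))) v := by
  have h := ((hasDerivAt_log_one_sub hv).const_mul (-a)).cexp
  have e : Complex.exp (-(a + 1) * Complex.log (1 - v)) =
      Complex.exp (-a * Complex.log (1 - v)) * (1 - v)⁻¹ := by
    rw [show -(a + 1) * Complex.log (1 - v) = -a * Complex.log (1 - v) + -Complex.log (1 - v) by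
      ring, Complex.exp_add, Complex.exp_neg, Complex.exp_log (Complex.slitPlane_ne_zero hv)]
  rw [e]
  refine h.congr_deriv ?_
  ring

lemma iteratedDeriv_exp_mul_log_one_sub (a : ℂ) (k : ℕ) :
    iteratedDeriv k (fun v : ℂ => Complex.exp (-a * Complex.log (1 - v))) =ᶠ[𝓝 0]
      fun v => (∏ i ∈ Finset.range k, (a + i)) *
        Complex.exp (-(a + k) * Complex.log (1 - v)) := by
  induction k with
  | zero => simp
  | succ k ih =>
    rw [iteratedDeriv_succ]
    filter_upwards [ih.deriv, eventually_one_sub_mem_slitPlane] with v h hv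
    rw [h, ((hasDerivAt_exp_mul_log_one_sub (a + k) hv).const_mul _).deriv,
      Finset.prod_range_succ]
    push_cast
    ring_nf

/-- The left inverse of the reciprocal of `z ↦ e_q(z) / (e_q(z) - 1)`. -/
def betaInverse (q : ℝ) (v : ℂ) : ℂ :=
  if q = 0 then -Complex.log (1 - v) else (1 - Complex.exp (q * Complex.log (1 - v))) / q

lemma betaInverse_zero (q : ℝ) : betaInverse q 0 = 0 := by
  unfold betaInverse; split_ifs <;> simp

lemma hasDerivAt_betaInverse (q : ℝ) {v : ℂ} (hv : 1 - v ∈ Complex.slitPlane) :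
    HasDerivAt (betaInverse q) (Complex.exp (-(1 - q) * Complex.log (1 - v))) v := by
  unfold betaInverse
  split_ifs with h
  · refine (hasDerivAt_log_one_sub hv).neg.congr_deriv ?_
    rw [h, Complex.ofReal_zero, sub_zero, neg_one_mul, Complex.exp_neg,
      Complex.exp_log (Complex.slitPlane_ne_zero hv), neg_neg]
  · have hq : (q : ℂ) ≠ 0 := by exact_mod_cast h
    have h1 := ((hasDerivAt_exp_mul_log_one_sub (-q) hv).const_sub 1).div_const (q : ℂ)
    rw [neg_neg] at h1
    refine h1.congr_deriv ?_
    rw [show -(-(q : ℂ) + 1) = -(1 - q) by ring]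
    field_simp

lemma analyticAt_betaInverse (q : ℝ) : AnalyticAt ℂ (betaInverse q) 0 := by
  rw [Complex.analyticAt_iff_eventually_differentiableAt]
  filter_upwards [eventually_one_sub_mem_slitPlane] with v hv
  exact (hasDerivAt_betaInverse q hv).differentiableAt

/-- The derivative of `betaInverse q` is (1 - v)^{-(1-q)}, whose derivatives at 0 are the rising
factorials of 1 - q, as in the beta moments. -/
lemma iteratedDeriv_betaInverse (q : ℝ) (k : ℕ) :
    iteratedDeriv (k + 1) (betaInverse q) 0 =
      ((∏ i ∈ Finset.range k, (1 - q + i) : ℝ) : ℂ) := by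
  have h : deriv (betaInverse q) =ᶠ[𝓝 0]
      fun v => Complex.exp (-(1 - q : ℂ) * Complex.log (1 - v)) := by
    filter_upwards [eventually_one_sub_mem_slitPlane] with v hv
    exact (hasDerivAt_betaInverse q hv).deriv
  rw [iteratedDeriv_succ', h.iteratedDeriv_eq, (iteratedDeriv_exp_mul_log_one_sub _ k).self_of_nhds]
  simp

lemma qFun_of_ne (q : ℝ) (Psi : ℂ → ℂ) {z : ℂ} (hz : z ≠ 0) :
    qFun q Psi z =
      qExp q z * deriv Psi (qExp q z) + qExp q z / (qExp q z - 1) - 1 / z := by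
  rw [qFun, Function.update_of_ne hz]

lemma qFun_zero_of_ne (q : ℝ) {z : ℂ} (hz : z ≠ 0) :
    qFun q 0 z = qExp q z / (qExp q z - 1) - 1 / z := by
  rw [qFun_of_ne q 0 hz, show deriv (0 : ℂ → ℂ) = 0 from deriv_zero, Pi.zero_apply, mul_zero,
    zero_add]

lemma betaInverse_reciprocalShift (q : ℝ) :
    ∀ᶠ z in 𝓝 (0 : ℂ), betaInverse q (reciprocalShift (qFun q 0) z) = z := by
  have hT := (analyticAt_qLog q).continuousAt.tendsto
  rw [qLog_zero] at hT
  have him : ∀ᶠ s in 𝓝 (0 : ℂ), |s.im| < Real.pi :=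
    (show ContinuousAt (fun s : ℂ => |s.im|) 0 by fun_prop).eventually_mem
      (Iio_mem_nhds (by simpa using Real.pi_pos))
  have h2 : ∀ᶠ z in 𝓝 (0 : ℂ), q ≠ 0 → Complex.exp (-q * qLog q z) = 1 - q * z := by
    rcases eq_or_ne q 0 with h | h
    · exact .of_forall fun z h' => absurd h h'
    · exact (one_sub_exp_qLog q h).mono fun z hz _ => hz
  filter_upwards [exp_qLog q, h2, hT.eventually him] with z h1 h2 h3
  rcases eq_or_ne z 0 with rfl | hz
  · rw [reciprocalShift_zero, betaInverse_zero]
  -- The reciprocal of e_q/(e_q - 1) is 1 - 1/e_q, so the argument of the logarithm is 1/e_q(z).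
  have e1 : 1 - reciprocalShift (qFun q 0) z = Complex.exp (-qLog q z) := by
    rw [reciprocalShift_eq_inv hz, qFun_zero_of_ne q hz, one_div, sub_add_cancel, inv_div,
      sub_div, div_self (h1 ▸ Complex.exp_ne_zero _), sub_sub_cancel, Complex.exp_neg, h1, one_div]
  -- The principal logarithm undoes the exponential because the imaginary part of log e_q(z) is
  -- small near 0.
  have e2 : Complex.log (1 - reciprocalShift (qFun q 0) z) = -qLog q z := by
    rw [e1, Complex.log_exp]
    · rw [Complex.neg_im]; linarith [(abs_lt.mp h3).2]
    · rw [Complex.neg_im]; linarith [(abs_lt.mp h3).1]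
  unfold betaInverse
  rw [e2]
  split_ifs with h
  · simp [h, qLog]
  · have hq : (q : ℂ) ≠ 0 := by exact_mod_cast h
    rw [mul_neg, ← neg_mul, h2 h, sub_sub_cancel, mul_div_cancel_left₀ _ hq]

/-- The `R`-transform of the beta distribution. -/
theorem isRTransform_betaLaw {q : ℝ} (hq : q ∈ Set.Icc (-1 : ℝ) 1) :
    IsRTransform (betaLaw q) (qFun q 0) := by
  have := isProbabilityMeasure_betaLaw hq
  refine isRTransform_of_leftInverse zero_le_one (betaLaw_compl_Icc q)
    (qFun_spec analyticAt_const q).1 (analyticAt_betaInverse q) (betaInverse_zero q)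
    (betaInverse_reciprocalShift q) fun k => ?_
  rw [iteratedDeriv_betaInverse, integral_pow_betaLaw hq]
  have h : ((k + 1)! : ℂ) ≠ 0 := by exact_mod_cast (k + 1).factorial_ne_zero
  rw [Complex.ofReal_div, Complex.ofReal_natCast, mul_div_cancel₀ _ h]

/-- The additive splitting of the limiting `R`-transform. -/
lemma qFun_eq_add {Psi : ℂ → ℂ} (hPsi : AnalyticAt ℂ Psi 1) (q : ℝ) :
    ∀ᶠ z in 𝓝 (0 : ℂ),
      qFun q Psi z = qExp q z * deriv Psi (qExp q z) + qFun q 0 z := by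
  have h1 : AnalyticAt ℂ (fun z => qExp q z * deriv Psi (qExp q z) + qFun q 0 z) 0 := by
    refine ((analyticAt_qExp q).mul (AnalyticAt.fun_comp ?_ (analyticAt_qExp q))).add
      (qFun_spec analyticAt_const q).1
    rw [qExp_zero]
    exact hPsi.deriv
  refine ((qFun_spec hPsi q).1.frequently_eq_iff_eventually_eq h1).mp ?_
  refine Eventually.frequently ?_
  filter_upwards [self_mem_nhdsWithin] with z hz
  rw [qFun_of_ne q Psi hz, qFun_zero_of_ne q hz]
  ring

end BetaRTransform

end PerelomovPopov

end

theorem theorem14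
    (rho : (N : ℕ) → PMF (PerelomovPopov.Signature N))
    (h_conv : ∀ N : ℕ, ∃ V ∈ 𝓝 (1 : Fin N → ℂ),
      SummableUniformlyOn (PerelomovPopov.schurTerm (rho N)) V)
    (Psi : ℂ → ℂ) (hPsi : AnalyticAt ℂ Psi 1)
    (h_log : PerelomovPopov.LogSchurGenTendsto rho Psi)
    (q : ℝ) (hq : q ∈ Set.Icc (-1 : ℝ) 1) :
    ∃ mu : Measure ℝ, IsProbabilityMeasure mu ∧ PerelomovPopov.CompactlySupported mu ∧
      (∀ k : ℕ, 1 ≤ k →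
        ((∫ t, t ^ k ∂mu : ℝ) : ℂ) = PerelomovPopov.limitMoment q Psi k ∧
        ∀ ε : ℝ, 0 < ε →
          Tendsto
            (fun N : ℕ => (rho N).toMeasure
              {l | ε ≤ |(∫ t, t ^ k ∂(PerelomovPopov.ppMeasure q l)) - ∫ t, t ^ k ∂mu|})
            atTop (𝓝 0)) ∧
      ∃ R Rbeta : ℂ → ℂ,
        PerelomovPopov.IsRTransform mu R ∧
        PerelomovPopov.IsRTransform (PerelomovPopov.betaLaw q) Rbeta ∧
        (∀ᶠ z in 𝓝 (0 : ℂ),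
          R z = PerelomovPopov.qExp q z * deriv Psi (PerelomovPopov.qExp q z) + Rbeta z) ∧
        (∀ᶠ z in 𝓝[≠] (0 : ℂ),
          Rbeta z = PerelomovPopov.qExp q z / (PerelomovPopov.qExp q z - 1) - 1 / z) := by
  obtain ⟨mu, hmu, hmom⟩ := h_log.exists_limit_ppMeasure hPsi h_conv hq
  refine ⟨mu, hmu.1, hmu.2.1, fun k hk => ⟨?_, fun ε hε => ?_⟩,
    PerelomovPopov.qFun q Psi, PerelomovPopov.qFun q 0, hmu,
    PerelomovPopov.isRTransform_betaLaw hq, PerelomovPopov.qFun_eq_add hPsi q, ?_⟩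
  · rw [PerelomovPopov.limitMoment_eq_freeMoment q Psi hk, (hmom k).1]
  · simp only [PerelomovPopov.integral_pow_ppMeasure hq]
    exact (hmom k).2 ε hε
  · filter_upwards [self_mem_nhdsWithin] with z hz
    exact PerelomovPopov.qFun_zero_of_ne q hz
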